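/- **Notation.** Let $m\ge 1$, and let $\mathbb{R}_{0,m}$ be the real Clifford algebra generated by $e_1,\dots,e_m$ with $e_j^2=-1$ and $e_je_k=-e_ke_j$ for $j\ne k$. Identify $x=(x_0,\dots,x_m)\in\mathbb{R}^{m+1}$ with the paravector $x=x_0+\underline{x}$, $\underline{x}=\sum_{j=1}^m x_je_j$, and put $r=|\underline{x}|$, $\bar x=x_0-\underline{x}$. Let $R\subset\mathbb{R}^m\setminus\{0\}$ (seen in $\mathbb{R}^{m+1}$ as the vectors with zero $0$-th coordinate) be a root system: a finite set with $R\cap\mathbb{R}\underline\alpha=\{\underline\alpha,-\underline\alpha\}$ and $\sigma_{\underline\alpha}R=R$ for all $\underline\alpha\in R$, where $\sigma_{\underline\alpha}x=x-2\frac{\langle\underline\alpha,x\rangle}{|\underline\alpha|^2}\underline\alpha$. Let $R_+$ be a positive subsystem (the roots on one side of a hyperplane through the origin that contains no root), let $\kappa:R\to\mathbb{R}$ be a multiplicity function (invariant under the group generated by the reflections), and let $\gamma_\kappa=\sum_{\underline\alpha\in R_+}\kappa(\underline\alpha)$. For a $C^1$ function $f$ put $$\rho_{\underline\alpha}f(x)=\frac{f(x)-f(\sigma_{\underline\alpha}x)}{\langle\underline\alpha,x\rangle}\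 \text{ if }\langle\underline\alpha,x\rangle\neq0,\qquad \rho_{\underline\alpha}f(x)=\frac{2}{|\underline\alpha|^2}\,\partial_{\underline\alpha}f(x)\ \text{ if }\langle\underline\alpha,x\rangle=0$$ (the second value is the limit of the first). The Dunkl operators are $T_i=\partial_{x_i}+\sum_{\underline\alpha\in R_+}\kappa(\underline\alpha)\,\alpha_i\,\rho_{\underline\alpha}$, $i=0,\dots,m$. The singular set $K^{\rm sing}$ is the set of all $\kappa$ for which the bilinear form $[p,q]_\kappa=(p(T)q)(0)$ on real polynomials on $\mathbb{R}^{m+1}$ is degenerate. The spherical Dirac operator and the Dunkl-spherical Dirac operator are $$\Gamma_{\underline\omega}=-\sum_{1\le i<j\le m}e_ie_j(x_i\partial_{x_j}-x_j\partial_{x_i}),\qquad \widetilde\Gamma_{\underline\omega}=\gamma_\kappa+\Gamma_{\underline\omega}+\Psi,$$ $$\Psi f(x)=-\sum_{1\le i<j\le m}e_ie_j\sum_{\underline\alpha\in R_+}\kappa(\underline\alpha)(x_i\alpha_j-x_j\alpha_i)\,\rho_{\underline\alpha}f(x)-\sum_{\underline\alpha\in R_+}\kappa(\underline\alpha)f(\sigma_{\underline\alpha}x).$$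 Let $D\subset\mathbb{C}$ be open and symmetric with respect to the real axis, and let $\Omega_D=\{a+\underline\omega b:\ a+ib\in D,\ \underline\omega\in\mathbb{S}^{m-1}\}\subset\mathbb{R}^{m+1}$. A function $f:\Omega_D\to\mathbb{R}_{0,m}$ is *slice* if there are $\alpha,\beta:D\to\mathbb{R}_{0,m}$ with $\alpha(\bar z)=\alpha(z)$, $\beta(\bar z)=-\beta(z)$ on $D$, and $f(x)=\alpha(x_0,r)+\underline\omega\,\beta(x_0,r)$ for all $x=x_0+\underline\omega r\in\Omega_D$, $\underline\omega\in\mathbb{S}^{m-1}$, $r=|\underline x|$. The spherical derivative is $f'_s(x)=\underline{x}^{-1}(f(x)-f(\bar x))/2$ for $\underline x\neq0$. **Proposition (Characterization of sliceness).** Let $f:\Omega_D\to\mathbb{R}_{0,m}$ be real analytic, and suppose that $\gamma_\kappa=(1-m)/2$ and $\kappa\notin K^{\rm sing}$. Then the following are equivalent: 1. $f$ is slice; 2. $\widetilde\Gamma_{\underline\omega}f=0$ on $\Omega_D\setminus\mathbb{R}$. If these conditions hold, then on $\Omega_D\setminus\mathbb{R}$, for every $\underline\alpha\in R$, $$\Gamma_{\underline\omega}f=\gamma_\kappa\,\underline{x}\,\underline\alpha\,\rho_{\underline\alpha}f=-2\gamma_\kappa\,\underline{x}f'_s,$$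 and $\underline\alpha\,\rho_{\underline\alpha}f$ does not depend on $\underline\alpha\in R$. -/

import Mathlib

noncomputable section

/-! ### Root systems and Dunkl operators on `ℝ^{m+1}` (coordinates `x_0, …, x_m`) -/

/-- The space `ℝ^{m+1}` of paravectors `x = x_0 + x_1 e_1 + ⋯ + x_m e_m`. -/
abbrev Paravec (m : ℕ) : Type := EuclideanSpace ℝ (Fin (m + 1))

/-- The reflection `σ_α x = x - 2 ⟨α, x⟩ / |α|² α`. -/
def reflect {m : ℕ} (α x : Paravec m) : Paravec m :=
  x - (2 * inner ℝ α x / ‖α‖ ^ 2) • α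

/-- `R` is a (reduced, not necessarily crystallographic or spanning) root system. -/
structure IsRootSystem {m : ℕ} (R : Finset (Paravec m)) : Prop where
  ne_zero : ∀ α ∈ R, α ≠ 0
  inter_line : ∀ α ∈ R, {β : Paravec m | β ∈ R ∧ ∃ c : ℝ, β = c • α} = {α, -α}
  reflect_image : ∀ α ∈ R, reflect α '' (R : Set (Paravec m)) = (R : Set (Paravec m))

/-- `Rp` consists of the roots on one side of a hyperplane through the origin that contains no
root. -/
def IsPositiveSubsystem {m : ℕ} (R Rp : Finset (Paravec m)) : Prop :=
  ∃ v : Paravec m, (∀ α ∈ R, inner ℝ v α ≠ 0) ∧ ∀ α, α ∈ Rp ↔ α ∈ R ∧ 0 < inner ℝ v α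

/-- `κ` is invariant on `R` under the group generated by the reflections. Only the values of `κ`
on `R` matter. -/
def IsMultiplicity {m : ℕ} (R : Finset (Paravec m)) (κ : Paravec m → ℝ) : Prop :=
  ∀ α ∈ R, ∀ β ∈ R, κ (reflect α β) = κ β

/-- The index `γ_κ`, the sum of `κ` over the positive roots. -/
def dunklIndex {m : ℕ} (Rp : Finset (Paravec m)) (κ : Paravec m → ℝ) : ℝ :=
  ∑ α ∈ Rp, κ α

/-- The difference quotient `ρ_α f (x) = (f x - f (σ_α x)) / ⟨α, x⟩`. On the hyperplane
`⟨α, x⟩ = 0` it is given its limiting value `(2 / |α|²) ∂_α f (x)`, so that `ρ_α f` is continuous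
for every `f` of class `C¹`. -/
def rho {m : ℕ} {F : Type*} [NormedAddCommGroup F] [NormedSpace ℝ F]
    (α : Paravec m) (f : Paravec m → F) (x : Paravec m) : F :=
  if inner ℝ α x = 0 then (2 / ‖α‖ ^ 2) • fderiv ℝ f x α
  else (inner ℝ α x)⁻¹ • (f x - f (reflect α x))

/-- The partial derivative `∂f/∂x_i`. -/
def partialDeriv {m : ℕ} {F : Type*} [NormedAddCommGroup F] [NormedSpace ℝ F]
    (i : Fin (m + 1)) (f : Paravec m → F) (x : Paravec m) : F :=
  fderiv ℝ f x (EuclideanSpace.single i 1)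

/-- The Dunkl operator `T_i`. -/
def dunklOp {m : ℕ} (Rp : Finset (Paravec m)) (κ : Paravec m → ℝ) (i : Fin (m + 1))
    (f : Paravec m → ℝ) (x : Paravec m) : ℝ :=
  partialDeriv i f x + ∑ α ∈ Rp, κ α * rho α f x * α i

/-- The operator `T_0^{a_0} T_1^{a_1} ⋯ T_m^{a_m}`. -/
def dunklMonomial {m : ℕ} (Rp : Finset (Paravec m)) (κ : Paravec m → ℝ) (a : Fin (m + 1) →₀ ℕ)
    (f : Paravec m → ℝ) : Paravec m → ℝ :=
  (List.finRange (m + 1)).foldr (fun i g => (dunklOp Rp κ i)^[a i] g) f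

/-- The Fischer product `[p, q]_κ = (p(T) q)(0)`. -/
def fischerProduct {m : ℕ} (Rp : Finset (Paravec m)) (κ : Paravec m → ℝ)
    (p q : MvPolynomial (Fin (m + 1)) ℝ) : ℝ :=
  ∑ a ∈ p.support, p.coeff a *
    dunklMonomial Rp κ a (fun x : Paravec m => MvPolynomial.eval (fun i => x i) q) 0

/-- The singular set `K^sing`: the `κ` for which the Fischer product is degenerate. -/
def singularSet {m : ℕ} (Rp : Finset (Paravec m)) : Set (Paravec m → ℝ) :=
  {κ | ∃ q : MvPolynomial (Fin (m + 1)) ℝ, q ≠ 0 ∧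
    ∀ p : MvPolynomial (Fin (m + 1)) ℝ, fischerProduct Rp κ p q = 0}

/-! ### The Clifford algebra `ℝ_{0,m}` -/

/-- The quadratic form `-(v_1² + ⋯ + v_m²)`. -/
abbrev negSqForm (m : ℕ) : QuadraticForm ℝ (Fin m → ℝ) :=
  QuadraticMap.weightedSumSquares ℝ (fun _ : Fin m => (-1 : ℝ))

/-- The real Clifford algebra `ℝ_{0,m}`. -/
abbrev Cl (m : ℕ) : Type := CliffordAlgebra (negSqForm m)

/-- The basis of `ℝ_{0,m}` that corresponds to the basis `e_{i_1} ∧ ⋯ ∧ e_{i_k}`,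
`i_1 < ⋯ < i_k`, of the exterior algebra. -/
def clBasis (m : ℕ) : Module.Basis (Finset (Fin m)) ℝ (Cl m) :=
  (Pi.basisFun ℝ (Fin m)).ExteriorAlgebra.map (CliffordAlgebra.equivExterior (negSqForm m)).symm

/-- The maximum norm of the components. As `ℝ_{0,m}` has finite dimension, derivatives and
analyticity do not depend on the choice of the norm: they are taken component by component. -/
instance clNormedAddCommGroup (m : ℕ) : NormedAddCommGroup (Cl m) :=
  NormedAddCommGroup.induced (Cl m) (Finset (Fin m) → ℝ)
    (clBasis m).equivFun.toLinearMap (clBasis m).equivFun.injective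

instance clNormedSpace (m : ℕ) : NormedSpace ℝ (Cl m) :=
  NormedSpace.induced ℝ (Cl m) (Finset (Fin m) → ℝ) (clBasis m).equivFun.toLinearMap

/-- The generator `e_j`. -/
def clE {m : ℕ} (j : Fin m) : Cl m := CliffordAlgebra.ι (negSqForm m) (Pi.single j 1)

theorem clE_mul_self {m : ℕ} (j : Fin m) : clE j * clE j = -1 := by
  rw [clE, CliffordAlgebra.ι_sq_scalar, QuadraticMap.weightedSumSquares_apply,
    Finset.sum_eq_single j]
  · simp
  · intro b _ hb
    simp [hb]
  · simp

theorem clE_mul_comm {m : ℕ} {j k : Fin m} (h : j ≠ k) : clE j * clE k = -(clE k * clE j) := by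
  refine CliffordAlgebra.ι_mul_ι_comm_of_isOrtho ?_
  rw [QuadraticMap.isOrtho_def]
  simp only [QuadraticMap.weightedSumSquares_apply, Pi.add_apply, smul_eq_mul,
    ← Finset.sum_add_distrib]
  refine Finset.sum_congr rfl fun i _ => ?_
  by_cases hj : i = j
  · subst hj
    simp [h]
  · simp [hj]

/-- The vector `v_1 e_1 + ⋯ + v_m e_m`. -/
def clVec {m : ℕ} (v : Fin m → ℝ) : Cl m := ∑ j, v j • clE j

/-- The vector part `x_1 e_1 + ⋯ + x_m e_m` of a paravector `x`, also its imaginary part. -/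
def clIm {m : ℕ} (x : Paravec m) : Cl m := clVec (fun j => x j.succ)

/-- `r = |x_1 e_1 + ⋯ + x_m e_m|`. -/
def imNorm {m : ℕ} (x : Paravec m) : ℝ := Real.sqrt (∑ j : Fin m, x j.succ ^ 2)

/-- The point `a + ω b`. -/
def slicePoint {m : ℕ} (a b : ℝ) (ω : EuclideanSpace ℝ (Fin m)) : Paravec m :=
  WithLp.toLp 2 (Fin.cons a fun j => b * ω j)

/-- The conjugate paravector `x_0 - x_1 e_1 - ⋯ - x_m e_m`. -/
def paraConj {m : ℕ} (x : Paravec m) : Paravec m :=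
  WithLp.toLp 2 (Fin.cons (x 0) fun j => - x j.succ)

/-! ### Slice functions -/

/-- The circularization `Ω_D` of `D ⊆ ℂ`. -/
def circularization (m : ℕ) (D : Set ℂ) : Set (Paravec m) :=
  {x | ∃ (a b : ℝ) (ω : EuclideanSpace ℝ (Fin m)),
    ‖ω‖ = 1 ∧ (⟨a, b⟩ : ℂ) ∈ D ∧ x = slicePoint a b ω}

/-- The real axis of the space of paravectors. -/
def realAxis (m : ℕ) : Set (Paravec m) := {x | ∀ j : Fin m, x j.succ = 0}

/-- `(A, B)` are the components of a stem function `F = A + i B` on `D`. -/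
def IsStem {m : ℕ} (D : Set ℂ) (A B : ℂ → Cl m) : Prop :=
  ∀ z ∈ D, A (starRingEnd ℂ z) = A z ∧ B (starRingEnd ℂ z) = - B z

/-- `f` is a slice function on `Ω_D`: it is induced by a stem function `A + i B`, that is,
`f(x) = A(x_0, r) + ω B(x_0, r)` for `x = x_0 + ω r ∈ Ω_D` with `ω` a unit vector and `r` the
length of the vector part of `x`. -/
def IsSliceOn {m : ℕ} (D : Set ℂ) (f : Paravec m → Cl m) : Prop :=
  ∃ A B : ℂ → Cl m, IsStem D A B ∧
    ∀ x ∈ circularization m D, ∀ ω : EuclideanSpace ℝ (Fin m), ‖ω‖ = 1 →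
      x = slicePoint (x 0) (imNorm x) ω →
      f x = A ⟨x 0, imNorm x⟩ + clVec (fun j => ω j) * B ⟨x 0, imNorm x⟩

/-- The spherical derivative `f'_s(x) = Im(x)⁻¹ (f(x) - f(x̄)) / 2`, for `x` off the real axis
(where `Im(x)` is a unit of `ℝ_{0,m}`). -/
def sphericalDeriv {m : ℕ} (f : Paravec m → Cl m) (x : Paravec m) : Cl m :=
  Ring.inverse (clIm x) * ((1 / 2 : ℝ) • (f x - f (paraConj x)))

/-! ### Spherical Dirac operators -/

/-- The spherical Dirac operator `Γ_ω = -∑_{i<j} e_i e_j (x_i ∂_j - x_j ∂_i)`. -/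
def sphericalDirac {m : ℕ} (f : Paravec m → Cl m) (x : Paravec m) : Cl m :=
  -∑ i : Fin m, ∑ j ∈ Finset.Ioi i, clE i * clE j *
    (x i.succ • partialDeriv j.succ f x - x j.succ • partialDeriv i.succ f x)

/-- The reflection part `Ψ`. -/
def dunklPsi {m : ℕ} (Rp : Finset (Paravec m)) (κ : Paravec m → ℝ)
    (f : Paravec m → Cl m) (x : Paravec m) : Cl m :=
  -(∑ i : Fin m, ∑ j ∈ Finset.Ioi i, clE i * clE j *
      ∑ α ∈ Rp, (κ α * (x i.succ * α j.succ - x j.succ * α i.succ)) • rho α f x)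
    - ∑ α ∈ Rp, κ α • f (reflect α x)

/-- The Dunkl-spherical Dirac operator `γ_κ + Γ_ω + Ψ`. -/
def dunklSphericalDirac {m : ℕ} (Rp : Finset (Paravec m)) (κ : Paravec m → ℝ)
    (f : Paravec m → Cl m) (x : Paravec m) : Cl m :=
  dunklIndex Rp κ • f x + sphericalDirac f x + dunklPsi Rp κ f x

end

/-! On the spheres `{a + ω b : |ω| = 1}` with `b ≠ 0`, being slice means `f = P + ω Q` with
constants `P`, `Q` on each of them (`IsSliceOn.exists_eq_add`, `isSliceOn_of_forall_exists`). The
Dunkl-spherical Dirac operator acts on each sphere separately, so the theorem describes its kernel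
among analytic functions on one sphere.

Affine functions lie in the kernel by computation. For `f = P + ω Q` one finds `Γ f = (m - 1) ω Q`,
and `x α ρ_α f = -2 ω Q` for every root, because `f - f ∘ σ_α` is a multiple of `α Q` and `α² =
-|α|²` cancels the length of the root. Since `Ψ f = -∑ κ(α) (x α ρ_α f + f)`, the operator gives `(m
- 1 + 2 γ) ω Q = 0`. The same two formulas give the final assertions.

For polynomials the converse is algebraic. The operator is `-E - X D`, with the Euler operator `E`,
the vector variable `X` and the Dunkl–Dirac operator `D`. Always `X D + D X = -(2 E + m + 2 γ)`, and
the given `γ` turns the constant into `1`, so that `-E - X D` anticommutes with `X`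
(`sphOp_mul_vecOp`). A homogeneous kernel element of degree `n ≥ 1` satisfies `n F = -X D F`, hence
is `X` times a kernel element of degree `n - 1`, and by induction `F = X ^ n v`
(`exists_eq_vecOp_pow`). On the unit sphere `X² = -1`. Powers of `|x|²` make the even and odd parts
of any polynomial homogeneous without changing its values there, which leaves `v + ω w`
(`exists_evalVec_eq`).

It remains to show that an analytic solution is a polynomial on the sphere
(`exists_polyFun_eq_of_sphDunkl_eq_zero`). The multiplicities may be negative, so no Dunkl weight is
used: the argument runs in the ordinary `L²` of the sphere, split into layers of spherical harmonics
of degree `l`. Analyticity makes the layers decay like `e^{-εl}`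
(`exists_exp_mul_norm_layerProj_le`). The operator `Γ` is bounded below by a multiple of `l`
(`exists_mul_norm_le_angDirac`). The function `ρ_α f` solves `⟨α, x⟩ ρ_α f = f - f ∘ σ_α`, and
division by a linear form costs only a factor `√l` in such a bound
(`exists_exp_mul_norm_layerProj_le_of_linOp`). Hence the equation improves `e^{εl} ‖f_l‖ ≤ K` for `l
> J` to the same bound with `K / 2`, for one fixed large `J`. Iteration gives `f_l = 0` for `l > J`.
-/

noncomputable section

set_option linter.unusedSectionVars false

open MvPolynomial Finset

/-! ### Clifford families and abstract Dirac operators -/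

/-- A family of elements that satisfies the relations of the generators of `ℝ_{0,m}`. -/
def IsCliffordFamily {m : ℕ} {A : Type*} [Ring A] (c : Fin m → A) : Prop :=
  ∀ i j, c i * c j + c j * c i = if i = j then -2 else 0

theorem eq_of_two_smul_eq {M : Type*} [AddCommGroup M] [Module ℝ M] {a b : M}
    (h : (2 : ℝ) • a = (2 : ℝ) • b) : a = b :=
  (smul_right_injective M (two_ne_zero : (2 : ℝ) ≠ 0)) h

section AbstractDirac

variable {m : ℕ} {A : Type*} [Ring A] [Algebra ℝ A] {c x T : Fin m → A}

/-- Averaging with the sum in which `i` and `j` are exchanged turns `c i * c j` into half of its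
anticommutator, which lives on the diagonal. -/
theorem IsCliffordFamily.sum_symm (hc : IsCliffordFamily c) {S : Fin m → Fin m → A}
    (hS : ∀ i j, S i j = S j i) :
    ∑ i, ∑ j, c i * c j * S i j = -∑ i, S i i := by
  apply eq_of_two_smul_eq
  rw [two_smul]
  nth_rewrite 2 [Finset.sum_comm]
  rw [← sum_add_distrib]
  simp_rw [← sum_add_distrib]
  have : ∀ i j, c i * c j * S i j + c j * c i * S j i = if i = j then -2 * S i i else 0 := by
    intro i j
    rw [hS j i, ← add_mul, hc i j]
    split_ifs with h
    · rw [h]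
    · simp
  simp_rw [this]
  simp [two_smul, neg_mul, two_mul, sum_add_distrib]

theorem sum_mul_sum_of_commute (hcx : ∀ i j, Commute (c i) (x j)) (T : Fin m → A) :
    (∑ i, c i * x i) * (∑ j, c j * T j) = ∑ i, ∑ j, c i * c j * (x i * T j) := by
  rw [Finset.sum_mul_sum]
  refine sum_congr rfl fun i _ => sum_congr rfl fun j _ => ?_
  rw [mul_assoc, ← mul_assoc (x i), ← (hcx j i).eq]
  simp only [mul_assoc]

/-- The square of the vector variable. -/
theorem IsCliffordFamily.sum_sq (hc : IsCliffordFamily c) (hcx : ∀ i j, Commute (c i) (x j))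
    (hx : ∀ i j, Commute (x i) (x j)) :
    (∑ i, c i * x i) * (∑ j, c j * x j) = -∑ i, x i * x i := by
  rw [sum_mul_sum_of_commute hcx, hc.sum_symm (S := fun i j => x i * x j) fun i j => (hx i j).eq]

/-- The anticommutator of the vector variable and a Dirac operator. -/
theorem IsCliffordFamily.anticomm (hc : IsCliffordFamily c) (hcx : ∀ i j, Commute (c i) (x j))
    (hcT : ∀ i j, Commute (c i) (T j))
    (hN : ∀ i j, T i * x j - x j * T i = T j * x i - x i * T j) :
    (∑ i, c i * x i) * (∑ j, c j * T j) + (∑ j, c j * T j) * (∑ i, c i * x i) =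
      -∑ i, (x i * T i + T i * x i) := by
  rw [sum_mul_sum_of_commute hcx, sum_mul_sum_of_commute hcT, ← sum_add_distrib]
  simp_rw [← sum_add_distrib, ← mul_add]
  rw [hc.sum_symm (S := fun i j => x i * T j + T i * x j)]
  intro i j
  have := hN i j
  rw [sub_eq_sub_iff_add_eq_add] at this
  rw [add_comm (x i * T j), this, add_comm]

/-- The angular part of a Dirac operator. -/
theorem IsCliffordFamily.sum_angular (hc : IsCliffordFamily c) (hcx : ∀ i j, Commute (c i) (x j))
    (T : Fin m → A) :
    ∑ i, ∑ j, c i * c j * (x i * T j - x j * T i) =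
      (2 : ℝ) • ((∑ i, c i * x i) * (∑ j, c j * T j) + ∑ i, x i * T i) := by
  have h := hc.sum_symm (S := fun i j => x i * T j + x j * T i) fun i j => add_comm _ _
  rw [sum_mul_sum_of_commute hcx]
  simp only [mul_add, mul_sub, sum_add_distrib, sum_sub_distrib, two_smul] at h ⊢
  rw [eq_sub_of_add_eq' h]
  abel

end AbstractDirac

/-- A spherical Dirac operator `-E - X D` anticommutes with `X` when the anticommutator
of `X` and `D` is `-(2 E + 1)`. -/
theorem neg_sub_mul_anticomm {A : Type*} [Ring A] {E X D : A} (hE : E * X = X * (E + 1))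
    (hXD : X * D + D * X = -(2 * E + 1)) : (-E - X * D) * X = -(X * (-E - X * D)) := by
  have : X * D * X = -(X * (2 * E + 1)) - X * X * D := by
    rw [mul_assoc, eq_sub_of_add_eq' hXD]; noncomm_ring
  rw [sub_mul, this, neg_mul, hE]; noncomm_ring

/-! ### Dunkl operators on polynomials -/

section Poly

variable {m : ℕ}

/-- The linear form `⟨α, x⟩`. -/
def linForm (α : Fin m → ℝ) : MvPolynomial (Fin m) ℝ := ∑ i, C (α i) * X i

/-- The square of the length of a vector. -/
def sqLen (α : Fin m → ℝ) : ℝ := ∑ i, α i ^ 2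

theorem sqLen_ne_zero {α : Fin m → ℝ} (hα : α ≠ 0) : sqLen α ≠ 0 := by
  obtain ⟨i, hi⟩ := Function.ne_iff.1 hα
  refine (sum_pos' (fun i _ => sq_nonneg _) ⟨i, mem_univ _, ?_⟩).ne'
  exact pow_pos (abs_pos.2 hi) 2 |>.trans_eq (sq_abs _)

theorem linForm_ne_zero {α : Fin m → ℝ} (hα : α ≠ 0) : linForm α ≠ 0 := by
  intro h
  have := congr_arg (eval α) h
  simp only [linForm, map_sum, map_mul, eval_C, eval_X, map_zero] at this
  exact sqLen_ne_zero hα (by simpa [sqLen, sq] using this)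

/-- Composition with the reflection in the hyperplane orthogonal to `α`. -/
def polyReflect (α : Fin m → ℝ) : MvPolynomial (Fin m) ℝ →ₐ[ℝ] MvPolynomial (Fin m) ℝ :=
  aeval fun i => X i - C (2 / sqLen α * α i) * linForm α

/-- Modulo the linear form the reflection is the identity on every variable, hence on every
polynomial. -/
theorem linForm_dvd_sub_polyReflect (α : Fin m → ℝ) (p : MvPolynomial (Fin m) ℝ) :
    linForm α ∣ p - polyReflect α p := by
  induction p using MvPolynomial.induction_on with
  | C a => simp [polyReflect]
  | add p q hp hq =>
    rw [map_add, add_sub_add_comm]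
    exact dvd_add hp hq
  | mul_X p i hp =>
    have : p * X i - polyReflect α (p * X i) = (p - polyReflect α p) * X i +
        polyReflect α p * C (2 / sqLen α * α i) * linForm α := by
      simp only [map_mul, polyReflect, aeval_X]
      ring
    rw [this]
    exact dvd_add (hp.mul_right _) (dvd_mul_left _ _)

/-- The divided difference `(p - p ∘ σ_α) / ⟨α, x⟩`. -/
def polyRho {α : Fin m → ℝ} (hα : α ≠ 0) :
    MvPolynomial (Fin m) ℝ →ₗ[ℝ] MvPolynomial (Fin m) ℝ where
  toFun p := (linForm_dvd_sub_polyReflect α p).choose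
  -- The quotient by a nonzero element of a domain is unique, so the chosen quotients depend
  -- linearly on `p`.
  map_add' p q := by
    apply mul_left_cancel₀ (linForm_ne_zero hα)
    rw [mul_add, ← (linForm_dvd_sub_polyReflect α _).choose_spec,
      ← (linForm_dvd_sub_polyReflect α p).choose_spec,
      ← (linForm_dvd_sub_polyReflect α q).choose_spec, map_add]
    ring
  map_smul' r p := by
    apply mul_left_cancel₀ (linForm_ne_zero hα)
    rw [RingHom.id_apply, mul_smul_comm, ← (linForm_dvd_sub_polyReflect α _).choose_spec,
      ← (linForm_dvd_sub_polyReflect α p).choose_spec, map_smul, smul_sub]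

theorem linForm_mul_polyRho {α : Fin m → ℝ} (hα : α ≠ 0) (p : MvPolynomial (Fin m) ℝ) :
    linForm α * polyRho hα p = p - polyReflect α p :=
  (linForm_dvd_sub_polyReflect α p).choose_spec.symm

/-- A Leibniz rule twisted by the reflection; it is the source of the reflection terms in the
commutators below. -/
theorem polyRho_X_mul {α : Fin m → ℝ} (hα : α ≠ 0) (j : Fin m) (p : MvPolynomial (Fin m) ℝ) :
    polyRho hα (X j * p) = X j * polyRho hα p + C (2 / sqLen α * α j) * polyReflect α p := by
  apply mul_left_cancel₀ (linForm_ne_zero hα)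
  rw [linForm_mul_polyRho, mul_add, mul_left_comm, linForm_mul_polyRho, map_mul]
  simp only [polyReflect, aeval_X]
  ring

/-- The Euler operator. -/
def polyEuler : Derivation ℝ (MvPolynomial (Fin m) ℝ) (MvPolynomial (Fin m) ℝ) :=
  ∑ i, (X i : MvPolynomial (Fin m) ℝ) • pderiv i

theorem polyEuler_apply (p : MvPolynomial (Fin m) ℝ) :
    polyEuler p = ∑ i, X i * pderiv i p := by
  have : ∀ s : Finset (Fin m), (∑ i ∈ s, (X i : MvPolynomial (Fin m) ℝ) •
      (pderiv i : Derivation ℝ (MvPolynomial (Fin m) ℝ) (MvPolynomial (Fin m) ℝ))) p =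
      ∑ i ∈ s, X i * pderiv i p := by
    classical
    intro s
    induction s using Finset.induction_on with
    | empty => simp
    | insert a s ha ih => rw [sum_insert ha, sum_insert ha, Derivation.add_apply, ih]; simp
  exact this _

@[simp]
theorem polyEuler_X (j : Fin m) : polyEuler (X j : MvPolynomial (Fin m) ℝ) = X j := by
  rw [polyEuler_apply, sum_eq_single j] <;> simp +contextual [pderiv_X, eq_comm]

@[simp]
theorem polyEuler_linForm (α : Fin m → ℝ) : polyEuler (linForm α) = linForm α := by
  simp [linForm, map_sum, Derivation.leibniz]

theorem polyEuler_polyReflect (α : Fin m → ℝ) (p : MvPolynomial (Fin m) ℝ) :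
    polyEuler (polyReflect α p) = polyReflect α (polyEuler p) := by
  induction p using MvPolynomial.induction_on with
  | C a => simp [polyReflect]
  | add p q hp hq => simp only [map_add, hp, hq]
  | mul_X p i hp =>
    rw [map_mul, Derivation.leibniz, Derivation.leibniz, hp]
    simp only [smul_eq_mul, map_add, map_mul, polyEuler_X]
    congr 2
    simp [polyReflect, Derivation.leibniz, polyEuler_linForm]

/-- The divided difference lowers the degree by one: apply the derivation `polyEuler` to
`linForm_mul_polyRho` and cancel the linear form, which is itself an eigenvector. -/
theorem polyEuler_polyRho {α : Fin m → ℝ} (hα : α ≠ 0) (p : MvPolynomial (Fin m) ℝ) :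
    polyEuler (polyRho hα p) = polyRho hα (polyEuler p) - polyRho hα p := by
  apply mul_left_cancel₀ (linForm_ne_zero hα)
  have h := congr_arg polyEuler (linForm_mul_polyRho hα p)
  rw [Derivation.leibniz, map_sub, polyEuler_polyReflect, ← linForm_mul_polyRho hα,
    polyEuler_linForm, smul_eq_mul, smul_eq_mul] at h
  rw [mul_sub, ← h]
  ring

theorem polyEuler_pderiv (i : Fin m) (p : MvPolynomial (Fin m) ℝ) :
    polyEuler (pderiv i p) = pderiv i (polyEuler p) - pderiv i p := by
  induction p using MvPolynomial.induction_on with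
  | C a => simp
  | add p q hp hq => simp only [map_add, hp, hq]; ring
  | mul_X p j hp =>
    simp only [Derivation.leibniz, smul_eq_mul, map_add, hp, polyEuler_X, pderiv_X]
    by_cases h : j = i
    · subst h; simp; ring
    · simp [h]; ring

theorem coeff_polyEuler (p : MvPolynomial (Fin m) ℝ) (a : Fin m →₀ ℕ) :
    coeff a (polyEuler p) = a.degree * coeff a p := by
  induction p using MvPolynomial.induction_on' with
  | monomial u r =>
    rw [polyEuler_apply, coeff_sum, coeff_monomial]
    simp_rw [X_mul_pderiv_monomial, coeff_smul, coeff_monomial]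
    split_ifs with h
    · subst h
      rw [Finsupp.degree_eq_sum]
      simp [sum_mul]
    · simp
  | add p q hp hq => rw [map_add, coeff_add, coeff_add, hp, hq]; ring

/-- An eigenvector of the Euler operator is homogeneous. -/
theorem isHomogeneous_of_polyEuler_eq {p : MvPolynomial (Fin m) ℝ} {n : ℕ}
    (h : polyEuler p = (n : ℝ) • p) : p.IsHomogeneous n := by
  intro a ha
  have := coeff_polyEuler p a
  rw [h, coeff_smul, smul_eq_mul, mul_eq_mul_right_iff, or_iff_left ha, Nat.cast_inj] at this
  rw [this]
  simp [Finsupp.weight_apply, Finsupp.degree_eq_sum, Finsupp.sum_fintype]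

theorem eq_C_of_polyEuler_eq_zero {p : MvPolynomial (Fin m) ℝ} (h : polyEuler p = 0) :
    p = C (coeff 0 p) := by
  have := isHomogeneous_of_polyEuler_eq (n := 0) (p := p) (by simp [h])
  rw [← homogeneousComponent_zero, homogeneousComponent_eq_self this]

end Poly

end

noncomputable section

set_option linter.unusedSectionVars false

open MvPolynomial Finset

/-! ### Dunkl–Dirac operators on vectors of polynomials, and their homogeneous kernel. -/

section DunklPoly

variable {m : ℕ} {ι J : Type*} [Fintype ι] [DecidableEq ι] [Fintype J]

/-- The action of a real matrix on vectors of polynomials. -/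
def matOp : Matrix ι ι ℝ →ₐ[ℝ] Module.End ℝ (ι → MvPolynomial (Fin m) ℝ) :=
  AlgHom.ofLinearMap
    { toFun := fun a =>
        { toFun := fun F A => ∑ B, a A B • F B
          map_add' := fun F G => by ext1 A; simp [sum_add_distrib]
          map_smul' := fun r F => by ext1 A; simp [smul_sum, smul_comm r] }
      map_add' := fun a b => by
        refine LinearMap.ext fun F => funext fun A => ?_
        simp [add_smul, sum_add_distrib]
      map_smul' := fun r a => by
        refine LinearMap.ext fun F => funext fun A => ?_
        simp [mul_smul, smul_sum] }
    (by
      refine LinearMap.ext fun F => funext fun A => ?_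
      simp [Matrix.one_apply, ite_smul])
    (by
      intro a b
      refine LinearMap.ext fun F => funext fun A => ?_
      simp only [LinearMap.coe_mk, AddHom.coe_mk, Module.End.mul_apply, Matrix.mul_apply, sum_smul,
        smul_sum, mul_smul]
      exact sum_comm)

theorem matOp_apply (a : Matrix ι ι ℝ) (F : ι → MvPolynomial (Fin m) ℝ) (A : ι) :
    matOp a F A = ∑ B, a A B • F B := rfl

variable (ι) in
/-- The action of a linear operator on each component. -/
def diagOp (φ : Module.End ℝ (MvPolynomial (Fin m) ℝ)) :
    Module.End ℝ (ι → MvPolynomial (Fin m) ℝ) := φ.compLeft ι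

theorem diagOp_apply (φ : Module.End ℝ (MvPolynomial (Fin m) ℝ))
    (F : ι → MvPolynomial (Fin m) ℝ) (A : ι) : diagOp ι φ F A = φ (F A) := rfl

theorem matOp_commute_diagOp (a : Matrix ι ι ℝ) (φ : Module.End ℝ (MvPolynomial (Fin m) ℝ)) :
    Commute (matOp a) (diagOp ι φ) := by
  refine LinearMap.ext fun F => funext fun A => ?_
  simp [Module.End.mul_apply, matOp_apply, diagOp_apply]

/-- Multiplication by a coordinate. -/
def coordOp (i : Fin m) : Module.End ℝ (MvPolynomial (Fin m) ℝ) := LinearMap.mulLeft ℝ (X i)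

/-- The Dunkl operator on polynomials, for an arbitrary finite family `α` of nonzero vectors. -/
def polyDunkl {α : J → Fin m → ℝ} (hα : ∀ a, α a ≠ 0) (k : J → ℝ) (i : Fin m) :
    Module.End ℝ (MvPolynomial (Fin m) ℝ) :=
  (pderiv i).toLinearMap + ∑ a, (k a * α a i) • polyRho (hα a)

variable {α : J → Fin m → ℝ} (hα : ∀ a, α a ≠ 0) (k : J → ℝ)

theorem polyDunkl_apply (i : Fin m) (p : MvPolynomial (Fin m) ℝ) :
    polyDunkl hα k i p = pderiv i p + ∑ a, (k a * α a i) • polyRho (hα a) p := by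
  simp [polyDunkl]

/-- The right-hand side is symmetric in `i` and `j`, which is the hypothesis that
`IsCliffordFamily.anticomm` needs. -/
theorem polyDunkl_X_mul (i j : Fin m) (p : MvPolynomial (Fin m) ℝ) :
    polyDunkl hα k i (X j * p) - X j * polyDunkl hα k i p = (if i = j then p else 0) +
      ∑ a, (k a * (2 / sqLen (α a)) * (α a i * α a j)) • polyReflect (α a) p := by
  simp only [polyDunkl_apply, Derivation.leibniz, pderiv_X, polyRho_X_mul, smul_add,
    sum_add_distrib, smul_eq_mul, mul_add, mul_sum]
  have : ∀ a, (k a * α a i) • (C (2 / sqLen (α a) * α a j) * polyReflect (α a) p) =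
      (k a * (2 / sqLen (α a)) * (α a i * α a j)) • polyReflect (α a) p := by
    intro a
    rw [← smul_eq_C_mul, smul_smul]
    congr 1
    ring
  simp only [this, mul_smul_comm]
  rcases eq_or_ne i j with h | h
  · subst h; simp; ring
  · simp [h, h.symm]

/-- The coefficients `α a i` and the coordinates assemble to the linear form, which cancels the
denominator of the divided difference. -/
theorem sum_X_mul_polyDunkl (p : MvPolynomial (Fin m) ℝ) :
    ∑ i, X i * polyDunkl hα k i p = polyEuler p + ∑ a, k a • (p - polyReflect (α a) p) := by
  simp only [polyDunkl_apply, mul_add, sum_add_distrib, polyEuler_apply, mul_sum]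
  congr 1
  rw [sum_comm]
  refine sum_congr rfl fun a _ => ?_
  rw [← linForm_mul_polyRho (hα a), linForm, sum_mul, smul_sum]
  refine sum_congr rfl fun i _ => ?_
  simp only [smul_eq_C_mul, map_mul]
  ring

/-- The trace of `polyDunkl_X_mul`, in which `∑ i, α a i ^ 2` cancels `sqLen (α a)`. Its reflection
terms are twice those of `sum_X_mul_polyDunkl` with the opposite sign. -/
theorem sum_polyDunkl_X_mul (p : MvPolynomial (Fin m) ℝ) :
    ∑ i, polyDunkl hα k i (X i * p) =
      ∑ i, X i * polyDunkl hα k i p + (m : ℝ) • p + ∑ a, (2 * k a) • polyReflect (α a) p := by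
  have h := fun i => eq_add_of_sub_eq (polyDunkl_X_mul hα k i i p)
  simp only [h, if_true, sum_add_distrib]
  rw [sum_comm (s := univ) (t := univ) (f := fun i a =>
    (k a * (2 / sqLen (α a)) * (α a i * α a i)) • polyReflect (α a) p)]
  have : ∀ a, ∑ i, (k a * (2 / sqLen (α a)) * (α a i * α a i)) • polyReflect (α a) p =
      (2 * k a) • polyReflect (α a) p := by
    intro a
    rw [← sum_smul, ← mul_sum]
    congr 1
    have := sqLen_ne_zero (hα a)
    rw [show ∑ i, α a i * α a i = sqLen (α a) by simp [sqLen, sq]]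
    field_simp
  simp only [this]
  simp [Nat.cast_smul_eq_nsmul]
  ring

theorem polyEuler_polyDunkl (i : Fin m) (p : MvPolynomial (Fin m) ℝ) :
    polyEuler (polyDunkl hα k i p) = polyDunkl hα k i (polyEuler p) - polyDunkl hα k i p := by
  simp only [polyDunkl_apply, map_add, map_sum, Derivation.map_smul, polyEuler_pderiv,
    polyEuler_polyRho, smul_sub, sum_sub_distrib]
  ring

variable (c : Fin m → Matrix ι ι ℝ)

/-- Multiplication by the vector variable. -/
def vecOp : Module.End ℝ (ι → MvPolynomial (Fin m) ℝ) := ∑ i, matOp (c i) * diagOp ι (coordOp i)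

/-- The Dunkl–Dirac operator on polynomials. -/
def diracOp : Module.End ℝ (ι → MvPolynomial (Fin m) ℝ) :=
  ∑ i, matOp (c i) * diagOp ι (polyDunkl hα k i)

variable (ι m) in
/-- The Euler operator on vectors of polynomials. -/
def eulerOp : Module.End ℝ (ι → MvPolynomial (Fin m) ℝ) := diagOp ι polyEuler.toLinearMap

/-- The Dunkl-spherical Dirac operator on polynomials. -/
def sphOp : Module.End ℝ (ι → MvPolynomial (Fin m) ℝ) :=
  -eulerOp m ι - vecOp c * diracOp hα k c

variable {c}

theorem isCliffordFamily_matOp (hc : IsCliffordFamily c) :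
    IsCliffordFamily fun i => (matOp (c i) : Module.End ℝ (ι → MvPolynomial (Fin m) ℝ)) := by
  intro i j
  rw [← map_mul, ← map_mul, ← map_add, hc i j]
  split_ifs
  · rw [map_neg, map_ofNat]
  · exact map_zero _

theorem vecOp_mul_self (hc : IsCliffordFamily c) :
    vecOp c * vecOp c = -diagOp ι (LinearMap.mulLeft ℝ (∑ i, X i * X i)) := by
  rw [vecOp, (isCliffordFamily_matOp hc).sum_sq (fun i j => matOp_commute_diagOp _ _)]
  · congr 1
    refine LinearMap.ext fun F => funext fun A => ?_
    simp [LinearMap.sum_apply, Module.End.mul_apply, diagOp_apply, coordOp, sum_mul, mul_assoc]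
  · intro i j
    refine LinearMap.ext fun F => funext fun A => ?_
    simp only [Module.End.mul_apply, diagOp_apply, coordOp, LinearMap.mulLeft_apply]
    ring

/-- In the sum of the two traces `∑ X T` and `∑ T X` all reflections cancel, and the multiplicities
survive only through the constant `2 * ∑ a, k a`. -/
theorem vecOp_anticomm_diracOp (hc : IsCliffordFamily c) :
    vecOp c * diracOp hα k c + diracOp hα k c * vecOp c =
      -(2 * eulerOp m ι + ((m : ℝ) + 2 * ∑ a, k a) • 1) := by
  rw [vecOp, diracOp, (isCliffordFamily_matOp hc).anticomm (fun i j => matOp_commute_diagOp _ _)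
    (fun i j => matOp_commute_diagOp _ _)]
  · congr 1
    refine LinearMap.ext fun F => funext fun A => ?_
    have h1 := sum_X_mul_polyDunkl hα k (F A)
    have h2 := sum_polyDunkl_X_mul hα k (F A)
    simp only [LinearMap.sum_apply, LinearMap.add_apply, Module.End.mul_apply, Finset.sum_apply,
      Pi.add_apply, diagOp_apply, coordOp, LinearMap.mulLeft_apply, sum_add_distrib, h2, h1,
      two_mul, eulerOp, LinearMap.smul_apply, Module.End.one_apply, Pi.smul_apply,
      Derivation.coeFn_coe, add_smul, sum_smul, smul_sub, sum_sub_distrib]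
    ring
  · intro i j
    refine LinearMap.ext fun F => funext fun A => ?_
    have h1 := polyDunkl_X_mul hα k i j (F A)
    have h2 := polyDunkl_X_mul hα k j i (F A)
    simp only [LinearMap.sub_apply, Module.End.mul_apply, Pi.sub_apply, diagOp_apply, coordOp,
      LinearMap.mulLeft_apply, h1, h2]
    congr 1
    · simp [eq_comm]
    · exact sum_congr rfl fun a _ => by rw [mul_comm (α a i)]

theorem eulerOp_mul_vecOp : eulerOp m ι * vecOp c = vecOp c * (eulerOp m ι + 1) := by
  rw [vecOp, mul_sum, sum_mul]
  refine sum_congr rfl fun i _ => ?_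
  rw [← mul_assoc, eulerOp, ← (matOp_commute_diagOp _ _).eq, mul_assoc, mul_assoc]
  congr 1
  refine LinearMap.ext fun F => funext fun A => ?_
  simp [Module.End.mul_apply, diagOp_apply, coordOp, Derivation.leibniz, mul_add, mul_comm,
    add_comm]

theorem eulerOp_mul_diracOp :
    eulerOp m ι * diracOp hα k c = diracOp hα k c * (eulerOp m ι - 1) := by
  rw [diracOp, mul_sum, sum_mul]
  refine sum_congr rfl fun i _ => ?_
  rw [← mul_assoc, eulerOp, ← (matOp_commute_diagOp _ _).eq, mul_assoc, mul_assoc]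
  congr 1
  refine LinearMap.ext fun F => funext fun A => ?_
  simp [Module.End.mul_apply, diagOp_apply, polyEuler_polyDunkl]

/-- For polynomials the value of `γ` enters here: it makes `m + 2 γ` equal to `1`, the constant that
`neg_sub_mul_anticomm` requires. -/
theorem sphOp_mul_vecOp (hc : IsCliffordFamily c) (hγ : ∑ a, k a = (1 - (m : ℝ)) / 2) :
    sphOp hα k c * vecOp c = -(vecOp c * sphOp hα k c) := by
  refine neg_sub_mul_anticomm eulerOp_mul_vecOp ?_
  rw [vecOp_anticomm_diracOp hα k hc, hγ]
  congr 3
  rw [show (m : ℝ) + 2 * ((1 - (m : ℝ)) / 2) = 1 by ring, one_smul]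

theorem eulerOp_commute_sphOp : Commute (eulerOp m ι) (sphOp hα k c) := by
  refine ((Commute.refl _).neg_right).sub_right ?_
  change _ = _
  rw [← mul_assoc, eulerOp_mul_vecOp, mul_assoc, mul_assoc, add_mul, eulerOp_mul_diracOp, one_mul,
    mul_sub, mul_one, sub_add_cancel]

/-- The square of `vecOp c` is multiplication by `-∑ X i * X i`, a nonzero element of a domain as
soon as there is a variable. -/
theorem vecOp_injective (hm : m ≠ 0) (hc : IsCliffordFamily c) :
    Function.Injective (vecOp c : Module.End ℝ (ι → MvPolynomial (Fin m) ℝ)) := by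
  rw [← LinearMap.ker_eq_bot, LinearMap.ker_eq_bot']
  intro F hF
  have h := LinearMap.congr_fun (vecOp_mul_self hc) F
  rw [Module.End.mul_apply, hF, map_zero] at h
  refine funext fun A => ?_
  have hA := congr_fun h A
  simp only [LinearMap.neg_apply, Pi.neg_apply, diagOp_apply, LinearMap.mulLeft_apply,
    Pi.zero_apply, zero_eq_neg, mul_eq_zero] at hA
  refine hA.resolve_left fun h0 => hm ?_
  have := congr_arg (eval fun _ => (1 : ℝ)) h0
  simpa using this

/-- A homogeneous polynomial in the kernel of the Dunkl-spherical Dirac operator is a power of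
the vector variable times a constant. -/
theorem exists_eq_vecOp_pow (hm : m ≠ 0) (hc : IsCliffordFamily c)
    (hγ : ∑ a, k a = (1 - (m : ℝ)) / 2) (n : ℕ) (F : ι → MvPolynomial (Fin m) ℝ)
    (hF : eulerOp m ι F = (n : ℝ) • F) (h0 : sphOp hα k c F = 0) :
    ∃ v : ι → ℝ, F = (vecOp c ^ n) fun A => C (v A) := by
  induction n generalizing F with
  | zero =>
    refine ⟨fun A => coeff 0 (F A), funext fun A => ?_⟩
    refine eq_C_of_polyEuler_eq_zero ?_
    have := congr_fun hF A
    simpa [eulerOp, diagOp_apply] using this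
  | succ n ih =>
    have hn : ((n : ℝ) + 1) ≠ 0 := by positivity
    -- In degree `n + 1` the kernel equation reads `X D F = -(n + 1) F`, so this `Q` is `F` divided
    -- by the vector variable.
    set Q := -((n : ℝ) + 1)⁻¹ • diracOp hα k c F with hQ
    have hFQ : F = vecOp c Q := by
      have h1 : vecOp c (diracOp hα k c F) = -(((n + 1 : ℕ) : ℝ) • F) := by
        rw [← hF]
        simp only [sphOp, LinearMap.sub_apply, LinearMap.neg_apply, Module.End.mul_apply] at h0
        exact (sub_eq_zero.1 h0).symm
      rw [hQ, map_smul, h1, smul_neg, neg_smul, neg_neg, smul_smul, Nat.cast_succ,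
        inv_mul_cancel₀ hn, one_smul]
    have hEQ : eulerOp m ι Q = (n : ℝ) • Q := by
      have := LinearMap.congr_fun (eulerOp_mul_diracOp (ι := ι) (c := c) hα k) F
      simp only [Module.End.mul_apply, LinearMap.sub_apply, Module.End.one_apply, hF] at this
      rw [hQ, map_smul, this, smul_comm (n : ℝ)]
      congr 1
      rw [← map_smul]
      congr 1
      push_cast
      module
    have hSQ : sphOp hα k c Q = 0 := by
      apply vecOp_injective hm hc
      have := LinearMap.congr_fun (sphOp_mul_vecOp hα k hc hγ) Q
      rw [Module.End.mul_apply, ← hFQ, h0, LinearMap.neg_apply, Module.End.mul_apply] at this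
      rw [map_zero, ← neg_eq_zero, ← this]
    obtain ⟨v, hv⟩ := ih Q hEQ hSQ
    exact ⟨v, by rw [hFQ, hv, pow_succ', Module.End.mul_apply]⟩

end DunklPoly

end

noncomputable section

set_option linter.unusedSectionVars false

open MvPolynomial Finset

/-! ### From homogeneous polynomials to polynomials on the unit sphere. -/

section Homogenize

variable {m : ℕ} {ι J : Type*} [Fintype ι] [DecidableEq ι] [Fintype J]

theorem MvPolynomial.IsHomogeneous.eval_smul_vec {p : MvPolynomial (Fin m) ℝ} {n : ℕ}
    (hp : p.IsHomogeneous n) (t : ℝ) (x : Fin m → ℝ) :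
    eval (t • x) p = t ^ n * eval x p := by
  rw [eval_eq, eval_eq, mul_sum]
  refine sum_congr rfl fun d hd => ?_
  have h : ∑ i, d i = n := by
    have := hp (mem_support_iff.1 hd)
    simpa [Finsupp.weight_apply, Finsupp.sum_fintype] using this
  have h2 : ∏ i ∈ d.support, t ^ d i = t ^ n := by
    rw [prod_pow_eq_pow_sum, ← h]
    congr 1
    exact sum_subset (subset_univ _) fun i _ hi => Finsupp.notMem_support_iff.1 hi
  simp only [Pi.smul_apply, smul_eq_mul, mul_pow, prod_mul_distrib, h2]
  ring

theorem eval_linForm (α x : Fin m → ℝ) : eval x (linForm α) = ∑ i, α i * x i := by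
  simp [linForm]

/-- A homogeneous polynomial that vanishes on the unit sphere outside finitely many hyperplanes
is zero. -/
theorem eq_zero_of_isHomogeneous (hm : m ≠ 0) {α : J → Fin m → ℝ} (hα : ∀ a, α a ≠ 0)
    {p : MvPolynomial (Fin m) ℝ} {n : ℕ} (hp : p.IsHomogeneous n)
    (h : ∀ x : Fin m → ℝ, ∑ i, x i ^ 2 = 1 → (∀ a, ∑ i, α a i * x i ≠ 0) → eval x p = 0) :
    p = 0 := by
  -- The extra factors make the product vanish on the mirrors and at the origin; everywhere else
  -- homogeneity reduces to the regular part of the sphere.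
  have key : p * (∏ a, linForm (α a)) * (∑ i, X i ^ 2) = 0 := by
    refine MvPolynomial.funext fun x => ?_
    simp only [map_mul, map_prod, map_sum, map_pow, eval_X, eval_linForm, map_zero]
    by_cases hx : ∑ i, x i ^ 2 = 0
    · rw [hx, mul_zero]
    by_cases hr : ∀ a, ∑ i, α a i * x i ≠ 0
    · have hpos : 0 < ∑ i, x i ^ 2 := lt_of_le_of_ne (sum_nonneg fun i _ => sq_nonneg _) (Ne.symm hx)
      set s := Real.sqrt (∑ i, x i ^ 2) with hs
      have hs0 : s ≠ 0 := (Real.sqrt_pos.2 hpos).ne'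
      have hss : s ^ 2 = ∑ i, x i ^ 2 := Real.sq_sqrt hpos.le
      have hx' : x = s • (s⁻¹ • x) := by rw [smul_smul, mul_inv_cancel₀ hs0, one_smul]
      rw [hx', hp.eval_smul_vec, h (s⁻¹ • x), ← hx']
      · simp
      · simp only [Pi.smul_apply, smul_eq_mul, mul_pow, ← mul_sum, ← hss]
        field_simp
      · intro a
        simp only [Pi.smul_apply, smul_eq_mul, mul_left_comm _ s⁻¹, ← mul_sum]
        exact mul_ne_zero (inv_ne_zero hs0) (hr a)
    · push Not at hr
      obtain ⟨a, ha⟩ := hr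
      rw [prod_eq_zero (mem_univ a) ha]
      simp
  have h2 : (∑ i, X i ^ 2 : MvPolynomial (Fin m) ℝ) ≠ 0 := by
    intro h0
    have := congr_arg (eval fun _ => (1 : ℝ)) h0
    simp [hm] at this
  have h3 : ∏ a, linForm (α a) ≠ 0 := prod_ne_zero_iff.2 fun a _ => linForm_ne_zero (hα a)
  exact (mul_eq_zero.1 ((mul_eq_zero.1 key).resolve_right h2)).resolve_right h3

/-- Evaluation of a vector of polynomials. -/
def evalVec (x : Fin m → ℝ) : (ι → MvPolynomial (Fin m) ℝ) →ₗ[ℝ] ι → ℝ :=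
  (aeval (R := ℝ) x).toLinearMap.compLeft ι

theorem evalVec_apply (x : Fin m → ℝ) (F : ι → MvPolynomial (Fin m) ℝ) (A : ι) :
    evalVec x F A = eval x (F A) := by
  simp [evalVec, aeval_eq_eval]

theorem evalVec_matOp (x : Fin m → ℝ) (a : Matrix ι ι ℝ) (F : ι → MvPolynomial (Fin m) ℝ) :
    evalVec x (matOp a F) = a.mulVec (evalVec x F) := by
  ext1 A
  simp [evalVec_apply, matOp_apply, Matrix.mulVec, dotProduct, smul_eval]

theorem evalVec_vecOp (x : Fin m → ℝ) (c : Fin m → Matrix ι ι ℝ)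
    (F : ι → MvPolynomial (Fin m) ℝ) :
    evalVec x (vecOp c F) = (∑ i, x i • c i).mulVec (evalVec x F) := by
  rw [vecOp, LinearMap.sum_apply, map_sum, Matrix.sum_mulVec]
  refine sum_congr rfl fun i _ => ?_
  rw [Module.End.mul_apply, evalVec_matOp, Matrix.smul_mulVec, ← Matrix.mulVec_smul]
  congr 1
  ext1 A
  simp [evalVec_apply, diagOp_apply, coordOp]

variable {α : J → Fin m → ℝ} (hα : ∀ a, α a ≠ 0) (k : J → ℝ) {c : Fin m → Matrix ι ι ℝ}

theorem vec_mul_vec (hc : IsCliffordFamily c) (x : Fin m → ℝ) :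
    (∑ i, x i • c i) * (∑ i, x i • c i) = -(∑ i, x i ^ 2) • (1 : Matrix ι ι ℝ) := by
  have h := hc.sum_sq (x := fun i => x i • (1 : Matrix ι ι ℝ))
    (fun i j => (Commute.one_right _).smul_right _)
    (fun i j => ((Commute.one_right _).smul_right _))
  simp only [mul_smul_comm, mul_one, smul_smul] at h
  rw [h, neg_smul, sum_smul]
  simp [sq]

theorem evalVec_vecOp_vecOp (hc : IsCliffordFamily c) {x : Fin m → ℝ} (hx : ∑ i, x i ^ 2 = 1)
    (F : ι → MvPolynomial (Fin m) ℝ) :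
    evalVec x (vecOp c (vecOp c F)) = -evalVec x F := by
  rw [evalVec_vecOp, evalVec_vecOp, Matrix.mulVec_mulVec, vec_mul_vec hc, hx]
  simp [Matrix.neg_mulVec]

/-- Multiplication by a power of the squared length. -/
theorem evalVec_neg_vecOp_sq_pow (hc : IsCliffordFamily c) {x : Fin m → ℝ}
    (hx : ∑ i, x i ^ 2 = 1) (n : ℕ) (F : ι → MvPolynomial (Fin m) ℝ) :
    evalVec x (((-(vecOp c * vecOp c)) ^ n) F) = evalVec x F := by
  induction n with
  | zero => simp
  | succ n ih =>
    rw [pow_succ', Module.End.mul_apply, LinearMap.neg_apply, map_neg, Module.End.mul_apply,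
      evalVec_vecOp_vecOp hc hx, neg_neg, ih]

theorem eulerOp_neg_vecOp_sq_pow {F : ι → MvPolynomial (Fin m) ℝ} {l : ℕ}
    (hF : eulerOp m ι F = (l : ℝ) • F) (n : ℕ) :
    eulerOp m ι (((-(vecOp c * vecOp c)) ^ n) F) =
      ((2 * n + l : ℕ) : ℝ) • ((-(vecOp c * vecOp c)) ^ n) F := by
  have h1 : ∀ (G : ι → MvPolynomial (Fin m) ℝ) (l : ℕ), eulerOp m ι G = (l : ℝ) • G →
      eulerOp m ι (vecOp c G) = ((l + 1 : ℕ) : ℝ) • vecOp c G := by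
    intro G l hG
    have := LinearMap.congr_fun (eulerOp_mul_vecOp (ι := ι) (c := c)) G
    simp only [Module.End.mul_apply, LinearMap.add_apply, hG, Module.End.one_apply] at this
    rw [this, map_add, map_smul, Nat.cast_succ, add_smul, one_smul]
  induction n with
  | zero => simpa using hF
  | succ n ih =>
    rw [pow_succ', Module.End.mul_apply, LinearMap.neg_apply, map_neg, Module.End.mul_apply,
      h1 _ _ (h1 _ _ ih), smul_neg]
    congr 3
    ring

theorem sphOp_commute_neg_vecOp_sq (hc : IsCliffordFamily c)
    (hγ : ∑ a, k a = (1 - (m : ℝ)) / 2) :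
    Commute (sphOp hα k c) (-(vecOp c * vecOp c)) := by
  refine Commute.neg_right (show sphOp hα k c * (vecOp c * vecOp c) =
    vecOp c * vecOp c * sphOp hα k c from ?_)
  refine LinearMap.ext fun F => ?_
  have h := LinearMap.congr_fun (sphOp_mul_vecOp hα k hc hγ)
  simp only [Module.End.mul_apply, LinearMap.neg_apply] at h ⊢
  rw [h, h, map_neg, neg_neg]

/-- `sphOp` preserves the degree, so its value on `F` is homogeneous and vanishes identically once
it vanishes on the regular part of the sphere. -/
theorem evalVec_homogeneous_kernel (hm : m ≠ 0) (hc : IsCliffordFamily c)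
    (hγ : ∑ a, k a = (1 - (m : ℝ)) / 2) {n : ℕ} {F : ι → MvPolynomial (Fin m) ℝ}
    (hF : eulerOp m ι F = (n : ℝ) • F)
    (h : ∀ x : Fin m → ℝ, ∑ i, x i ^ 2 = 1 → (∀ a, ∑ i, α a i * x i ≠ 0) →
      evalVec x (sphOp hα k c F) = 0) :
    ∃ v : ι → ℝ, F = (vecOp c ^ n) fun A => C (v A) := by
  refine exists_eq_vecOp_pow hα k hm hc hγ n F hF (funext fun A => ?_)
  have hE : eulerOp m ι (sphOp hα k c F) = (n : ℝ) • sphOp hα k c F := by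
    rw [← Module.End.mul_apply, (eulerOp_commute_sphOp hα k).eq, Module.End.mul_apply, hF, map_smul]
  refine eq_zero_of_isHomogeneous hm hα
    (isHomogeneous_of_polyEuler_eq (n := n) (congr_fun hE A)) fun x hx hr => ?_
  rw [← evalVec_apply, h x hx hr, Pi.zero_apply]

theorem evalVec_neg {F : ι → MvPolynomial (Fin m) ℝ} {n : ℕ}
    (hF : eulerOp m ι F = (n : ℝ) • F) (x : Fin m → ℝ) :
    evalVec (-x) F = (-1 : ℝ) ^ n • evalVec x F := by
  ext1 A
  have := (isHomogeneous_of_polyEuler_eq (n := n) (congr_fun hF A)).eval_smul_vec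
    (-1) x
  rwa [neg_one_smul, ← evalVec_apply, ← evalVec_apply] at this

theorem sum_range_two_mul {M : Type*} [AddCommMonoid M] (f : ℕ → M) (n : ℕ) :
    ∑ i ∈ range (2 * n), f i = ∑ i ∈ range n, f (2 * i) + ∑ i ∈ range n, f (2 * i + 1) := by
  induction n with
  | zero => simp
  | succ n ih =>
    rw [mul_add, mul_one, sum_range_succ, sum_range_succ, ih, sum_range_succ, sum_range_succ]
    abel

/-- A polynomial that is annihilated by the Dunkl-spherical Dirac operator on the regular part of
the unit sphere is there a combination of a constant and the vector variable. -/
theorem exists_evalVec_eq (hm : m ≠ 0) (hc : IsCliffordFamily c)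
    (hγ : ∑ a, k a = (1 - (m : ℝ)) / 2) (F : ι → MvPolynomial (Fin m) ℝ)
    (h : ∀ x : Fin m → ℝ, ∑ i, x i ^ 2 = 1 → (∀ a, ∑ i, α a i * x i ≠ 0) →
      evalVec x (sphOp hα k c F) = 0) :
    ∃ v w : ι → ℝ, ∀ x : Fin m → ℝ, ∑ i, x i ^ 2 = 1 →
      evalVec x F = v + (∑ i, x i • c i).mulVec w := by
  obtain ⟨N, hN⟩ : ∃ N, ∀ A, (F A).totalDegree < 2 * N :=
    ⟨∑ A, ((F A).totalDegree + 1), fun A => by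
      have := single_le_sum (f := fun A => (F A).totalDegree + 1) (fun A _ => Nat.zero_le _)
        (mem_univ A)
      omega⟩
  set H : ℕ → ι → MvPolynomial (Fin m) ℝ := fun l A => homogeneousComponent l (F A) with hH
  have hHE : ∀ l, eulerOp m ι (H l) = (l : ℝ) • H l := fun l => funext fun A => by
    have := (homogeneousComponent_isHomogeneous l (F A)).sum_X_mul_pderiv
    rw [← polyEuler_apply, ← Nat.cast_smul_eq_nsmul ℝ] at this
    exact this
  have hsum : F = ∑ l ∈ range (2 * N), H l := funext fun A => by
    rw [Finset.sum_apply, ← sum_homogeneousComponent (F A)]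
    refine sum_subset (range_subset_range.2 (hN A)) fun l _ hl => ?_
    exact homogeneousComponent_eq_zero _ _ (by simpa using hl)
  rw [sum_range_two_mul] at hsum
  -- `r` is multiplication by `|x|²`. It raises the degree by two, commutes with `sphOp` and leaves
  -- the values on the sphere unchanged, so the even components can be lifted to degree `2 N` and
  -- the odd ones to `2 N + 1`.
  set r := -(vecOp c * vecOp c) with hr
  set Fe := ∑ i ∈ range N, (r ^ (N - i)) (H (2 * i)) with hFe
  set Fo := ∑ i ∈ range N, (r ^ (N - i)) (H (2 * i + 1)) with hFo
  have hEe : eulerOp m ι Fe = ((2 * N : ℕ) : ℝ) • Fe := by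
    rw [hFe, map_sum, smul_sum]
    refine sum_congr rfl fun i hi => ?_
    rw [eulerOp_neg_vecOp_sq_pow (hHE _)]
    congr 2
    have := mem_range.1 hi
    omega
  have hEo : eulerOp m ι Fo = ((2 * N + 1 : ℕ) : ℝ) • Fo := by
    rw [hFo, map_sum, smul_sum]
    refine sum_congr rfl fun i hi => ?_
    rw [eulerOp_neg_vecOp_sq_pow (hHE _)]
    congr 2
    have := mem_range.1 hi
    omega
  have hev : ∀ x : Fin m → ℝ, ∑ i, x i ^ 2 = 1 → evalVec x F = evalVec x Fe + evalVec x Fo := by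
    intro x hx
    rw [hsum, hFe, hFo]
    simp only [map_add, map_sum, hr, evalVec_neg_vecOp_sq_pow hc hx]
  have hevS : ∀ x : Fin m → ℝ, ∑ i, x i ^ 2 = 1 → evalVec x (sphOp hα k c F) =
      evalVec x (sphOp hα k c Fe) + evalVec x (sphOp hα k c Fo) := by
    intro x hx
    have hcomm : ∀ (n : ℕ) G, sphOp hα k c ((r ^ n) G) = (r ^ n) (sphOp hα k c G) := by
      intro n G
      rw [← Module.End.mul_apply, ((sphOp_commute_neg_vecOp_sq hα k hc hγ).pow_right n).eq,
        Module.End.mul_apply]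
    rw [hsum, hFe, hFo]
    simp only [map_add, map_sum, hcomm]
    simp only [hr, evalVec_neg_vecOp_sq_pow hc hx]
  have hSE : ∀ {n : ℕ} {G : ι → MvPolynomial (Fin m) ℝ}, eulerOp m ι G = (n : ℝ) • G →
      eulerOp m ι (sphOp hα k c G) = (n : ℝ) • sphOp hα k c G := by
    intro n G hG
    rw [← Module.End.mul_apply, (eulerOp_commute_sphOp hα k).eq, Module.End.mul_apply, hG, map_smul]
  have hzero : ∀ x : Fin m → ℝ, ∑ i, x i ^ 2 = 1 → (∀ a, ∑ i, α a i * x i ≠ 0) →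
      evalVec x (sphOp hα k c Fe) = 0 ∧ evalVec x (sphOp hα k c Fo) = 0 := by
    intro x hx hreg
    have h1 := h x hx hreg
    -- The regular part of the sphere is symmetric, so comparing `x` and `-x` separates the even
    -- from the odd part.
    have h2 := h (-x) (by simpa using hx) (fun a => by simpa using hreg a)
    rw [hevS x hx] at h1
    rw [hevS (-x) (by simpa using hx), evalVec_neg (hSE hEe), evalVec_neg (hSE hEo)] at h2
    rw [pow_succ, pow_mul, neg_one_sq, one_pow, one_mul, one_smul, neg_one_smul,
      ← sub_eq_add_neg, sub_eq_zero] at h2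
    rw [← h2, ← two_smul ℝ] at h1
    have h3 := (smul_eq_zero.1 h1).resolve_left two_ne_zero
    exact ⟨h3, h2 ▸ h3⟩
  obtain ⟨v, hv⟩ := evalVec_homogeneous_kernel hα k hm hc hγ hEe fun x hx hx' => (hzero x hx hx').1
  obtain ⟨w, hw⟩ := evalVec_homogeneous_kernel hα k hm hc hγ hEo fun x hx hx' => (hzero x hx hx').2
  have hpow : ∀ (x : Fin m → ℝ) (_ : ∑ i, x i ^ 2 = 1) (n : ℕ) (G : ι → MvPolynomial (Fin m) ℝ),
      evalVec x ((vecOp c ^ (2 * n)) G) = (-1 : ℝ) ^ n • evalVec x G := by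
    intro x hx n G
    induction n with
    | zero => simp
    | succ n ih =>
      rw [mul_add, mul_one, pow_succ', pow_succ', Module.End.mul_apply, Module.End.mul_apply,
        evalVec_vecOp_vecOp hc hx, ih, pow_succ', neg_one_mul, neg_smul]
  have hC : ∀ (x : Fin m → ℝ) (v : ι → ℝ),
      evalVec x (fun A => (C (v A) : MvPolynomial (Fin m) ℝ)) = v := by
    intro x v
    ext1 A
    simp [evalVec_apply]
  -- The sign is the value of `X ^ (2 N)` on the sphere.
  refine ⟨(-1 : ℝ) ^ N • v, (-1 : ℝ) ^ N • w, fun x hx => ?_⟩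
  rw [hev x hx, hv, hw, hpow x hx, hC, pow_succ', Module.End.mul_apply, evalVec_vecOp, hpow x hx, hC]

end Homogenize

end

noncomputable section

set_option linter.unusedSectionVars false

open Finset

/-! ### Orthogonal layers of a filtration -/

section Filtration

variable {F : Type*} [NormedAddCommGroup F] [InnerProductSpace ℝ F]

/-- The orthogonal complement of `V n` in `V (n + 1)`. -/
def layer (V : ℕ → Submodule ℝ F) (n : ℕ) : Submodule ℝ F := V (n + 1) ⊓ (V n)ᗮ

variable {V : ℕ → Submodule ℝ F} [∀ n, FiniteDimensional ℝ (V n)]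

instance (n : ℕ) : FiniteDimensional ℝ (layer V n) :=
  Submodule.finiteDimensional_of_le inf_le_left

variable (V) in
/-- The orthogonal projection onto the `n`-th layer. -/
def layerProj (n : ℕ) : F →L[ℝ] F := (layer V n).starProjection

theorem layerProj_mem (n : ℕ) (u : F) : layerProj V n u ∈ layer V n :=
  Submodule.starProjection_apply_mem _ _

theorem inner_layerProj {n : ℕ} (u : F) {h : F} (hh : h ∈ layer V n) :
    inner ℝ (layerProj V n u) h = inner ℝ u h := by
  rw [← sub_eq_zero, ← inner_sub_left, ← neg_sub, inner_neg_left, neg_eq_zero]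
  exact Submodule.starProjection_inner_eq_zero u h hh

theorem inner_layerProj_right {n : ℕ} (u : F) {h : F} (hh : h ∈ layer V n) :
    inner ℝ h (layerProj V n u) = inner ℝ h u := by
  rw [real_inner_comm, inner_layerProj u hh, real_inner_comm]

theorem layerProj_eq_self {n : ℕ} {h : F} (hh : h ∈ layer V n) : layerProj V n h = h :=
  Submodule.starProjection_eq_self_iff.2 hh

theorem layerProj_eq_of_inner {n : ℕ} {u w : F} (hw : w ∈ layer V n)
    (h : ∀ k ∈ layer V n, inner ℝ w k = inner ℝ u k) : layerProj V n u = w := by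
  rw [← sub_eq_zero, ← inner_self_eq_zero (𝕜 := ℝ)]
  have hmem : layerProj V n u - w ∈ layer V n := sub_mem (layerProj_mem n u) hw
  rw [inner_sub_left, inner_layerProj _ hmem, h _ hmem, sub_self]

theorem norm_layerProj_le (n : ℕ) (u : F) : ‖layerProj V n u‖ ≤ ‖u‖ :=
  Submodule.norm_starProjection_apply_le _ u

/-- Test `u` against its own projection. -/
theorem norm_layerProj_le_of_inner {n : ℕ} {u : F} {b : ℝ} (hb : 0 ≤ b)
    (h : ∀ k ∈ layer V n, inner ℝ u k ≤ b * ‖k‖) : ‖layerProj V n u‖ ≤ b := by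
  rcases (norm_nonneg (layerProj V n u)).eq_or_lt with h0 | h0
  · rwa [← h0]
  · have := h _ (layerProj_mem n u)
    rw [← inner_layerProj u (layerProj_mem n u), real_inner_self_eq_norm_mul_norm] at this
    exact le_of_mul_le_mul_right this h0

theorem inner_eq_zero_of_mem_layer {n k : ℕ} (hV : Monotone V) (hkn : k ≤ n) {h v : F}
    (hh : h ∈ layer V n) (hv : v ∈ V k) : inner ℝ h v = 0 := by
  rw [real_inner_comm]
  exact hh.2 v (hV hkn hv)

theorem inner_eq_zero_of_layer_ne (hV : Monotone V) {n k : ℕ} (hnk : n ≠ k) {h h' : F}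
    (hh : h ∈ layer V n) (hh' : h' ∈ layer V k) : inner ℝ h h' = 0 := by
  rcases lt_or_gt_of_ne hnk with hlt | hlt
  · rw [real_inner_comm]
    exact inner_eq_zero_of_mem_layer hV hlt hh' hh.1
  · exact inner_eq_zero_of_mem_layer hV hlt hh hh'.1

theorem layerProj_eq_zero_of_mem (hV : Monotone V) {n k : ℕ} (hkn : k ≤ n) {v : F}
    (hv : v ∈ V k) : layerProj V n v = 0 :=
  layerProj_eq_of_inner (zero_mem _) fun h hh => by
    rw [inner_zero_left, real_inner_comm, inner_eq_zero_of_mem_layer hV hkn hh hv]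

theorem eq_sum_layerProj (hV : Monotone V) (hV0 : V 0 = ⊥) {n : ℕ} {v : F} (hv : v ∈ V n) :
    v = ∑ k ∈ range n, layerProj V k v := by
  induction n generalizing v with
  | zero => simpa [hV0] using hv
  | succ n ih =>
    set w := (V n).starProjection v with hw
    have hwn : w ∈ V n := Submodule.starProjection_apply_mem _ _
    have h1 : v - w ∈ layer V n :=
      ⟨sub_mem hv (hV n.le_succ hwn), Submodule.sub_starProjection_mem_orthogonal v⟩
    have h2 : layerProj V n v = v - w := by
      conv_lhs => rw [← sub_add_cancel v w]
      rw [map_add, layerProj_eq_self h1, layerProj_eq_zero_of_mem hV le_rfl hwn, add_zero]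
    have h3 : ∀ k ∈ range n, layerProj V k v = layerProj V k w := by
      intro k hk
      refine layerProj_eq_of_inner (layerProj_mem _ _) fun h hh => ?_
      rw [inner_layerProj _ hh, ← sub_eq_zero, ← inner_sub_left, ← neg_sub, inner_neg_left,
        inner_eq_zero_of_mem_layer hV (mem_range.1 hk) h1 hh.1, neg_zero]
    rw [sum_range_succ, h2, sum_congr rfl h3, ← ih hwn, add_sub_cancel]

/-- Bessel's inequality: expand `0 ≤ ‖u - w‖ ^ 2` for the partial sum `w` of the orthogonal
components. -/
theorem sum_sq_norm_layerProj_le (hV : Monotone V) (s : Finset ℕ) (u : F) :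
    ∑ k ∈ s, ‖layerProj V k u‖ ^ 2 ≤ ‖u‖ ^ 2 := by
  set w := ∑ k ∈ s, layerProj V k u with hw
  have h1 : ∀ k ∈ s, inner ℝ u (layerProj V k u) = ‖layerProj V k u‖ ^ 2 := fun k _ => by
    rw [← inner_layerProj u (layerProj_mem k u), real_inner_self_eq_norm_sq]
  have h2 : inner ℝ u w = ∑ k ∈ s, ‖layerProj V k u‖ ^ 2 := by
    rw [hw, inner_sum, sum_congr rfl h1]
  have h3 : ‖w‖ ^ 2 = ∑ k ∈ s, ‖layerProj V k u‖ ^ 2 := by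
    rw [← real_inner_self_eq_norm_sq, hw, sum_inner]
    refine sum_congr rfl fun k hk => ?_
    rw [inner_sum, sum_eq_single k, real_inner_self_eq_norm_sq]
    · exact fun l _ hl => inner_eq_zero_of_layer_ne hV hl.symm (layerProj_mem _ _)
        (layerProj_mem _ _)
    · exact fun h => absurd hk h
  have h4 : 0 ≤ ‖u - w‖ ^ 2 := sq_nonneg _
  rw [norm_sub_sq_real, h2, h3] at h4
  linarith

theorem inner_eq_zero_of_layerProj_eq_zero (hV : Monotone V) (hV0 : V 0 = ⊥) {u : F}
    (hu : ∀ n, layerProj V n u = 0) {n : ℕ} {v : F} (hv : v ∈ V n) : inner ℝ u v = 0 := by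
  rw [eq_sum_layerProj hV hV0 hv, inner_sum]
  refine sum_eq_zero fun k _ => ?_
  rw [← inner_layerProj u (layerProj_mem k v), hu, inner_zero_left]

/-- An isometric automorphism that preserves the filtration does not change the norms of the
components. -/
theorem norm_layerProj_map_le {n : ℕ} {S : F →ₗ[ℝ] F} (hS : ∀ u v, inner ℝ (S u) v = inner ℝ u (S v))
    (hS' : ∀ u, ‖S u‖ = ‖u‖) (hSV : ∀ n, ∀ v ∈ V n, S v ∈ V n) (u : F) :
    ‖layerProj V n (S u)‖ ≤ ‖layerProj V n u‖ := by
  refine norm_layerProj_le_of_inner (norm_nonneg _) fun k hk => ?_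
  have hSk : S k ∈ layer V n := ⟨hSV _ _ hk.1, fun v hv => by
    rw [← hS]; exact hk.2 _ (hSV _ _ hv)⟩
  rw [hS, ← inner_layerProj u hSk, ← hS' k]
  exact real_inner_le_norm _ _

/-- A symmetric isometry that preserves the filtration and acts by `(-1)^n` on `V (n + 1) / V n`
acts by `(-1)^n` on the `n`-th layer. -/
theorem parity_eq {N : F →ₗ[ℝ] F} (hN : ∀ u v, inner ℝ (N u) v = inner ℝ u (N v))
    (hNV : ∀ n, ∀ v ∈ V n, N v ∈ V n) (hNV' : ∀ n, ∀ v ∈ V (n + 1), N v - (-1 : ℝ) ^ n • v ∈ V n)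
    {n : ℕ} {h : F} (hh : h ∈ layer V n) : N h = (-1 : ℝ) ^ n • h := by
  rw [← sub_eq_zero, ← inner_self_eq_zero (𝕜 := ℝ)]
  -- The difference lies in `V n`, while `h` and, by symmetry of `N`, also `N h` are orthogonal to
  -- `V n`.
  have h1 := hNV' n h hh.1
  rw [inner_sub_left, hN, inner_smul_left, real_inner_comm, hh.2 _ (hNV _ _ h1), real_inner_comm, hh.2 _ h1]
  simp

variable {Y N : F →ₗ[ℝ] F}

/-- A symmetric operator of degree one that is odd with respect to a parity operator maps a layer
to the sum of the two neighbouring ones. -/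
theorem map_eq_layerProj_add (hV : Monotone V) (hV0 : V 0 = ⊥)
    (hY : ∀ u v, inner ℝ (Y u) v = inner ℝ u (Y v)) (hYV : ∀ n, ∀ v ∈ V n, Y v ∈ V (n + 1))
    (hN : ∀ u v, inner ℝ (N u) v = inner ℝ u (N v)) (hNN : ∀ u, N (N u) = u)
    (hNV : ∀ n, ∀ v ∈ V n, N v ∈ V n) (hNV' : ∀ n, ∀ v ∈ V (n + 1), N v - (-1 : ℝ) ^ n • v ∈ V n)
    (hYN : ∀ u, Y (N u) = -N (Y u)) {n : ℕ} {h : F} (hh : h ∈ layer V (n + 1)) :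
    Y h = layerProj V (n + 2) (Y h) + layerProj V n (Y h) := by
  -- As `h` lies in `V (n + 2)`, the vector `Y h` lies in `V (n + 3)` and has components in the
  -- layers `0, …, n + 2` only.
  have h1 := eq_sum_layerProj hV hV0 (hYV _ _ hh.1)
  -- Parity: two elements of the same layer get the same sign from `N`, but `Y` anticommutes with
  -- `N`, so `⟨Y h, k⟩` equals its own negative.
  have h2 : layerProj V (n + 1) (Y h) = 0 := by
    refine layerProj_eq_of_inner (zero_mem _) fun k hk => ?_
    have e1 : inner ℝ (Y (N h)) (N k) = inner ℝ (Y h) k := by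
      rw [parity_eq hN hNV hNV' hh, parity_eq hN hNV hNV' hk, map_smul, inner_smul_left,
        inner_smul_right, ← mul_assoc]
      simp [← mul_pow]
    have e2 : inner ℝ (Y (N h)) (N k) = -inner ℝ (Y h) k := by
      rw [hYN, inner_neg_left, hN, hNN]
    rw [inner_zero_left]
    linarith
  -- `Y` moved to the other side carries layer `k < n` into `V (k + 2)`, which is contained in `V (n
  -- + 1)` and so orthogonal to `h`.
  have h3 : ∑ k ∈ range n, layerProj V k (Y h) = 0 := by
    refine sum_eq_zero fun k hk => layerProj_eq_of_inner (zero_mem _) fun v hv => ?_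
    rw [inner_zero_left, hY, inner_eq_zero_of_mem_layer hV _ hh (hYV _ _ hv.1)]
    have := mem_range.1 hk
    omega
  rw [show n + 1 + 1 + 1 = n + 3 by ring, sum_range_succ, sum_range_succ, sum_range_succ, h2, h3,
    zero_add, add_zero, add_comm] at h1
  exact h1

/-- The transpose of `map_eq_layerProj_add`: test against the layer `n + 1` and move `Y` to the test
vector. -/
theorem layerProj_map (hV : Monotone V) (hV0 : V 0 = ⊥)
    (hY : ∀ u v, inner ℝ (Y u) v = inner ℝ u (Y v)) (hYV : ∀ n, ∀ v ∈ V n, Y v ∈ V (n + 1))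
    (hN : ∀ u v, inner ℝ (N u) v = inner ℝ u (N v)) (hNN : ∀ u, N (N u) = u)
    (hNV : ∀ n, ∀ v ∈ V n, N v ∈ V n) (hNV' : ∀ n, ∀ v ∈ V (n + 1), N v - (-1 : ℝ) ^ n • v ∈ V n)
    (hYN : ∀ u, Y (N u) = -N (Y u)) (n : ℕ) (u : F) :
    layerProj V (n + 1) (Y u) = layerProj V (n + 1) (Y (layerProj V n u)) +
      layerProj V (n + 1) (Y (layerProj V (n + 2) u)) := by
  refine layerProj_eq_of_inner (add_mem (layerProj_mem _ _) (layerProj_mem _ _)) fun k hk => ?_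
  have h1 := map_eq_layerProj_add hV hV0 hY hYV hN hNN hNV hNV' hYN hk
  rw [inner_add_left, inner_layerProj _ hk, inner_layerProj _ hk, hY, hY, hY,
    ← inner_layerProj_right (Y k) (layerProj_mem n u),
    ← inner_layerProj_right (Y k) (layerProj_mem (n + 2) u), inner_layerProj _ (layerProj_mem _ _),
    inner_layerProj _ (layerProj_mem _ _), ← inner_add_right, add_comm, ← h1]

end Filtration

end

noncomputable section

set_option linter.unusedSectionVars false

open MvPolynomial Finset MeasureTheory

/-! ### The degree filtration of polynomials -/

section Degree

variable {m : ℕ}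

variable (m) in
/-- The polynomials of degree less than `n`. -/
def polyLT (n : ℕ) : Submodule ℝ (MvPolynomial (Fin m) ℝ) :=
  restrictSupport ℝ {a | a.degree < n}

theorem mem_polyLT {n : ℕ} {p : MvPolynomial (Fin m) ℝ} :
    p ∈ polyLT m n ↔ ∀ a, coeff a p ≠ 0 → a.degree < n := by
  rw [polyLT, mem_restrictSupport_iff]
  exact ⟨fun h a ha => h (mem_coe.2 (mem_support_iff.2 ha)),
    fun h a ha => h a (mem_support_iff.1 (mem_coe.1 ha))⟩

theorem mem_polyLT_succ {n : ℕ} {p : MvPolynomial (Fin m) ℝ} :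
    p ∈ polyLT m (n + 1) ↔ p.totalDegree ≤ n := by
  rw [mem_polyLT, MvPolynomial.totalDegree, Finset.sup_le_iff]
  simp only [mem_support_iff, Finsupp.sum, Finsupp.degree_apply, Nat.lt_succ_iff]

theorem polyLT_zero : polyLT m 0 = ⊥ := by
  rw [eq_bot_iff]
  intro p hp
  rw [mem_polyLT] at hp
  rw [Submodule.mem_bot, MvPolynomial.ext_iff]
  intro a
  by_contra h
  exact absurd (hp a h) (Nat.not_lt_zero _)

theorem polyLT_mono : Monotone (polyLT m) := fun _ _ h _ hp =>
  mem_polyLT.2 fun a ha => (mem_polyLT.1 hp a ha).trans_le h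

theorem exists_mem_polyLT (p : MvPolynomial (Fin m) ℝ) : ∃ n, p ∈ polyLT m n :=
  ⟨_, mem_polyLT_succ.2 le_rfl⟩

instance (n : ℕ) : FiniteDimensional ℝ (polyLT m n) := by
  refine Submodule.finiteDimensional_of_le (S₂ := restrictTotalDegree (Fin m) ℝ n) fun p hp => ?_
  rw [mem_restrictTotalDegree, ← mem_polyLT_succ]
  exact polyLT_mono n.le_succ hp

theorem mul_mem_polyLT {n : ℕ} {p q : MvPolynomial (Fin m) ℝ} (hp : p.totalDegree ≤ 1)
    (hq : q ∈ polyLT m n) : p * q ∈ polyLT m (n + 1) := by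
  cases n with
  | zero =>
    rw [polyLT_zero, Submodule.mem_bot] at hq
    rw [hq, mul_zero]
    exact zero_mem _
  | succ n =>
    rw [mem_polyLT_succ] at hq ⊢
    have := totalDegree_mul p q
    omega

theorem totalDegree_linForm_le (α : Fin m → ℝ) : (linForm α).totalDegree ≤ 1 := by
  refine (totalDegree_finsetSum _ _).trans (Finset.sup_le fun i _ => ?_)
  refine (totalDegree_mul _ _).trans ?_
  simp

theorem polyReflect_mem_polyLT (α : Fin m → ℝ) {n : ℕ} {p : MvPolynomial (Fin m) ℝ}
    (hp : p ∈ polyLT m n) : polyReflect α p ∈ polyLT m n := by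
  rw [p.as_sum, map_sum]
  refine sum_mem fun a ha => ?_
  have hn := mem_polyLT.1 hp a (mem_support_iff.1 ha)
  refine polyLT_mono hn (mem_polyLT_succ.2 ?_)
  rw [polyReflect, aeval_monomial, Finsupp.prod_fintype _ _ (by simp)]
  refine (totalDegree_mul _ _).trans ?_
  rw [algebraMap_eq, totalDegree_C, zero_add, Finsupp.degree_eq_sum]
  refine (totalDegree_finsetProd _ _).trans (sum_le_sum fun i _ => ?_)
  refine (totalDegree_pow _ _).trans (mul_le_of_le_one_right (Nat.zero_le _) ?_)
  refine (totalDegree_sub _ _).trans (max_le (totalDegree_X _).le ((totalDegree_mul _ _).trans ?_))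
  rw [totalDegree_C, zero_add]
  exact totalDegree_linForm_le α

theorem pderiv_mem_polyLT (i : Fin m) {n : ℕ} {p : MvPolynomial (Fin m) ℝ}
    (hp : p ∈ polyLT m (n + 1)) : pderiv i p ∈ polyLT m n := by
  rw [mem_polyLT] at hp ⊢
  intro a ha
  rw [coeff_pderiv] at ha
  have := hp _ (left_ne_zero_of_mul ha)
  simpa using this

theorem polyEuler_sub_mem_polyLT {n : ℕ} {p : MvPolynomial (Fin m) ℝ}
    (hp : p ∈ polyLT m (n + 1)) : polyEuler p - (n : ℝ) • p ∈ polyLT m n := by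
  rw [mem_polyLT] at hp ⊢
  intro a ha
  rw [coeff_sub, coeff_polyEuler, coeff_smul, smul_eq_mul, ← sub_mul] at ha
  have h1 := hp a (right_ne_zero_of_mul ha)
  refine lt_of_le_of_ne (Nat.lt_succ_iff.1 h1) fun h => ?_
  rw [h] at ha
  simp at ha

/-- Composition with `x ↦ -x`. -/
def polyNeg : MvPolynomial (Fin m) ℝ →ₐ[ℝ] MvPolynomial (Fin m) ℝ := aeval fun i => -X i

theorem coeff_polyNeg (p : MvPolynomial (Fin m) ℝ) (a : Fin m →₀ ℕ) :
    coeff a (polyNeg p) = (-1) ^ a.degree * coeff a p := by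
  induction p using MvPolynomial.induction_on' with
  | monomial u r =>
    have : polyNeg (monomial u r : MvPolynomial (Fin m) ℝ) = monomial u ((-1) ^ u.degree * r) := by
      rw [polyNeg, aeval_monomial, monomial_eq, Finsupp.degree_eq_sum, map_mul, Finsupp.prod_fintype,
        Finsupp.prod_fintype]
      · simp only [neg_pow (X _ : MvPolynomial (Fin m) ℝ), prod_mul_distrib,
          prod_pow_eq_pow_sum, algebraMap_eq, map_pow, map_neg, map_one]
        ring
      · simp
      · simp
    rw [this, coeff_monomial, coeff_monomial]
    split_ifs with h
    · rw [h]
    · simp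
  | add p q hp hq => rw [map_add, coeff_add, coeff_add, hp, hq]; ring

theorem polyNeg_mem_polyLT {n : ℕ} {p : MvPolynomial (Fin m) ℝ} (hp : p ∈ polyLT m n) :
    polyNeg p ∈ polyLT m n := by
  rw [mem_polyLT] at hp ⊢
  intro a ha
  rw [coeff_polyNeg] at ha
  exact hp a (right_ne_zero_of_mul ha)

theorem polyNeg_sub_mem_polyLT {n : ℕ} {p : MvPolynomial (Fin m) ℝ}
    (hp : p ∈ polyLT m (n + 1)) : polyNeg p - (-1 : ℝ) ^ n • p ∈ polyLT m n := by
  rw [mem_polyLT] at hp ⊢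
  intro a ha
  rw [coeff_sub, coeff_polyNeg, coeff_smul, smul_eq_mul, ← sub_mul] at ha
  have h1 := hp a (right_ne_zero_of_mul ha)
  refine lt_of_le_of_ne (Nat.lt_succ_iff.1 h1) fun h => ?_
  rw [h] at ha
  simp at ha

end Degree

/-! ### The space of continuous functions on the sphere with the `L²` inner product -/

/-- Euclidean space. -/
abbrev Euc (m : ℕ) : Type := EuclideanSpace ℝ (Fin m)

/-- The unit sphere. -/
abbrev Sph (m : ℕ) : Type := Metric.sphere (0 : Euc m) 1

section SphFun

variable {m : ℕ}

variable (m) in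
/-- The surface measure of the sphere. -/
def sphMeasure : Measure (Sph m) := (volume : Measure (Euc m)).toSphere

instance : IsFiniteMeasure (sphMeasure m) := by unfold sphMeasure; infer_instance

instance : (sphMeasure m).IsOpenPosMeasure := by unfold sphMeasure; infer_instance

variable (m) in
/-- Continuous functions on the sphere, to be equipped with the `L²` inner product. -/
def SphFun : Type := C(Sph m, ℝ)

instance : AddCommGroup (SphFun m) := inferInstanceAs (AddCommGroup C(Sph m, ℝ))

instance : Module ℝ (SphFun m) := inferInstanceAs (Module ℝ C(Sph m, ℝ))

instance : FunLike (SphFun m) (Sph m) ℝ := inferInstanceAs (FunLike C(Sph m, ℝ) (Sph m) ℝ)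

instance : ContinuousMapClass (SphFun m) (Sph m) ℝ :=
  inferInstanceAs (ContinuousMapClass C(Sph m, ℝ) (Sph m) ℝ)

namespace SphFun

@[ext]
theorem ext {u v : SphFun m} (h : ∀ x, u x = v x) : u = v := ContinuousMap.ext h

@[simp] theorem add_apply (u v : SphFun m) (x : Sph m) : (u + v) x = u x + v x := rfl
@[simp] theorem sub_apply (u v : SphFun m) (x : Sph m) : (u - v) x = u x - v x := rfl
@[simp] theorem neg_apply (u : SphFun m) (x : Sph m) : (-u) x = -u x := rfl
@[simp] theorem smul_apply (r : ℝ) (u : SphFun m) (x : Sph m) : (r • u) x = r * u x := rfl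

theorem sum_apply {κ : Type*} (s : Finset κ) (u : κ → SphFun m) (x : Sph m) :
    (∑ i ∈ s, u i) x = ∑ i ∈ s, u i x :=
  map_sum (⟨⟨fun u : SphFun m => u x, rfl⟩, fun _ _ => rfl⟩ : SphFun m →+ ℝ) u s

theorem integrable_of_continuous {u : Sph m → ℝ} (hu : Continuous u) :
    Integrable u (sphMeasure m) :=
  hu.integrable_of_hasCompactSupport (HasCompactSupport.of_compactSpace u)

/-- The form is definite because the surface measure charges every nonempty open set. It sits on the
copy `SphFun m`, as `C(Sph m, ℝ)` already carries the supremum norm. -/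
instance innerCore : InnerProductSpace.Core ℝ (SphFun m) where
  inner u v := ∫ x, u x * v x ∂sphMeasure m
  conj_inner_symm u v := by simp [mul_comm]
  re_inner_nonneg u := integral_nonneg fun x => mul_self_nonneg _
  add_left u v w := by
    simp only [add_apply, add_mul]
    exact integral_add (integrable_of_continuous ((map_continuous u).mul (map_continuous w)))
      (integrable_of_continuous ((map_continuous v).mul (map_continuous w)))
  smul_left u v r := by
    simp [mul_assoc, integral_const_mul]
  definite u h := by
    have h1 : (fun x => u x * u x) =ᵐ[sphMeasure m] 0 :=
      (integral_eq_zero_iff_of_nonneg (fun x => mul_self_nonneg (u x))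
        (integrable_of_continuous ((map_continuous u).mul (map_continuous u)))).1 h
    have h2 := Continuous.ae_eq_iff_eq _ ((map_continuous u).mul (map_continuous u))
      continuous_zero |>.1 h1
    exact ext fun x => mul_self_eq_zero.1 (congr_fun h2 x)

instance : NormedAddCommGroup (SphFun m) := innerCore.toNormedAddCommGroup

instance : InnerProductSpace ℝ (SphFun m) := InnerProductSpace.ofCore innerCore.toCore

theorem inner_def (u v : SphFun m) : inner ℝ u v = ∫ x, u x * v x ∂sphMeasure m := rfl

/-- Multiplication by a continuous function. -/
def mulOp (w : C(Sph m, ℝ)) : SphFun m →ₗ[ℝ] SphFun m where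
  toFun u := (⟨fun x => w x * u x, by fun_prop⟩ : C(Sph m, ℝ))
  map_add' u v := ext fun x => mul_add _ _ _
  map_smul' r u := ext fun x => mul_left_comm _ _ _

@[simp] theorem mulOp_apply (w : C(Sph m, ℝ)) (u : SphFun m) (x : Sph m) :
    mulOp w u x = w x * u x := rfl

theorem inner_mulOp (w : C(Sph m, ℝ)) (u v : SphFun m) :
    inner ℝ (mulOp w u) v = inner ℝ u (mulOp w v) := by
  simp only [inner_def, mulOp_apply]
  congr 1
  ext x
  ring

theorem norm_mulOp_le (w : C(Sph m, ℝ)) {b : ℝ} (hb : 0 ≤ b) (hw : ∀ x, |w x| ≤ b)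
    (u : SphFun m) : ‖mulOp w u‖ ≤ b * ‖u‖ := by
  refine abs_le_of_sq_le_sq' ?_ (by positivity) |>.2
  rw [mul_pow, ← real_inner_self_eq_norm_sq, ← real_inner_self_eq_norm_sq, inner_def, inner_def,
    ← integral_const_mul]
  refine integral_mono (integrable_of_continuous (by fun_prop)) (integrable_of_continuous
    (by fun_prop)) fun x => ?_
  simp only [mulOp_apply]
  have : w x ^ 2 ≤ b ^ 2 := sq_le_sq' (abs_le.1 (hw x)).1 (abs_le.1 (hw x)).2
  nlinarith [mul_self_nonneg (u x)]

theorem norm_le_of_forall_abs_le {u : SphFun m} {b : ℝ} (hb : 0 ≤ b) (h : ∀ x, |u x| ≤ b) :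
    ‖u‖ ≤ b * Real.sqrt ((sphMeasure m).real Set.univ) := by
  refine abs_le_of_sq_le_sq' ?_ (by positivity) |>.2
  rw [mul_pow, Real.sq_sqrt measureReal_nonneg, ← real_inner_self_eq_norm_sq, inner_def]
  have : ∀ x, u x * u x ≤ b ^ 2 := fun x => by
    rw [← sq]
    exact sq_le_sq' (abs_le.1 (h x)).1 (abs_le.1 (h x)).2
  refine (integral_mono (integrable_of_continuous (by fun_prop)) (integrable_const _) this).trans ?_
  simp [mul_comm]

end SphFun

end SphFun

end

noncomputable section

set_option linter.unusedSectionVars false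

open MvPolynomial Finset MeasureTheory
open scoped Pointwise

/-! ### Polynomials, isometries and multiplication by linear forms on the sphere. -/

section SphPoly

variable {m : ℕ}

/-- The function on Euclidean space that is defined by a polynomial. -/
def polyFun (p : MvPolynomial (Fin m) ℝ) (x : Euc m) : ℝ := eval (x : Fin m → ℝ) p

@[fun_prop]
theorem continuous_polyFun (p : MvPolynomial (Fin m) ℝ) : Continuous (polyFun p) :=
  (MvPolynomial.continuous_eval p).comp (PiLp.continuous_ofLp 2 _)

theorem polyFun_add (p q : MvPolynomial (Fin m) ℝ) (x : Euc m) :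
    polyFun (p + q) x = polyFun p x + polyFun q x := by simp [polyFun]

theorem polyFun_mul (p q : MvPolynomial (Fin m) ℝ) (x : Euc m) :
    polyFun (p * q) x = polyFun p x * polyFun q x := by simp [polyFun]

theorem polyFun_linForm (α x : Euc m) : polyFun (linForm α) x = inner ℝ α x := by
  simp [polyFun, eval_linForm, PiLp.inner_apply, mul_comm]

theorem polyFun_contDiff (p : MvPolynomial (Fin m) ℝ) : ContDiff ℝ ⊤ (polyFun p) := by
  induction p using MvPolynomial.induction_on with
  | C a =>
    have : polyFun (C a : MvPolynomial (Fin m) ℝ) = fun _ => a := by ext; simp [polyFun]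
    rw [this]
    exact contDiff_const
  | add p q hp hq => simpa only [funext (polyFun_add p q)] using hp.add hq
  | mul_X p i hp =>
    have h1 : polyFun (p * X i) = fun x : Euc m => polyFun p x * x i := by
      ext y; simp [polyFun]
    have h2 : ContDiff ℝ ⊤ fun x : Euc m => x i := by fun_prop
    rw [h1]
    exact hp.mul h2

theorem fderiv_polyFun (p : MvPolynomial (Fin m) ℝ) (x v : Euc m) :
    fderiv ℝ (polyFun p) x v = ∑ i, v i * polyFun (pderiv i p) x := by
  have hd : ∀ p : MvPolynomial (Fin m) ℝ, DifferentiableAt ℝ (polyFun p) x := fun p =>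
    (polyFun_contDiff p).contDiffAt.differentiableAt (by simp)
  induction p using MvPolynomial.induction_on with
  | C a =>
    have : polyFun (C a : MvPolynomial (Fin m) ℝ) = fun _ => a := by ext; simp [polyFun]
    simp [this, polyFun]
  | add p q hp hq =>
    have : polyFun (p + q) = polyFun p + polyFun q := funext (polyFun_add p q)
    rw [this, fderiv_add (hd p) (hd q), _root_.add_apply, hp, hq, ← sum_add_distrib]
    refine sum_congr rfl fun i _ => ?_
    rw [map_add, polyFun_add, mul_add]
  | mul_X p j hp =>
    have h1 : polyFun (p * X j) = polyFun p * fun x : Euc m => x j := by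
      ext y; simp [polyFun]
    have h2 : HasFDerivAt (fun x : Euc m => x j) (EuclideanSpace.proj j : Euc m →L[ℝ] ℝ) x :=
      (EuclideanSpace.proj j : Euc m →L[ℝ] ℝ).hasFDerivAt
    rw [h1, ((hd p).hasFDerivAt.mul h2).fderiv]
    simp only [_root_.add_apply, _root_.smul_apply, smul_eq_mul, hp,
      Derivation.leibniz, pderiv_X, polyFun_add, polyFun_mul, mul_add, sum_add_distrib]
    have h3 : ∀ i, polyFun ((Pi.single i 1 : Fin m → MvPolynomial (Fin m) ℝ) j) x =
        if j = i then 1 else 0 := by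
      intro i
      rw [Pi.single_apply]
      split_ifs <;> simp [polyFun]
    simp only [h3, mul_ite, mul_one, mul_zero, sum_ite_eq, mem_univ, if_true, mul_sum]
    congr 1
    · simp [mul_comm]
    · refine sum_congr rfl fun i _ => ?_
      simp [polyFun]
      ring

/-- The restriction of a polynomial to the sphere. -/
def polyRes : MvPolynomial (Fin m) ℝ →ₗ[ℝ] SphFun m where
  toFun p := (⟨fun x => polyFun p x, by fun_prop⟩ : C(Sph m, ℝ))
  map_add' p q := SphFun.ext fun x => polyFun_add p q x
  map_smul' r p := SphFun.ext fun x => by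
    change polyFun (r • p) x = r * polyFun p x
    simp [polyFun, smul_eval]

theorem polyRes_apply (p : MvPolynomial (Fin m) ℝ) (x : Sph m) : polyRes p x = polyFun p x := rfl

theorem polyRes_sq_mul (p : MvPolynomial (Fin m) ℝ) :
    polyRes ((∑ i, X i * X i) * p) = polyRes p := by
  refine SphFun.ext fun x => ?_
  rw [polyRes_apply, polyRes_apply, polyFun_mul]
  have : ∑ i, (x : Euc m) i ^ 2 = 1 := by
    rw [← EuclideanSpace.real_norm_sq_eq, norm_eq_of_mem_sphere x, one_pow]
  simp [polyFun, ← sq, this]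

/-- The filtration of the functions on the sphere by the degree of polynomials. -/
def sphFilt (n : ℕ) : Submodule ℝ (SphFun m) := (polyLT m n).map polyRes

instance (n : ℕ) : FiniteDimensional ℝ (sphFilt n : Submodule ℝ (SphFun m)) := by
  unfold sphFilt; infer_instance

theorem sphFilt_mono : Monotone (sphFilt : ℕ → Submodule ℝ (SphFun m)) := fun _ _ h =>
  Submodule.map_mono (polyLT_mono h)

theorem sphFilt_zero : (sphFilt 0 : Submodule ℝ (SphFun m)) = ⊥ := by
  rw [sphFilt, polyLT_zero, Submodule.map_bot]

theorem polyRes_mem {n : ℕ} {p : MvPolynomial (Fin m) ℝ} (hp : p ∈ polyLT m n) :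
    polyRes p ∈ sphFilt n := Submodule.mem_map_of_mem hp

/-- A continuous function that is orthogonal to all polynomials is zero. -/
theorem eq_zero_of_inner_polyRes (u : SphFun m) (hu : ∀ p, inner ℝ u (polyRes p) = 0) :
    u = 0 := by
  -- Stone–Weierstrass is applied to the algebra of restricted polynomials, whose coordinates
  -- already separate points.
  let A : Subalgebra ℝ C(Sph m, ℝ) := AlgHom.range
    (AlgHom.ofLinearMap (A := MvPolynomial (Fin m) ℝ) (B := C(Sph m, ℝ)) 
      { toFun := fun p => ⟨fun x => polyFun p x, by fun_prop⟩
        map_add' := fun p q => ContinuousMap.ext fun x => polyFun_add p q x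
        map_smul' := fun r p => ContinuousMap.ext fun x => by simp [polyFun, smul_eval] }
      (ContinuousMap.ext fun x => by simp [polyFun])
      (fun p q => ContinuousMap.ext fun x => polyFun_mul p q x))
  have hA : A.SeparatesPoints := by
    intro x y hxy
    by_contra! h
    refine hxy (Subtype.ext (PiLp.ext fun i => ?_))
    have := h (fun x : Sph m => polyFun (X i) x) ⟨_, ⟨X i, rfl⟩, rfl⟩
    simpa [polyFun] using this
  rw [← inner_self_eq_zero (𝕜 := ℝ)]
  set M := ∫ x, |u x| ∂sphMeasure m with hM
  have hM0 : 0 ≤ M := integral_nonneg fun x => abs_nonneg _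
  refine le_antisymm (le_of_forall_pos_le_add fun ε hε => ?_) real_inner_self_nonneg
  -- With this accuracy the error `M * (ε / (M + 1))` in `⟨u, u⟩` is at most `ε`, also when `M = 0`.
  obtain ⟨⟨g, p, hp⟩, hg⟩ := ContinuousMap.exists_mem_subalgebra_near_continuousMap_of_separatesPoints
    A hA (u : C(Sph m, ℝ)) (ε / (M + 1)) (by positivity)
  have hgp : ∀ x, g x = polyRes p x := fun x => by rw [← hp]; rfl
  have h1 : inner ℝ u u = inner ℝ u (u - polyRes p) := by
    rw [inner_sub_right, hu, sub_zero]
  rw [h1, zero_add, SphFun.inner_def]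
  have h2 : ∀ x, u x * (u - polyRes p) x ≤ |u x| * (ε / (M + 1)) := by
    intro x
    refine (le_abs_self _).trans ?_
    rw [abs_mul]
    refine mul_le_mul_of_nonneg_left ?_ (abs_nonneg _)
    have := (ContinuousMap.norm_coe_le_norm _ x).trans hg.le
    rw [SphFun.sub_apply, ← hgp, abs_sub_comm]
    exact this
  refine (integral_mono (SphFun.integrable_of_continuous (by fun_prop))
    (SphFun.integrable_of_continuous (by fun_prop)) h2).trans ?_
  rw [integral_mul_const, ← hM, mul_div_assoc', div_le_iff₀ (by positivity)]
  nlinarith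

/-! ### Isometries -/

/-- The action of a linear isometry on the sphere. -/
def sphMap (R : Euc m ≃ₗᵢ[ℝ] Euc m) : C(Sph m, Sph m) :=
  ⟨fun x => ⟨R x, by simp⟩, by fun_prop⟩

/-- The surface measure of a set is, up to a dimensional factor, the volume of the cone over it. An
isometry maps cones to cones and preserves volume. -/
theorem measurePreserving_sphMap (R : Euc m ≃ₗᵢ[ℝ] Euc m) :
    MeasurePreserving (sphMap R) (sphMeasure m) (sphMeasure m) := by
  refine ⟨(sphMap R).continuous.measurable, Measure.ext fun s hs => ?_⟩
  rw [Measure.map_apply (sphMap R).continuous.measurable hs, sphMeasure,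
    Measure.toSphere_apply' _ hs,
    Measure.toSphere_apply' _ ((sphMap R).continuous.measurable hs)]
  congr 1
  have h : Set.Ioo (0 : ℝ) 1 • ((↑) '' (sphMap R ⁻¹' s) : Set (Euc m)) =
      R ⁻¹' (Set.Ioo (0 : ℝ) 1 • ((↑) '' s)) := by
    ext y
    simp only [Set.mem_smul, Set.mem_image, Set.mem_preimage, exists_exists_and_eq_and]
    constructor
    · rintro ⟨r, hr, z, hz, rfl⟩
      exact ⟨r, hr, sphMap R z, hz, by simp [sphMap]⟩
    · rintro ⟨r, hr, z, hz, hy⟩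
      refine ⟨r, hr, sphMap R.symm z, ?_, ?_⟩
      · convert hz using 1
        exact Subtype.ext (by simp [sphMap])
      · apply R.injective
        rw [map_smul, ← hy]
        simp [sphMap]
  rw [h]
  exact R.measurePreserving.measure_preimage_emb R.toHomeomorph.measurableEmbedding _

theorem integral_sphMap (R : Euc m ≃ₗᵢ[ℝ] Euc m) {u : Sph m → ℝ} (hu : Continuous u) :
    ∫ x, u (sphMap R x) ∂sphMeasure m = ∫ x, u x ∂sphMeasure m := by
  have := measurePreserving_sphMap R
  nth_rewrite 2 [← this.map_eq]
  rw [integral_map this.measurable.aemeasurable hu.aestronglyMeasurable]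

/-- Composition with an isometry. -/
def compOp (R : Euc m ≃ₗᵢ[ℝ] Euc m) : SphFun m →ₗ[ℝ] SphFun m where
  toFun u := (⟨fun x => u (sphMap R x), by fun_prop⟩ : C(Sph m, ℝ))
  map_add' u v := rfl
  map_smul' r u := rfl

theorem compOp_apply (R : Euc m ≃ₗᵢ[ℝ] Euc m) (u : SphFun m) (x : Sph m) :
    compOp R u x = u (sphMap R x) := rfl

theorem inner_compOp (R : Euc m ≃ₗᵢ[ℝ] Euc m) (u v : SphFun m) :
    inner ℝ (compOp R u) (compOp R v) = inner ℝ u v :=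
  integral_sphMap R (u := fun x => u x * v x) (by fun_prop)

theorem norm_compOp (R : Euc m ≃ₗᵢ[ℝ] Euc m) (u : SphFun m) : ‖compOp R u‖ = ‖u‖ := by
  rw [← sq_eq_sq₀ (norm_nonneg _) (norm_nonneg _), ← real_inner_self_eq_norm_sq, inner_compOp,
    real_inner_self_eq_norm_sq]

theorem inner_compOp_of_involutive {R : Euc m ≃ₗᵢ[ℝ] Euc m} (hR : ∀ x, R (R x) = x)
    (u v : SphFun m) : inner ℝ (compOp R u) v = inner ℝ u (compOp R v) := by
  have : compOp R (compOp R v) = v := SphFun.ext fun x => by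
    rw [compOp_apply, compOp_apply]
    congr 1
    exact Subtype.ext (hR x)
  rw [← inner_compOp R u (compOp R v), this]

/-- The reflection in the hyperplane orthogonal to `α`, as an isometry. -/
def reflIso (α : Euc m) : Euc m ≃ₗᵢ[ℝ] Euc m := (ℝ ∙ α)ᗮ.reflection

theorem reflIso_reflIso (α x : Euc m) : reflIso α (reflIso α x) = x :=
  Submodule.reflection_reflection _ x

theorem reflIso_apply (α x : Euc m) :
    reflIso α x = x - (2 * inner ℝ α x / ‖α‖ ^ 2) • α := by
  rw [reflIso, Submodule.reflection_orthogonal_apply, Submodule.reflection_singleton_apply]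
  simp only [RCLike.ofReal_real_eq_id, id, neg_sub, two_smul]
  rw [mul_div_assoc, two_mul, add_smul]

theorem sqLen_eq (α : Euc m) : sqLen (α : Fin m → ℝ) = ‖α‖ ^ 2 := by
  rw [EuclideanSpace.real_norm_sq_eq, sqLen]

theorem polyFun_polyReflect (α : Euc m) (p : MvPolynomial (Fin m) ℝ) (x : Euc m) :
    polyFun (polyReflect α p) x = polyFun p (reflIso α x) := by
  have : ∀ i, polyFun (polyReflect α (X i)) x = reflIso α x i := by
    intro i
    have := polyFun_linForm α x
    simp only [polyFun] at this
    simp only [polyFun, polyReflect, aeval_X, map_sub, eval_X, map_mul, eval_C, this, sqLen_eq,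
      reflIso_apply, PiLp.sub_apply, PiLp.smul_apply, smul_eq_mul]
    ring
  induction p using MvPolynomial.induction_on with
  | C a => simp [polyFun, polyReflect]
  | add p q hp hq => rw [map_add, polyFun_add, polyFun_add, hp, hq]
  | mul_X p i hp =>
    rw [map_mul, polyFun_mul, polyFun_mul, hp, this]
    simp [polyFun]

theorem compOp_reflIso_mem (α : Euc m) (n : ℕ) (v : SphFun m) (hv : v ∈ sphFilt n) :
    compOp (reflIso α) v ∈ sphFilt n := by
  obtain ⟨p, hp, rfl⟩ := hv
  refine ⟨polyReflect α p, polyReflect_mem_polyLT α hp, SphFun.ext fun x => ?_⟩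
  rw [polyRes_apply, polyFun_polyReflect]
  rfl

theorem norm_layerProj_compOp_reflIso_le (α : Euc m) (n : ℕ) (u : SphFun m) :
    ‖layerProj sphFilt n (compOp (reflIso α) u)‖ ≤ ‖layerProj sphFilt n u‖ :=
  norm_layerProj_map_le (inner_compOp_of_involutive (reflIso_reflIso α)) (norm_compOp _)
    (compOp_reflIso_mem α) u

variable (m) in
/-- The parity operator. -/
def negOp : SphFun m →ₗ[ℝ] SphFun m := compOp (LinearIsometryEquiv.neg ℝ)

theorem negOp_polyRes (p : MvPolynomial (Fin m) ℝ) : negOp m (polyRes p) = polyRes (polyNeg p) := by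
  refine SphFun.ext fun x => ?_
  rw [negOp, compOp_apply, polyRes_apply, polyRes_apply]
  have : ((sphMap (LinearIsometryEquiv.neg ℝ) x : Sph m) : Euc m) = -x := rfl
  rw [this]
  induction p using MvPolynomial.induction_on with
  | C a => simp [polyFun, polyNeg]
  | add p q hp hq => rw [map_add, polyFun_add, polyFun_add, hp, hq]
  | mul_X p i hp =>
    rw [map_mul, polyFun_mul, polyFun_mul, hp]
    simp [polyFun, polyNeg]

/-- Multiplication by the linear form `⟨α, x⟩`. -/
def linOp (α : Euc m) : SphFun m →ₗ[ℝ] SphFun m :=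
  SphFun.mulOp ⟨fun x => inner ℝ α (x : Euc m), by fun_prop⟩

theorem linOp_apply (α : Euc m) (u : SphFun m) (x : Sph m) :
    linOp α u x = inner ℝ α (x : Euc m) * u x := rfl

theorem linOp_polyRes (α : Euc m) (p : MvPolynomial (Fin m) ℝ) :
    linOp α (polyRes p) = polyRes (linForm α * p) :=
  SphFun.ext fun x => by rw [linOp_apply, polyRes_apply, polyRes_apply, polyFun_mul, polyFun_linForm]

theorem inner_linOp (α : Euc m) (u v : SphFun m) :
    inner ℝ (linOp α u) v = inner ℝ u (linOp α v) := SphFun.inner_mulOp _ u v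

theorem norm_linOp_le (α : Euc m) (u : SphFun m) : ‖linOp α u‖ ≤ ‖α‖ * ‖u‖ := by
  refine SphFun.norm_mulOp_le _ (norm_nonneg _) (fun x => ?_) u
  refine (abs_real_inner_le_norm α (x : Euc m)).trans ?_
  rw [norm_eq_of_mem_sphere x, mul_one]

theorem linOp_mem (α : Euc m) (n : ℕ) (v : SphFun m) (hv : v ∈ sphFilt n) :
    linOp α v ∈ sphFilt (n + 1) := by
  obtain ⟨p, hp, rfl⟩ := hv
  rw [linOp_polyRes]
  exact polyRes_mem (mul_mem_polyLT (totalDegree_linForm_le _) hp)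

theorem inner_negOp (u v : SphFun m) : inner ℝ (negOp m u) v = inner ℝ u (negOp m v) :=
  inner_compOp_of_involutive (fun x => by simp) u v

theorem negOp_negOp (u : SphFun m) : negOp m (negOp m u) = u := SphFun.ext fun x => by
  rw [negOp, compOp_apply, compOp_apply]
  congr 1
  exact Subtype.ext (by simp [sphMap])

theorem negOp_mem (n : ℕ) (v : SphFun m) (hv : v ∈ sphFilt n) : negOp m v ∈ sphFilt n := by
  obtain ⟨p, hp, rfl⟩ := hv
  rw [negOp_polyRes]
  exact polyRes_mem (polyNeg_mem_polyLT hp)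

theorem negOp_sub_mem (n : ℕ) (v : SphFun m) (hv : v ∈ sphFilt (n + 1)) :
    negOp m v - (-1 : ℝ) ^ n • v ∈ sphFilt n := by
  obtain ⟨p, hp, rfl⟩ := hv
  rw [negOp_polyRes, ← map_smul, ← map_sub]
  exact polyRes_mem (polyNeg_sub_mem_polyLT hp)

theorem linOp_negOp (α : Euc m) (u : SphFun m) : linOp α (negOp m u) = -negOp m (linOp α u) := by
  refine SphFun.ext fun x => ?_
  rw [SphFun.neg_apply, linOp_apply, negOp, compOp_apply, compOp_apply, linOp_apply]
  simp [sphMap]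

/-- Multiplication by a linear form maps a layer to the two neighbouring layers. -/
theorem linOp_eq_layerProj_add (α : Euc m) {n : ℕ} {h : SphFun m}
    (hh : h ∈ layer sphFilt (n + 1)) :
    linOp α h = layerProj sphFilt (n + 2) (linOp α h) + layerProj sphFilt n (linOp α h) :=
  map_eq_layerProj_add sphFilt_mono sphFilt_zero (inner_linOp α) (linOp_mem α) inner_negOp
    negOp_negOp negOp_mem negOp_sub_mem (linOp_negOp α) hh

theorem layerProj_linOp (α : Euc m) (n : ℕ) (u : SphFun m) :
    layerProj sphFilt (n + 1) (linOp α u) =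
      layerProj sphFilt (n + 1) (linOp α (layerProj sphFilt n u)) +
      layerProj sphFilt (n + 1) (linOp α (layerProj sphFilt (n + 2) u)) :=
  layerProj_map sphFilt_mono sphFilt_zero (inner_linOp α) (linOp_mem α) inner_negOp
    negOp_negOp negOp_mem negOp_sub_mem (linOp_negOp α) n u

end SphPoly

end

noncomputable section

set_option linter.unusedSectionVars false

open MvPolynomial Finset MeasureTheory

/-! ### Plane rotations, angular derivatives and integration by parts on the sphere. -/

section Rotation

variable {m : ℕ}

/-- The generator of the rotations of the `(i, j)` plane, `x ↦ x_i e_j - x_j e_i`. -/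
def rotGen (i j : Fin m) : Euc m →L[ℝ] Euc m :=
  (EuclideanSpace.proj i : Euc m →L[ℝ] ℝ).smulRight (EuclideanSpace.single j 1) -
    (EuclideanSpace.proj j : Euc m →L[ℝ] ℝ).smulRight (EuclideanSpace.single i 1)

/-- The orthogonal projection onto the `(i, j)` plane. -/
def planeProj (i j : Fin m) : Euc m →L[ℝ] Euc m :=
  (EuclideanSpace.proj i : Euc m →L[ℝ] ℝ).smulRight (EuclideanSpace.single i 1) +
    (EuclideanSpace.proj j : Euc m →L[ℝ] ℝ).smulRight (EuclideanSpace.single j 1)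

theorem rotGen_apply (i j : Fin m) (x : Euc m) :
    rotGen i j x = x i • EuclideanSpace.single j (1 : ℝ) - x j • EuclideanSpace.single i 1 := rfl

theorem planeProj_apply (i j : Fin m) (x : Euc m) :
    planeProj i j x = x i • EuclideanSpace.single i (1 : ℝ) + x j • EuclideanSpace.single j 1 := rfl

theorem rotGen_planeProj {i j : Fin m} (hij : i ≠ j) (x : Euc m) :
    rotGen i j (planeProj i j x) = rotGen i j x := by
  simp [rotGen_apply, planeProj_apply, hij, hij.symm]

theorem rotGen_rotGen {i j : Fin m} (hij : i ≠ j) (x : Euc m) :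
    rotGen i j (rotGen i j x) = -planeProj i j x := by
  simp [rotGen_apply, planeProj_apply, hij, hij.symm]
  abel

/-- The rotation of the `(i, j)` plane by the angle `t`. -/
def planeRot (i j : Fin m) (t : ℝ) (x : Euc m) : Euc m :=
  x + (Real.cos t - 1) • planeProj i j x + Real.sin t • rotGen i j x

theorem inner_planeProj (i j : Fin m) (x y : Euc m) :
    inner ℝ y (planeProj i j x) = x i * y i + x j * y j := by
  simp [planeProj_apply, inner_add_right, inner_smul_right, EuclideanSpace.inner_single_right]

theorem inner_rotGen (i j : Fin m) (x y : Euc m) :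
    inner ℝ y (rotGen i j x) = x i * y j - x j * y i := by
  simp [rotGen_apply, inner_sub_right, inner_smul_right, EuclideanSpace.inner_single_right]

theorem norm_planeRot {i j : Fin m} (hij : i ≠ j) (t : ℝ) (x : Euc m) :
    ‖planeRot i j t x‖ = ‖x‖ := by
  have h1 : inner ℝ x (planeProj i j x) = x i ^ 2 + x j ^ 2 := by
    rw [inner_planeProj]; ring
  have h2 : inner ℝ x (rotGen i j x) = 0 := by
    rw [inner_rotGen]; ring
  have h3 : inner ℝ (planeProj i j x) (planeProj i j x) = x i ^ 2 + x j ^ 2 := by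
    rw [inner_planeProj]
    simp [planeProj_apply, hij, hij.symm]
    ring
  have h4 : inner ℝ (planeProj i j x) (rotGen i j x) = 0 := by
    rw [inner_rotGen]
    simp [planeProj_apply, hij, hij.symm]
    ring
  have h5 : inner ℝ (rotGen i j x) (rotGen i j x) = x i ^ 2 + x j ^ 2 := by
    rw [inner_rotGen]
    simp [rotGen_apply, hij, hij.symm]
    ring
  rw [← sq_eq_sq₀ (norm_nonneg _) (norm_nonneg _), ← real_inner_self_eq_norm_sq,
    ← real_inner_self_eq_norm_sq, planeRot]
  simp only [inner_add_left, inner_add_right, inner_smul_left, inner_smul_right, h1, h2, h3, h4, h5,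
    real_inner_comm x, real_inner_comm (planeProj i j x) (rotGen i j x), RCLike.conj_to_real]
  have := Real.sin_sq_add_cos_sq t
  linear_combination (x i ^ 2 + x j ^ 2) * this

/-- The rotation of the `(i, j)` plane, as a linear map. -/
def planeRotLin (i j : Fin m) (t : ℝ) : Euc m →ₗ[ℝ] Euc m :=
  LinearMap.id + (Real.cos t - 1) • (planeProj i j).toLinearMap +
    Real.sin t • (rotGen i j).toLinearMap

theorem planeRotLin_apply (i j : Fin m) (t : ℝ) (x : Euc m) :
    planeRotLin i j t x = planeRot i j t x := by
  simp [planeRotLin, planeRot]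

/-- The rotation of the `(i, j)` plane, as an isometry. -/
def planeRotIso {i j : Fin m} (hij : i ≠ j) (t : ℝ) : Euc m ≃ₗᵢ[ℝ] Euc m :=
  LinearIsometry.toLinearIsometryEquiv
    ⟨planeRotLin i j t, fun x => by rw [planeRotLin_apply, norm_planeRot hij]⟩ rfl

theorem planeRot_zero (i j : Fin m) (x : Euc m) : planeRot i j 0 x = x := by simp [planeRot]

theorem hasDerivAt_planeRot {i j : Fin m} (hij : i ≠ j) (x : Euc m) (t : ℝ) :
    HasDerivAt (fun t => planeRot i j t x) (rotGen i j (planeRot i j t x)) t := by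
  have h : HasDerivAt (fun t => planeRot i j t x)
      (0 + (-Real.sin t) • planeProj i j x + Real.cos t • rotGen i j x) t :=
    ((hasDerivAt_const t x).add (((Real.hasDerivAt_cos t).sub_const 1).smul_const _)).add
      ((Real.hasDerivAt_sin t).smul_const _)
  convert h using 1
  simp only [planeRot, map_add, map_smul, rotGen_planeProj hij, rotGen_rotGen hij]
  module

/-- The angular derivative. -/
def angDeriv {W : Type*} [NormedAddCommGroup W] [NormedSpace ℝ W] (i j : Fin m) (w : Euc m → W)
    (x : Euc m) : W := fderiv ℝ w x (rotGen i j x)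

theorem hasDerivAt_comp_planeRot {W : Type*} [NormedAddCommGroup W] [NormedSpace ℝ W]
    {i j : Fin m} (hij : i ≠ j) {w : Euc m → W} {x : Euc m} {t : ℝ}
    (hw : DifferentiableAt ℝ w (planeRot i j t x)) :
    HasDerivAt (fun t => w (planeRot i j t x)) (angDeriv i j w (planeRot i j t x)) t :=
  hw.hasFDerivAt.comp_hasDerivAt t (hasDerivAt_planeRot hij x t)

theorem angDeriv_self {W : Type*} [NormedAddCommGroup W] [NormedSpace ℝ W] (i : Fin m)
    (w : Euc m → W) (x : Euc m) : angDeriv i i w x = 0 := by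
  simp [angDeriv, rotGen_apply]

/-- The integral of an angular derivative over the sphere vanishes. -/
theorem integral_angDeriv (i j : Fin m) {w : Euc m → ℝ}
    (hw : ∀ x ∈ Metric.sphere (0 : Euc m) 1, ContDiffAt ℝ 1 w x) :
    ∫ x : Sph m, angDeriv i j w x ∂sphMeasure m = 0 := by
  rcases eq_or_ne i j with rfl | hij
  · simp [angDeriv_self]
  have hd : ∀ x ∈ Metric.sphere (0 : Euc m) 1, DifferentiableAt ℝ w x := fun x hx =>
    (hw x hx).differentiableAt one_ne_zero
  have hcw : Continuous fun x : Sph m => w x := continuous_iff_continuousAt.2 fun x =>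
    (hw x x.2).continuousAt.comp continuous_subtype_val.continuousAt
  have hc : Continuous fun x : Sph m => angDeriv i j w x := by
    refine continuous_iff_continuousAt.2 fun x => ?_
    have h1 : ContinuousAt (fderiv ℝ w) (x : Euc m) :=
      ((hw x x.2).fderiv_right (m := 0) le_rfl).continuousAt
    have h2 : ContinuousAt (angDeriv i j w) (x : Euc m) :=
      h1.clm_apply (rotGen i j).continuous.continuousAt
    exact h2.comp continuous_subtype_val.continuousAt
  have hmem : ∀ t (x : Sph m), planeRot i j t x ∈ Metric.sphere (0 : Euc m) 1 := fun t x => by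
    rw [mem_sphere_zero_iff_norm, norm_planeRot hij, norm_eq_of_mem_sphere]
  obtain ⟨B, hB⟩ : ∃ B, ∀ x : Sph m, ‖angDeriv i j w x‖ ≤ B := by
    obtain ⟨B, hB⟩ := (isCompact_range hc).isBounded.exists_norm_le
    exact ⟨B, fun x => hB _ ⟨x, rfl⟩⟩
  -- The integral of `w` composed with the rotation by `t` does not depend on `t`; its derivative at
  -- `t = 0`, taken under the integral, is the integral in question.
  have hder := hasDerivAt_integral_of_dominated_loc_of_deriv_le (μ := sphMeasure m)
    (F := fun t (x : Sph m) => w (planeRot i j t x))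
    (F' := fun t (x : Sph m) => angDeriv i j w (planeRot i j t x)) (x₀ := 0) (s := Set.univ)
    (bound := fun _ => B) Filter.univ_mem
    (Filter.Eventually.of_forall fun t => Continuous.aestronglyMeasurable
      (hcw.comp (sphMap (planeRotIso hij t)).continuous))
    (by simpa only [planeRot_zero] using SphFun.integrable_of_continuous hcw)
    (by simpa only [planeRot_zero] using hc.aestronglyMeasurable)
    (Filter.Eventually.of_forall fun x t _ => hB ⟨_, hmem t x⟩)
    (integrable_const B)
    (Filter.Eventually.of_forall fun x t _ => hasDerivAt_comp_planeRot hij (hd _ (hmem t x)))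
  have hconst : (fun t => ∫ x : Sph m, w (planeRot i j t x) ∂sphMeasure m) =
      fun _ => ∫ x : Sph m, w x ∂sphMeasure m := funext fun t =>
    integral_sphMap (planeRotIso hij t) hcw
  have h := hder.2
  rw [hconst] at h
  have := h.unique (hasDerivAt_const _ _)
  simpa only [planeRot_zero] using this

/-- The angular derivative of a polynomial. -/
def polyAng (i j : Fin m) : Module.End ℝ (MvPolynomial (Fin m) ℝ) :=
  coordOp i * (pderiv j).toLinearMap - coordOp j * (pderiv i).toLinearMap

theorem polyAng_apply (i j : Fin m) (p : MvPolynomial (Fin m) ℝ) :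
    polyAng i j p = X i * pderiv j p - X j * pderiv i p := rfl

theorem angDeriv_polyFun (i j : Fin m) (p : MvPolynomial (Fin m) ℝ) (x : Euc m) :
    angDeriv i j (polyFun p) x = polyFun (polyAng i j p) x := by
  rw [angDeriv, rotGen_apply, map_sub, map_smul, map_smul, fderiv_polyFun, fderiv_polyFun]
  simp [polyFun, polyAng_apply]

theorem angDeriv_mul (i j : Fin m) {v w : Euc m → ℝ} {x : Euc m} (hv : DifferentiableAt ℝ v x)
    (hw : DifferentiableAt ℝ w x) :
    angDeriv i j (fun x => v x * w x) x = v x * angDeriv i j w x + w x * angDeriv i j v x := by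
  simp only [angDeriv]
  rw [fderiv_fun_mul hv hw]
  rfl

/-- Integration by parts. -/
theorem integral_angDeriv_mul (i j : Fin m) {w : Euc m → ℝ}
    (hw : ∀ x ∈ Metric.sphere (0 : Euc m) 1, ContDiffAt ℝ 1 w x) (p : MvPolynomial (Fin m) ℝ) :
    ∫ x : Sph m, angDeriv i j w x * polyFun p x ∂sphMeasure m =
      -∫ x : Sph m, w x * polyFun (polyAng i j p) x ∂sphMeasure m := by
  have hp : ∀ x, ContDiffAt ℝ 1 (polyFun p) x := fun x =>
    (polyFun_contDiff p).contDiffAt.of_le le_top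
  have h := integral_angDeriv i j fun x hx => (hw x hx).mul (hp x)
  have e : ∀ x : Sph m, angDeriv i j (fun x => w x * polyFun p x) x =
      w x * polyFun (polyAng i j p) x + angDeriv i j w x * polyFun p x := fun x => by
    rw [angDeriv_mul i j ((hw x x.2).differentiableAt one_ne_zero)
      ((hp x).differentiableAt one_ne_zero), angDeriv_polyFun, mul_comm (polyFun p _)]
  have hcw : Continuous fun x : Sph m => w x := continuous_iff_continuousAt.2 fun x =>
    (hw x x.2).continuousAt.comp continuous_subtype_val.continuousAt
  have hc : Continuous fun x : Sph m => angDeriv i j w x := by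
    refine continuous_iff_continuousAt.2 fun x => ?_
    have h1 : ContinuousAt (fderiv ℝ w) (x : Euc m) :=
      ((hw x x.2).fderiv_right (m := 0) le_rfl).continuousAt
    have h2 : ContinuousAt (angDeriv i j w) (x : Euc m) :=
      h1.clm_apply (rotGen i j).continuous.continuousAt
    exact h2.comp continuous_subtype_val.continuousAt
  simp only [e] at h
  have hcp : ∀ p : MvPolynomial (Fin m) ℝ, Continuous fun x : Sph m => polyFun p (x : Euc m) :=
    fun p => (continuous_polyFun p).comp continuous_subtype_val
  have hi := integral_add (μ := sphMeasure m)
    (SphFun.integrable_of_continuous (hcw.mul (hcp (polyAng i j p))))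
    (SphFun.integrable_of_continuous (hc.mul (hcp p)))
  simp only [Pi.mul_apply] at hi
  rw [hi] at h
  linarith

theorem inner_polyRes_polyAng (i j : Fin m) (p q : MvPolynomial (Fin m) ℝ) :
    inner ℝ (polyRes (polyAng i j p)) (polyRes q) =
      -inner ℝ (polyRes p) (polyRes (polyAng i j q)) := by
  have := integral_angDeriv_mul i j (w := polyFun p)
    (fun x _ => (polyFun_contDiff p).contDiffAt.of_le le_top) q
  simp only [angDeriv_polyFun] at this
  exact this

theorem polyAng_mem_polyLT (i j : Fin m) {n : ℕ} {p : MvPolynomial (Fin m) ℝ}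
    (hp : p ∈ polyLT m n) : polyAng i j p ∈ polyLT m n := by
  cases n with
  | zero =>
    rw [polyLT_zero, Submodule.mem_bot] at hp ⊢
    rw [hp, map_zero]
  | succ n =>
    exact sub_mem (mul_mem_polyLT (totalDegree_X _).le (pderiv_mem_polyLT j hp))
      (mul_mem_polyLT (totalDegree_X _).le (pderiv_mem_polyLT i hp))

/-- Angular derivatives preserve the filtration and are skew-symmetric, hence they also preserve its
orthogonal layers. -/
theorem polyRes_polyAng_mem_layer (i j : Fin m) {n : ℕ} {p : MvPolynomial (Fin m) ℝ}
    (hp : p ∈ polyLT m (n + 1)) (h : polyRes p ∈ layer sphFilt n) :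
    polyRes (polyAng i j p) ∈ layer sphFilt n := by
  refine ⟨polyRes_mem (polyAng_mem_polyLT i j hp), ?_⟩
  rintro _ ⟨q, hq, rfl⟩
  rw [real_inner_comm, inner_polyRes_polyAng, real_inner_comm,
    h.2 _ (polyRes_mem (polyAng_mem_polyLT i j hq)), neg_zero]

end Rotation

end

noncomputable section

set_option linter.unusedSectionVars false

open MvPolynomial Finset MeasureTheory

/-! ### Norm identities for angular derivatives and linear forms on one layer. -/

section LayerIdentities

variable {m : ℕ}

theorem polyEuler_mem_polyLT {n : ℕ} {p : MvPolynomial (Fin m) ℝ} (hp : p ∈ polyLT m n) :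
    polyEuler p ∈ polyLT m n := by
  rw [mem_polyLT] at hp ⊢
  intro a ha
  rw [coeff_polyEuler] at ha
  exact hp a (right_ne_zero_of_mul ha)

theorem exists_polyRes_eq {n : ℕ} {h : SphFun m} (hh : h ∈ layer sphFilt n) :
    ∃ p ∈ polyLT m (n + 1), polyRes p = h := hh.1

theorem eq_zero_of_mem_layer_of_mem {n : ℕ} {h : SphFun m} (hh : h ∈ layer sphFilt n)
    (hn : h ∈ sphFilt n) : h = 0 := by
  rw [← inner_self_eq_zero (𝕜 := ℝ)]
  exact hh.2 h hn

/-- The square of the length minus one vanishes on the sphere, so that the angular derivatives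
yield the Euler operator. -/
theorem sum_polyAng_polyAng (p : MvPolynomial (Fin m) ℝ) :
    ∑ i, ∑ j, polyAng i j (polyAng i j p) = (2 : ℝ) • ((∑ i, X i * X i) * ∑ i, pderiv i (pderiv i p) -
      polyEuler (polyEuler p) - ((m : ℝ) - 2) • polyEuler p) := by
  have e1 : ∀ i j : Fin m, polyAng i j (polyAng i j p) =
      (X i * X i * pderiv j (pderiv j p) + X j * X j * pderiv i (pderiv i p)) -
      (X i * (X j * pderiv j (pderiv i p)) + X j * (X i * pderiv i (pderiv j p))) -
      (X i * pderiv i p + X j * pderiv j p) + (if i = j then 2 * (X i * pderiv i p) else 0) := by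
    intro i j
    simp only [polyAng_apply, map_sub, Derivation.leibniz, smul_eq_mul, pderiv_X]
    rcases eq_or_ne i j with h | h
    · subst h; simp; ring
    · simp [h, h.symm]; ring
  have e2 : polyEuler (polyEuler p) = polyEuler p + ∑ i, ∑ j, X i * (X j * pderiv j (pderiv i p)) := by
    conv_lhs => rw [polyEuler_apply p, map_sum]
    simp only [Derivation.leibniz, polyEuler_X, smul_eq_mul, polyEuler_apply (pderiv _ p)]
    rw [sum_add_distrib, polyEuler_apply p, add_comm]
    congr 1
    · exact sum_congr rfl fun i _ => mul_comm _ _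
    · simp only [mul_sum]
  have e3 : ∑ i, ∑ j, (X j * (X i * pderiv i (pderiv j p)) : MvPolynomial (Fin m) ℝ) =
      ∑ i, ∑ j, X i * (X j * pderiv j (pderiv i p)) := sum_comm
  have e4 : ∑ i, ∑ j, (X j * X j * pderiv i (pderiv i p) : MvPolynomial (Fin m) ℝ) =
      ∑ i, ∑ j, X i * X i * pderiv j (pderiv j p) := sum_comm
  rw [e2]
  simp only [e1, sum_add_distrib, sum_sub_distrib, e3, sum_ite_eq, mem_univ, if_true,
    ← mul_sum, ← sum_mul, ← polyEuler_apply, sum_const, card_univ, Fintype.card_fin]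
  simp only [nsmul_eq_mul, smul_eq_C_mul, map_sub, map_natCast, mul_left_comm (X _) (m : MvPolynomial (Fin m) ℝ), ← mul_sum, ← polyEuler_apply]
  simp only [show (C (2:ℝ) : MvPolynomial (Fin m) ℝ) = 2 from map_ofNat C 2]
  ring

/-- By skew-symmetry the left side pairs `p` with `-∑ polyAng i j (polyAng i j p)`. Against the
layer, the Laplacian term drops out since it lowers the degree, and `polyEuler` acts as `l`. What
remains is the Laplace–Beltrami eigenvalue `l (l + m - 2)`, doubled because ordered pairs are
summed. -/
theorem sum_sq_norm_polyAng {l : ℕ} {p : MvPolynomial (Fin m) ℝ} (hp : p ∈ polyLT m (l + 1))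
    (h : polyRes p ∈ layer sphFilt l) :
    ∑ i, ∑ j, ‖polyRes (polyAng i j p)‖ ^ 2 = 2 * l * (l + m - 2) * ‖polyRes p‖ ^ 2 := by
  have e1 : ∀ i j, ‖polyRes (polyAng i j p)‖ ^ 2 =
      -inner ℝ (polyRes p) (polyRes (polyAng i j (polyAng i j p))) := fun i j => by
    rw [← real_inner_self_eq_norm_sq, inner_polyRes_polyAng]
  simp only [e1, sum_neg_distrib, ← inner_sum, ← map_sum]
  rw [sum_polyAng_polyAng, map_smul, map_sub, map_sub, polyRes_sq_mul, map_smul]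
  have z : ∀ q ∈ polyLT m l, inner ℝ (polyRes p) (polyRes q) = 0 := fun q hq => by
    rw [real_inner_comm]; exact h.2 _ (polyRes_mem hq)
  have hE := polyEuler_sub_mem_polyLT hp
  have h1 : inner ℝ (polyRes p) (polyRes (polyEuler p)) = l * ‖polyRes p‖ ^ 2 := by
    have := z _ hE
    rw [map_sub, map_smul, inner_sub_right, inner_smul_right, real_inner_self_eq_norm_sq] at this
    linarith
  have h2 : inner ℝ (polyRes p) (polyRes (polyEuler (polyEuler p))) = l * (l * ‖polyRes p‖ ^ 2) := by
    have := z _ (polyEuler_mem_polyLT hE)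
    rw [map_sub, Derivation.map_smul, map_sub, map_smul, inner_sub_right, inner_smul_right, h1] at this
    linarith
  have h3 : inner ℝ (polyRes p) (polyRes (∑ i, pderiv i (pderiv i p))) = 0 := by
    refine z _ (sum_mem fun i _ => ?_)
    have h4 := pderiv_mem_polyLT i hp
    exact pderiv_mem_polyLT i (polyLT_mono l.le_succ h4)
  rw [inner_smul_right, inner_sub_right, inner_sub_right, inner_smul_right, h1, h2, h3]
  ring

theorem norm_polyAng_le {l : ℕ} {p : MvPolynomial (Fin m) ℝ} (hp : p ∈ polyLT m (l + 1))
    (h : polyRes p ∈ layer sphFilt l) (i j : Fin m) :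
    ‖polyRes (polyAng i j p)‖ ≤ 2 * m * l * ‖polyRes p‖ := by
  have hm : (1 : ℝ) ≤ m := by
    have : 0 < m := i.pos
    exact_mod_cast this
  refine abs_le_of_sq_le_sq' ?_ (by positivity) |>.2
  have h1 : ‖polyRes (polyAng i j p)‖ ^ 2 ≤ ∑ i, ∑ j, ‖polyRes (polyAng i j p)‖ ^ 2 :=
    (single_le_sum (f := fun j => ‖polyRes (polyAng i j p)‖ ^ 2) (fun _ _ => sq_nonneg _)
      (mem_univ j)).trans (single_le_sum (f := fun i => ∑ j, ‖polyRes (polyAng i j p)‖ ^ 2)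
      (fun _ _ => sum_nonneg fun _ _ => sq_nonneg _) (mem_univ i))
  refine h1.trans ?_
  rw [sum_sq_norm_polyAng hp h, mul_pow]
  refine mul_le_mul_of_nonneg_right ?_ (sq_nonneg _)
  rcases Nat.eq_zero_or_pos l with rfl | hl
  · simp
  have hl : (1 : ℝ) ≤ l := by exact_mod_cast hl
  have : ((m : ℝ) - 1) * (l - 1) ≥ 0 := mul_nonneg (by linarith) (by linarith)
  have h2 : (l : ℝ) + m - 2 ≤ m * l := by nlinarith
  calc 2 * (l : ℝ) * (l + m - 2) ≤ 2 * l * (m * l) := by gcongr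
    _ ≤ (2 * m * l) ^ 2 := by 
      have h3 : (0 : ℝ) ≤ m * l ^ 2 := by positivity
      nlinarith [mul_le_mul_of_nonneg_right hm h3]

/-- Pigeonhole over the `m²` pairs: the total in `sum_sq_norm_polyAng` is at least `l² ‖p‖²`, since
`2 l (l + m - 2) - l² = l (l - 2 + 2 (m - 1))`. For `m = 1` this needs `l ≥ 2`. -/
theorem exists_le_norm_polyAng {l : ℕ} (hl : 2 ≤ l) (hm : m ≠ 0) {p : MvPolynomial (Fin m) ℝ}
    (hp : p ∈ polyLT m (l + 1)) (h : polyRes p ∈ layer sphFilt l) :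
    ∃ i j, l / m * ‖polyRes p‖ ≤ ‖polyRes (polyAng i j p)‖ := by
  by_contra! hc
  have hm' : (1 : ℝ) ≤ m := by exact_mod_cast Nat.one_le_iff_ne_zero.2 hm
  have hl' : (2 : ℝ) ≤ l := by exact_mod_cast hl
  have h1 := sum_sq_norm_polyAng hp h
  have hne : (univ : Finset (Fin m)).Nonempty := ⟨⟨0, Nat.pos_of_ne_zero hm⟩, mem_univ _⟩
  have h2 : ∑ i, ∑ j, ‖polyRes (polyAng i j p)‖ ^ 2 <
      ∑ i : Fin m, ∑ j : Fin m, (l / m * ‖polyRes p‖) ^ 2 :=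
    sum_lt_sum_of_nonempty hne fun i _ => sum_lt_sum_of_nonempty hne fun j _ =>
      pow_lt_pow_left₀ (hc i j) (norm_nonneg _) two_ne_zero
  rw [h1] at h2
  simp only [sum_const, card_univ, Fintype.card_fin, nsmul_eq_mul] at h2
  have h3 : (m : ℝ) * (m * (l / m * ‖polyRes p‖) ^ 2) = l ^ 2 * ‖polyRes p‖ ^ 2 := by
    field_simp
  have h4 : (0 : ℝ) ≤ l - 2 + 2 * (m - 1) := by linarith
  rw [h3] at h2
  nlinarith [sq_nonneg ‖polyRes p‖, mul_nonneg (mul_nonneg (zero_le_two.trans hl') h4) (sq_nonneg ‖polyRes p‖)]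

/-! ### Multiplication by a linear form -/

/-- The tangential part of the derivative in direction `α`. -/
def polyTan (α : Fin m → ℝ) (p : MvPolynomial (Fin m) ℝ) : MvPolynomial (Fin m) ℝ :=
  linForm α * polyEuler p - (∑ i, X i * X i) * ∑ i, C (α i) * pderiv i p

/-- In terms of angular derivatives the tangential derivative can be integrated by parts. -/
theorem polyTan_eq (α : Fin m → ℝ) (p : MvPolynomial (Fin m) ℝ) :
    polyTan α p = ∑ i, ∑ j, C (α i) * (X j * polyAng i j p) := by
  simp only [polyTan, polyAng_apply, linForm, polyEuler_apply, sum_mul_sum, mul_sub, sum_sub_distrib]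
  refine congr_arg₂ (· - ·) ?_ ?_
  · exact sum_congr rfl fun i _ => sum_congr rfl fun j _ => by ring
  · rw [sum_comm]
    exact sum_congr rfl fun i _ => sum_congr rfl fun j _ => by ring

theorem polyAng_X_mul (i j : Fin m) (q : MvPolynomial (Fin m) ℝ) :
    polyAng i j (X j * q) = X j * polyAng i j q + (X i * q - if i = j then X i * q else 0) := by
  simp only [polyAng_apply, Derivation.leibniz, smul_eq_mul, pderiv_X]
  rcases eq_or_ne i j with h | h
  · subst h; simp
  · simp [h, h.symm]; ring

theorem inner_polyRes_X_mul (j : Fin m) (p q : MvPolynomial (Fin m) ℝ) :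
    inner ℝ (polyRes (X j * p)) (polyRes q) = inner ℝ (polyRes p) (polyRes (X j * q)) := by
  simp only [SphFun.inner_def, polyRes_apply, polyFun_mul]
  congr 1
  ext x
  ring

/-- Integration by parts reverses the order of `X j` and `polyAng i j`. Restoring it produces one
term `X i * q` for each `j ≠ i`, whence the factor `m - 1`. -/
theorem inner_polyTan (α : Fin m → ℝ) (p q : MvPolynomial (Fin m) ℝ) :
    inner ℝ (polyRes (polyTan α p)) (polyRes q) = -inner ℝ (polyRes p) (polyRes (polyTan α q)) -
      ((m : ℝ) - 1) * inner ℝ (polyRes p) (polyRes (linForm α * q)) := by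
  have e : ∑ i, ∑ j, C (α i) * polyAng i j (X j * q) = polyTan α q + ((m : ℝ) - 1) • (linForm α * q) := by
    simp only [polyAng_X_mul, mul_add, mul_sub, sum_add_distrib, sum_sub_distrib, ← polyTan_eq]
    simp [linForm, sum_mul, smul_eq_C_mul]
    simp only [sub_mul, one_mul, mul_sum, mul_assoc, sum_sub_distrib]
  have : -inner ℝ (polyRes p) (polyRes (polyTan α q)) -
      ((m : ℝ) - 1) * inner ℝ (polyRes p) (polyRes (linForm α * q)) =
      -inner ℝ (polyRes p) (polyRes (∑ i, ∑ j, C (α i) * polyAng i j (X j * q))) := by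
    rw [e, map_add, map_smul, inner_add_right, inner_smul_right]
    ring
  rw [this, polyTan_eq]
  simp only [map_sum, sum_inner, inner_sum, ← smul_eq_C_mul, map_smul, inner_smul_left,
    inner_smul_right, inner_polyRes_X_mul, inner_polyRes_polyAng, sum_neg_distrib, mul_neg]
  simp

theorem polyTan_linForm_mul (α : Fin m → ℝ) (p : MvPolynomial (Fin m) ℝ) :
    polyTan α (linForm α * p) = linForm α * polyTan α p +
      (linForm α * (linForm α * p) - (∑ i, X i * X i) * (sqLen α • p)) := by
  have h : ∑ i, C (α i) * pderiv i (linForm α * p) =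
      linForm α * ∑ i, C (α i) * pderiv i p + sqLen α • p := by
    have : ∀ i, pderiv i (linForm α) = C (α i) := fun i => by
      simp [linForm, Derivation.leibniz, pderiv_X, Pi.single_apply]
    simp only [Derivation.leibniz, this, smul_eq_mul, mul_add, sum_add_distrib, mul_sum]
    congr 1
    · exact sum_congr rfl fun i _ => by ring
    · rw [sqLen, sum_smul]
      refine sum_congr rfl fun i _ => ?_
      rw [smul_eq_C_mul, map_pow]
      ring
  rw [polyTan, polyTan, h, Derivation.leibniz, polyEuler_linForm]
  simp only [smul_eq_mul]
  ring

/-- Take `q = ⟨α, x⟩ p` in `inner_polyTan`: on the sphere, the commutator of the tangential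
derivative with `⟨α, x⟩` is `⟨α, x⟩² - 1`. -/
theorem two_mul_inner_polyTan {α : Euc m} (hα : ‖α‖ = 1) (p : MvPolynomial (Fin m) ℝ) :
    2 * inner ℝ (polyRes (polyTan α p)) (linOp α (polyRes p)) =
      ‖polyRes p‖ ^ 2 - m * ‖linOp α (polyRes p)‖ ^ 2 := by
  have h1 := inner_polyTan α p (linForm α * p)
  rw [polyTan_linForm_mul, map_add, map_sub, polyRes_sq_mul, map_smul, sqLen_eq, hα, one_pow,
    one_smul, ← linOp_polyRes, ← linOp_polyRes, ← linOp_polyRes, ← linOp_polyRes, inner_add_right, inner_sub_right,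
    ← inner_linOp, ← inner_linOp α (polyRes p) (linOp α _), real_inner_self_eq_norm_sq,
    real_inner_self_eq_norm_sq, inner_linOp α (polyRes (polyTan α p)),
    ← inner_linOp α (polyRes p) (polyRes (polyTan α p)),
    real_inner_comm (polyRes (polyTan α p))] at h1
  linarith

/-- Up to lower degree on the sphere, the tangential derivative is `l` times multiplication by the
linear form, because `polyEuler` acts as `l` on the top degree and `∂_α` lowers the degree. -/
theorem polyRes_polyTan_sub_mem (α : Euc m) {l : ℕ} {p : MvPolynomial (Fin m) ℝ}
    (hp : p ∈ polyLT m (l + 1)) :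
    polyRes (polyTan α p) - (l : ℝ) • linOp α (polyRes p) ∈ sphFilt (l + 1) := by
  have h1 := polyEuler_sub_mem_polyLT hp
  have h2 : polyRes (polyTan α p) - (l : ℝ) • linOp α (polyRes p) =
      polyRes (linForm α * (polyEuler p - (l : ℝ) • p)) -
        polyRes (∑ i, C (α i) * pderiv i p) := by
    rw [polyTan, map_sub, polyRes_sq_mul, linOp_polyRes, mul_sub, map_sub, mul_smul_comm, map_smul]
    abel
  rw [h2]
  refine sub_mem (polyRes_mem (mul_mem_polyLT (totalDegree_linForm_le _) h1))
    (polyRes_mem (sum_mem fun i _ => ?_))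
  rw [← smul_eq_C_mul]
  exact Submodule.smul_mem _ _ (polyLT_mono l.le_succ (pderiv_mem_polyLT i hp))

/-- The squared norms of the two components of the product of a linear form of norm one and a
spherical harmonic. -/
theorem sq_norm_layerProj_linOp {α : Euc m} (hα : ‖α‖ = 1) {n : ℕ} {h : SphFun m}
    (hh : h ∈ layer sphFilt (n + 1)) :
    (2 * (n + 1) + m) * ‖layerProj sphFilt (n + 2) (linOp α h)‖ ^ 2 =
      ‖h‖ ^ 2 + (2 * (n + 1) + m - 4) * ‖layerProj sphFilt n (linOp α h)‖ ^ 2 := by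
  obtain ⟨p, hp, rfl⟩ := exists_polyRes_eq hh
  set a := layerProj sphFilt (n + 2) (linOp α (polyRes p)) with ha
  set b := layerProj sphFilt n (linOp α (polyRes p)) with hb
  have hY : linOp α (polyRes p) = a + b := linOp_eq_layerProj_add α hh
  have ham : a ∈ layer sphFilt (n + 2) := layerProj_mem _ _
  have hbm : b ∈ layer sphFilt n := layerProj_mem _ _
  have hab : inner ℝ a b = 0 := inner_eq_zero_of_layer_ne sphFilt_mono (by omega) ham hbm
  have hba : inner ℝ b a = 0 := by rw [real_inner_comm, hab]
  -- Here `p` has degree at most `l = n + 1`, so the upper component gets the factor `l`.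
  have h1 : inner ℝ (polyRes (polyTan α p)) a = (n + 1) * ‖a‖ ^ 2 := by
    have := inner_eq_zero_of_mem_layer sphFilt_mono le_rfl ham (polyRes_polyTan_sub_mem α hp)
    rw [hY, real_inner_comm, inner_sub_left, inner_smul_left, inner_add_left, hba,
      real_inner_self_eq_norm_sq] at this
    simp at this
    linarith
  -- The lower component comes from a polynomial of degree at most `n`. Moving the tangential
  -- derivative to it gives `-n`, and the correction in `inner_polyTan` a further `-(m - 1)`.
  have h2 : inner ℝ (polyRes (polyTan α p)) b = -(n + m - 1) * ‖b‖ ^ 2 := by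
    obtain ⟨q, hq, hqb⟩ := exists_polyRes_eq hbm
    have h3 : inner ℝ (polyRes p) (polyRes (linForm α * q)) = ‖b‖ ^ 2 := by
      rw [← linOp_polyRes, hqb, ← inner_linOp, hY, inner_add_left, hab, zero_add,
        real_inner_self_eq_norm_sq]
    have h4 := inner_eq_zero_of_mem_layer sphFilt_mono le_rfl hh (polyRes_polyTan_sub_mem α hq)
    rw [inner_sub_right, inner_smul_right, linOp_polyRes, h3] at h4
    rw [← hqb, inner_polyTan, h3, hqb]
    linarith
  have h5 := two_mul_inner_polyTan hα p
  have h6 : ‖a + b‖ ^ 2 = ‖a‖ ^ 2 + ‖b‖ ^ 2 := by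
    rw [norm_add_sq_real, hab]; ring
  rw [hY, inner_add_right, h1, h2, h6] at h5
  linarith

end LayerIdentities

/-! ### The classical spherical Dirac operator and its lower bound on a layer. -/

section SphericalDirac

/-- Eliminate `G * V` from the square by the anticommutator. The last term is `|x|²` times the
square of the Dirac operator, which has degree `-2`. -/
theorem quadratic_of_anticomm {A : Type*} [Ring A] [Algebra ℝ A] {E V G : A} {r : ℝ}
    (h1 : V * G + G * V = -(2 * E + r • 1)) (h2 : E * V = V * (E + 1))
    (h3 : E * G = G * (E - 1)) :
    (-E - V * G) * (-E - V * G) - (r - 2) • (-E - V * G) =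
      E * E + (r - 2) • E + -(V * V) * (G * G) := by
  have h5 : E * (V * G) = V * G * E := by
    rw [← mul_assoc, h2, mul_assoc, add_mul, h3, one_mul, mul_sub, mul_one, sub_add_cancel,
      ← mul_assoc]
  have h6 : V * G * (V * G) = -(2 : ℝ) • (V * G * E) + ((2 : ℝ) - r) • (V * G) - V * V * (G * G) := by
    have : G * V = -(2 * E + r • 1) - V * G := eq_sub_of_add_eq' h1
    have h7 : 2 * E * G = 2 * (G * (E - 1)) := by rw [mul_assoc, h3]
    rw [mul_assoc, ← mul_assoc G, this, sub_mul, neg_mul, add_mul, h7]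
    simp only [smul_mul_assoc, one_mul, mul_sub, mul_neg, mul_add, mul_one, two_mul,
      mul_smul_comm, add_mul, ← mul_assoc]
    module
  simp only [sub_mul, mul_sub, neg_mul, mul_neg, h5, h6]
  module

variable {m : ℕ} {ι : Type*} [Fintype ι] [DecidableEq ι]

/-- The spherical Dirac operator on polynomials. -/
def angDirac (c : Fin m → Matrix ι ι ℝ) : Module.End ℝ (ι → MvPolynomial (Fin m) ℝ) :=
  -(1 / 2 : ℝ) • ∑ i, ∑ j, matOp (c i * c j) * diagOp ι (polyAng i j)

theorem angDirac_apply (c : Fin m → Matrix ι ι ℝ) (F : ι → MvPolynomial (Fin m) ℝ) (A : ι) :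
    angDirac c F A = -(1 / 2 : ℝ) • ∑ i, ∑ j, ∑ B, (c i * c j) A B • polyAng i j (F B) := by
  simp [angDirac, LinearMap.sum_apply, Finset.sum_apply, Module.End.mul_apply, matOp_apply,
    diagOp_apply, -map_mul]

/-- The Dirac operator on polynomials. -/
def gradOp (c : Fin m → Matrix ι ι ℝ) : Module.End ℝ (ι → MvPolynomial (Fin m) ℝ) :=
  diracOp (J := Fin 0) (α := Fin.elim0) (fun a => a.elim0) Fin.elim0 c

theorem gradOp_eq (c : Fin m → Matrix ι ι ℝ) :
    gradOp c = ∑ i, matOp (c i) * diagOp ι (pderiv i).toLinearMap := by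
  simp [gradOp, diracOp, polyDunkl]

theorem gradOp_apply (c : Fin m → Matrix ι ι ℝ) (F : ι → MvPolynomial (Fin m) ℝ) (A : ι) :
    gradOp c F A = ∑ i, ∑ B, c i A B • pderiv i (F B) := by
  simp [gradOp_eq, LinearMap.sum_apply, Finset.sum_apply, Module.End.mul_apply, matOp_apply,
    diagOp_apply]

variable {c : Fin m → Matrix ι ι ℝ}

theorem diagOp_mul (φ ψ : Module.End ℝ (MvPolynomial (Fin m) ℝ)) :
    diagOp ι (φ * ψ) = diagOp ι φ * diagOp ι ψ := rfl

theorem diagOp_sub (φ ψ : Module.End ℝ (MvPolynomial (Fin m) ℝ)) :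
    diagOp ι (φ - ψ) = diagOp ι φ - diagOp ι ψ := rfl

/-- The identity `sum_angular` for the ordinary partial derivatives; the factor `1 / 2` accounts for
the sum over all pairs instead of `i < j`. -/
theorem angDirac_eq (hc : IsCliffordFamily c) :
    angDirac c = -eulerOp m ι - vecOp c * gradOp c := by
  have h := (isCliffordFamily_matOp (m := m) hc).sum_angular (x := fun i => diagOp ι (coordOp i))
    (fun i j => matOp_commute_diagOp _ _) fun i => diagOp ι (pderiv i).toLinearMap
  have hE : ∑ i : Fin m, diagOp ι (coordOp i) * diagOp ι (pderiv i).toLinearMap = eulerOp m ι := by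
    refine LinearMap.ext fun F => funext fun A => ?_
    simp [LinearMap.sum_apply, Finset.sum_apply, Module.End.mul_apply, diagOp_apply, coordOp,
      eulerOp, polyEuler_apply]
  rw [hE] at h
  rw [angDirac, gradOp_eq, vecOp]
  simp only [polyAng, diagOp_sub, diagOp_mul, map_mul]
  rw [h, smul_smul]
  norm_num
  abel

/-- The quadratic equation of the spherical Dirac operator. -/
theorem angDirac_mul_angDirac (hc : IsCliffordFamily c) :
    angDirac c * angDirac c - ((m : ℝ) - 2) • angDirac c =
      eulerOp m ι * eulerOp m ι + ((m : ℝ) - 2) • eulerOp m ι +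
        diagOp ι (LinearMap.mulLeft ℝ (∑ i, X i * X i)) * (gradOp c * gradOp c) := by
  have h1 : vecOp c * gradOp c + gradOp c * vecOp c = -(2 * eulerOp m ι + (m : ℝ) • 1) := by
    have := vecOp_anticomm_diracOp (J := Fin 0) (α := Fin.elim0) (fun a => a.elim0)
      Fin.elim0 hc
    simpa [gradOp] using this
  have h2 : eulerOp m ι * vecOp c = vecOp c * (eulerOp m ι + 1) := eulerOp_mul_vecOp
  have h3 : eulerOp m ι * gradOp c = gradOp c * (eulerOp m ι - 1) := eulerOp_mul_diracOp _ _
  have h4 := vecOp_mul_self hc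
  rw [angDirac_eq hc, ← neg_eq_iff_eq_neg.2 h4]
  exact quadratic_of_anticomm h1 h2 h3

theorem angDirac_mem_polyLT {n : ℕ} {F : ι → MvPolynomial (Fin m) ℝ}
    (hF : ∀ A, F A ∈ polyLT m n) (A : ι) : angDirac c F A ∈ polyLT m n := by
  rw [angDirac_apply]
  exact Submodule.smul_mem _ _ (sum_mem fun i _ => sum_mem fun j _ => sum_mem fun B _ =>
    Submodule.smul_mem _ _ (polyAng_mem_polyLT i j (hF B)))

theorem gradOp_mem_polyLT {n : ℕ} {F : ι → MvPolynomial (Fin m) ℝ}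
    (hF : ∀ A, F A ∈ polyLT m (n + 1)) (A : ι) : gradOp c F A ∈ polyLT m n := by
  rw [gradOp_apply]
  exact sum_mem fun i _ => sum_mem fun B _ =>
    Submodule.smul_mem _ _ (pderiv_mem_polyLT i (hF B))

theorem polyRes_angDirac (F : ι → MvPolynomial (Fin m) ℝ) (A : ι) :
    polyRes (angDirac c F A) =
      -(1 / 2 : ℝ) • ∑ i, ∑ j, ∑ B, (c i * c j) A B • polyRes (polyAng i j (F B)) := by
  simp only [angDirac_apply, map_smul, map_sum]

theorem polyRes_angDirac_mem_layer {n : ℕ} {F : ι → MvPolynomial (Fin m) ℝ}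
    (hF : ∀ A, F A ∈ polyLT m (n + 1)) (h : ∀ A, polyRes (F A) ∈ layer sphFilt n) (A : ι) :
    polyRes (angDirac c F A) ∈ layer sphFilt n := by
  rw [polyRes_angDirac]
  exact Submodule.smul_mem _ _ (sum_mem fun i _ => sum_mem fun j _ => sum_mem fun B _ =>
    Submodule.smul_mem _ _ (polyRes_polyAng_mem_layer i j (hF B) (h B)))

/-- In `angDirac_mul_angDirac` the Euler operator acts as `n` up to lower degree, and the square of
the Dirac operator lowers the degree. The difference of the two sides is thus in the layer and also
in the previous step of the filtration, so it vanishes. -/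
theorem polyRes_angDirac_angDirac (hc : IsCliffordFamily c) {n : ℕ}
    {F : ι → MvPolynomial (Fin m) ℝ} (hF : ∀ A, F A ∈ polyLT m (n + 1))
    (h : ∀ A, polyRes (F A) ∈ layer sphFilt n) (A : ι) :
    ((n : ℝ) * (n + m - 2)) • polyRes (F A) =
      polyRes (angDirac c (angDirac c F) A) - ((m : ℝ) - 2) • polyRes (angDirac c F A) := by
  rw [eq_comm, ← sub_eq_zero]
  have hF1 := angDirac_mem_polyLT (c := c) hF
  have h1 := polyRes_angDirac_mem_layer (c := c) hF h
  refine eq_zero_of_mem_layer_of_mem (n := n) (sub_mem (sub_mem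
    (polyRes_angDirac_mem_layer hF1 h1 A) (Submodule.smul_mem _ _ (h1 A)))
    (Submodule.smul_mem _ _ (h A))) ?_
  have e := congr_fun (LinearMap.congr_fun (angDirac_mul_angDirac (m := m) hc) F) A
  simp only [LinearMap.sub_apply, LinearMap.add_apply, LinearMap.smul_apply, Pi.sub_apply,
    Pi.add_apply, Pi.smul_apply, Module.End.mul_apply, diagOp_apply, LinearMap.mulLeft_apply] at e
  rw [← map_smul, ← map_sub, e, map_add, polyRes_sq_mul]
  have hE := polyEuler_sub_mem_polyLT (hF A)
  have hE2 := polyEuler_mem_polyLT hE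
  have hg := gradOp_mem_polyLT (c := c) fun B => polyLT_mono n.le_succ
    (gradOp_mem_polyLT (c := c) hF B)
  have : polyRes (eulerOp m ι (eulerOp m ι F) A + ((m : ℝ) - 2) • eulerOp m ι F A) +
      polyRes (gradOp c (gradOp c F) A) - ((n : ℝ) * (n + m - 2)) • polyRes (F A) =
      polyRes (polyEuler (polyEuler (F A) - (n : ℝ) • F A) +
        ((n : ℝ) + m - 2) • (polyEuler (F A) - (n : ℝ) • F A) + gradOp c (gradOp c F) A) := by
    rw [← map_add, ← map_smul, ← map_sub]
    congr 1
    simp only [eulerOp, diagOp_apply, Derivation.coeFn_coe, map_sub, Derivation.map_smul]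
    module
  rw [this]
  exact polyRes_mem (add_mem (add_mem hE2 (Submodule.smul_mem _ _ hE)) (hg A))

theorem norm_angDirac_le (c : Fin m → Matrix ι ι ℝ) {n : ℕ} {F : ι → MvPolynomial (Fin m) ℝ}
    (hF : ∀ A, F A ∈ polyLT m (n + 1)) (h : ∀ A, polyRes (F A) ∈ layer sphFilt n) (A : ι) :
    ‖polyRes (angDirac c F A)‖ ≤
      (∑ A, ∑ i, ∑ j, ∑ B, |(c i * c j) A B|) * (2 * m) * (n * ∑ B, ‖polyRes (F B)‖) := by
  rw [polyRes_angDirac, norm_smul]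
  set S := ∑ B, ‖polyRes (F B)‖ with hS
  have hS0 : 0 ≤ S := sum_nonneg fun _ _ => norm_nonneg _
  have h1 : ‖∑ i, ∑ j, ∑ B, (c i * c j) A B • polyRes (polyAng i j (F B))‖ ≤
      ∑ i, ∑ j, ∑ B, |(c i * c j) A B| * (2 * m * (n * S)) := by
    refine norm_sum_le_of_le _ fun i _ => norm_sum_le_of_le _ fun j _ =>
      norm_sum_le_of_le _ fun B _ => ?_
    rw [norm_smul, Real.norm_eq_abs]
    refine mul_le_mul_of_nonneg_left ((norm_polyAng_le (hF B) (h B) i j).trans ?_) (abs_nonneg _)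
    rw [mul_assoc (2 * (m : ℝ))]
    have : ‖polyRes (F B)‖ ≤ S :=
      single_le_sum (f := fun B => ‖polyRes (F B)‖) (fun _ _ => norm_nonneg _) (mem_univ B)
    exact mul_le_mul_of_nonneg_left (mul_le_mul_of_nonneg_left this n.cast_nonneg) (by positivity)
  have h2 : ‖-(1 / 2 : ℝ)‖ ≤ 1 := by norm_num
  refine (mul_le_mul h2 h1 (norm_nonneg _) zero_le_one).trans ?_
  rw [one_mul, mul_assoc _ (2 * (m : ℝ)) ((n : ℝ) * S)]
  simp only [← sum_mul]
  have h3 : 0 ≤ 2 * (m : ℝ) * (n * S) := by positivity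
  refine mul_le_mul_of_nonneg_right ?_ h3
  exact single_le_sum (f := fun A => ∑ i, ∑ j, ∑ B, |(c i * c j) A B|)
    (fun _ _ => sum_nonneg fun _ _ => sum_nonneg fun _ _ => sum_nonneg fun _ _ => abs_nonneg _)
    (mem_univ A)

/-- The spherical Dirac operator is bounded below by a multiple of the degree. -/
theorem exists_mul_norm_le_angDirac (hm : m ≠ 0) (hc : IsCliffordFamily c) :
    ∃ C, 0 ≤ C ∧ ∀ (n : ℕ), 2 ≤ n → ∀ F : ι → MvPolynomial (Fin m) ℝ,
    (∀ A, F A ∈ polyLT m (n + 1)) → (∀ A, polyRes (F A) ∈ layer sphFilt n) → ∀ A,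
    n * ‖polyRes (F A)‖ ≤ C * ∑ B, ‖polyRes (angDirac c F B)‖ := by
  set C := (∑ A, ∑ i, ∑ j, ∑ B, |(c i * c j) A B|) * (2 * (m : ℝ)) with hC
  have hC0 : 0 ≤ C := by
    rw [hC]
    exact mul_nonneg (sum_nonneg fun _ _ => sum_nonneg fun _ _ => sum_nonneg fun _ _ =>
      sum_nonneg fun _ _ => abs_nonneg _) (by positivity)
  refine ⟨2 * (C + m), mul_nonneg zero_le_two (add_nonneg hC0 m.cast_nonneg), fun n hn F hF h A => ?_⟩
  have hn' : (2 : ℝ) ≤ n := by exact_mod_cast hn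
  have hm' : (1 : ℝ) ≤ m := by exact_mod_cast Nat.one_le_iff_ne_zero.2 hm
  have hF1 := angDirac_mem_polyLT (c := c) hF
  have h1 := polyRes_angDirac_mem_layer (c := c) hF h
  set S := ∑ B, ‖polyRes (angDirac c F B)‖ with hS
  have hS0 : 0 ≤ S := sum_nonneg fun _ _ => norm_nonneg _
  -- From `n (n + m - 2) F = Γ (Γ F) - (m - 2) Γ F` and the upper bound for the outer `Γ`, one
  -- factor `n` cancels. Then `n + m - 2 ≥ n / 2`, as `n ≥ 2` and `m ≥ 1`.
  have e := congr_arg norm (polyRes_angDirac_angDirac hc hF h A)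
  rw [norm_smul, Real.norm_eq_abs, abs_of_nonneg (by nlinarith)] at e
  have b1 := norm_angDirac_le c hF1 h1 A
  have b2 : ‖polyRes (angDirac c F A)‖ ≤ S :=
    single_le_sum (f := fun B => ‖polyRes (angDirac c F B)‖) (fun _ _ => norm_nonneg _) (mem_univ A)
  have b3 : ‖((m : ℝ) - 2) • polyRes (angDirac c F A)‖ ≤ m * S := by
    rw [norm_smul, Real.norm_eq_abs]
    refine mul_le_mul (abs_le.2 ⟨by linarith, by linarith⟩) b2 (norm_nonneg _) (by linarith)
  have b4 := norm_sub_le (polyRes (angDirac c (angDirac c F) A))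
    (((m : ℝ) - 2) • polyRes (angDirac c F A))
  rw [← e] at b4
  have b5 : (n : ℝ) * (n + m - 2) * ‖polyRes (F A)‖ ≤ n * ((C + m) * S) := by
    have : (m : ℝ) * S ≤ n * (m * S) := le_mul_of_one_le_left (by positivity) (by linarith)
    linarith
  rw [mul_assoc] at b5
  have b6 := le_of_mul_le_mul_left b5 (by linarith)
  have b7 : (n : ℝ) / 2 * ‖polyRes (F A)‖ ≤ (n + m - 2) * ‖polyRes (F A)‖ := by
    refine mul_le_mul_of_nonneg_right ?_ (norm_nonneg _)
    linarith
  linarith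

end SphericalDirac

end

noncomputable section

set_option linter.unusedSectionVars false

open MvPolynomial Finset MeasureTheory
open scoped Nat NNReal ENNReal

/-! ### Derivative bounds for analytic functions. -/

section AnalyticBounds

variable {E F : Type*} [NormedAddCommGroup E] [NormedSpace ℝ E] [NormedAddCommGroup F]
  [NormedSpace ℝ F] [CompleteSpace F]

/-- The derivatives of an analytic function are bounded locally uniformly by `K C ^ k k!`. -/
theorem AnalyticAt.exists_norm_iteratedFDeriv_le {f : E → F} {x : E} (hf : AnalyticAt ℝ f x) :
    ∃ δ > 0, ∃ K ≥ 0, ∃ C ≥ 0, ∀ y, ‖y - x‖ < δ → ∀ (k : ℕ) (v : E),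
      ‖iteratedFDeriv ℝ k f y fun _ => v‖ ≤ K * (C * ‖v‖) ^ k * k ! := by
  obtain ⟨p, R, hp⟩ := hf
  obtain ⟨s, hs0, hsR⟩ := ENNReal.lt_iff_exists_nnreal_btwn.1 hp.r_pos
  have hs0' : 0 < s := ENNReal.coe_pos.1 hs0
  -- Half of the radius moves the centre and half is left for the recentred series, so that one
  -- convergent sum bounds all derivatives near `x`.
  have hr : ((s / 2 : ℝ≥0) + (s / 2 : ℝ≥0) : ℝ≥0∞) < p.radius := by
    rw [← ENNReal.coe_add, add_halves]
    exact hsR.trans_le hp.r_le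
  have hsum := p.changeOriginSeries_summable_aux₁ hr
  have hsum' := NNReal.summable_sigma.1 hsum
  refine ⟨s / 2, by positivity, ((∑' t : Σ k l : ℕ, { s : Finset (Fin (k + l)) // s.card = l },
    ‖p (t.1 + t.2.1)‖₊ * (s / 2) ^ t.2.1 * (s / 2) ^ t.1 : ℝ≥0) : ℝ), NNReal.coe_nonneg _, (s / 2)⁻¹,
    by positivity, fun y hy k v => ?_⟩
  have hyn : ‖y - x‖₊ ≤ s / 2 := by
    rw [← NNReal.coe_le_coe]; simpa using hy.le
  have hys : (‖y - x‖₊ : ℝ≥0∞) < R := by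
    refine lt_of_le_of_lt ?_ hsR
    rw [ENNReal.coe_le_coe]
    exact hyn.trans (half_le_self s.2)
  have h := (hp.changeOrigin hys).factorial_smul v k
  rw [add_sub_cancel] at h
  rw [← h, ← Nat.cast_smul_eq_nsmul ℝ, norm_smul, mul_comm]
  have h0 : (0 : ℝ) ≤ k ! := Nat.cast_nonneg _
  rw [Real.norm_of_nonneg h0]
  refine mul_le_mul_of_nonneg_right ?_ h0
  refine ((p.changeOrigin (y - x) k).le_opNorm _).trans ?_
  rw [prod_const, card_univ, Fintype.card_fin, mul_pow, ← mul_assoc]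
  refine mul_le_mul_of_nonneg_right ?_ (by positivity)
  have h1 : ‖p.changeOrigin (y - x) k‖₊ ≤ _ :=
    p.nnnorm_changeOrigin_le k (hys.trans_le hp.r_le)
  have h2 : (∑' s : Σ l : ℕ, { s : Finset (Fin (k + l)) // s.card = l },
      ‖p (k + s.1)‖₊ * ‖y - x‖₊ ^ s.1) ≤ ∑' t : Σ l : ℕ, { s : Finset (Fin (k + l)) // s.card = l },
      ‖p (k + t.1)‖₊ * (s / 2) ^ t.1 := by
    refine Summable.tsum_le_tsum (fun t => ?_) (p.changeOriginSeries_summable_aux₂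
      (hys.trans_le hp.r_le) k) (p.changeOriginSeries_summable_aux₂ ?_ k)
    · gcongr
    · exact lt_of_le_of_lt (le_add_right le_rfl) hr
  have h3 : (∑' t : Σ l : ℕ, { s : Finset (Fin (k + l)) // s.card = l },
      ‖p (k + t.1)‖₊ * (s / 2) ^ t.1) * (s / 2) ^ k ≤
      ∑' t : Σ k l : ℕ, { s : Finset (Fin (k + l)) // s.card = l },
        ‖p (t.1 + t.2.1)‖₊ * (s / 2) ^ t.2.1 * (s / 2) ^ t.1 := by
    rw [← NNReal.tsum_mul_right, hsum.tsum_sigma' hsum'.1]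
    exact hsum'.2.le_tsum k fun _ _ => zero_le
  have h4 := (mul_le_mul_left (h1.trans h2) ((s / 2) ^ k)).trans h3
  have hpos : (0 : ℝ) < (s / 2 : ℝ) ^ k := by positivity
  rw [inv_pow, ← div_eq_mul_inv, le_div_iff₀ hpos]
  exact_mod_cast h4

/-- Both sides are `k!` times the `k`-th coefficient of the power series at `x`, evaluated at `v`.
-/
theorem AnalyticAt.iteratedDeriv_comp_add_smul {f : E → F} {x : E} (hf : AnalyticAt ℝ f x) (v : E)
    (k : ℕ) : iteratedDeriv k (fun t : ℝ => f (x + t • v)) 0 = iteratedFDeriv ℝ k f x fun _ => v := by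
  obtain ⟨p, R, hp⟩ := hf
  have h1 : HasFPowerSeriesOnBall (fun z => f (x + z)) p 0 R := by
    have := hp.comp_sub (-x)
    simpa [add_comm] using this
  have h2 : HasFPowerSeriesOnBall (fun z => f (x + z)) p
      (ContinuousLinearMap.toSpanSingleton ℝ v 0) R := by simpa using h1
  have h3 := h2.compContinuousLinearMap
  have h4 := h3.factorial_smul 1 k
  have h5 := hp.factorial_smul v k
  rw [iteratedDeriv_eq_iteratedFDeriv, ← h5]
  refine h4.symm.trans ?_
  simp [FormalMultilinearSeries.compContinuousLinearMap]

end AnalyticBounds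

/-! ### Exponential decay of the layers of an analytic function. -/

section Decay

variable {m : ℕ}

theorem analyticOnNhd_angDeriv {g : Euc m → ℝ} {s : Set (Euc m)} (hg : AnalyticOnNhd ℝ g s)
    (i j : Fin m) : AnalyticOnNhd ℝ (angDeriv i j g) s := fun x hx =>
  ((ContinuousLinearMap.apply ℝ ℝ : Euc m →L[ℝ] (Euc m →L[ℝ] ℝ) →L[ℝ] ℝ).analyticAt_bilinear
    (rotGen i j x, fderiv ℝ g x)).comp₂ ((rotGen i j).analyticAt x) (hg.fderiv x hx)

theorem analyticOnNhd_angDeriv_iterate {g : Euc m → ℝ} {s : Set (Euc m)}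
    (hg : AnalyticOnNhd ℝ g s) (i j : Fin m) (k : ℕ) :
    AnalyticOnNhd ℝ ((angDeriv i j)^[k] g) s := by
  induction k with
  | zero => exact hg
  | succ k ih =>
    rw [Function.iterate_succ_apply']
    exact analyticOnNhd_angDeriv ih i j

theorem planeRot_mem_sphere {i j : Fin m} (hij : i ≠ j) (t : ℝ) {x : Euc m}
    (hx : x ∈ Metric.sphere (0 : Euc m) 1) : planeRot i j t x ∈ Metric.sphere (0 : Euc m) 1 := by
  rw [mem_sphere_zero_iff_norm] at hx ⊢
  rw [norm_planeRot hij, hx]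

/-- The angular derivative generates the rotation group of the plane, so iterating it means
differentiating along one orbit. -/
theorem iteratedDeriv_comp_planeRot {i j : Fin m} (hij : i ≠ j) {g : Euc m → ℝ}
    (hg : AnalyticOnNhd ℝ g (Metric.sphere 0 1)) {x : Euc m}
    (hx : x ∈ Metric.sphere (0 : Euc m) 1) (k : ℕ) :
    iteratedDeriv k (fun t => g (planeRot i j t x)) =
      fun t => (angDeriv i j)^[k] g (planeRot i j t x) := by
  induction k with
  | zero => exact iteratedDeriv_zero
  | succ k ih =>
    rw [iteratedDeriv_succ, ih]
    funext t
    rw [Function.iterate_succ_apply']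
    exact (hasDerivAt_comp_planeRot hij (analyticOnNhd_angDeriv_iterate hg i j k _
      (planeRot_mem_sphere hij t hx)).differentiableAt).deriv

theorem analyticAt_planeRot (i j : Fin m) (z : ℝ × Euc m) :
    AnalyticAt ℝ (fun z : ℝ × Euc m => planeRot i j z.1 z.2) z := by
  have h1 : AnalyticAt ℝ (fun z : ℝ × Euc m => planeProj i j z.2) z :=
    ((planeProj i j).comp (ContinuousLinearMap.snd ℝ ℝ (Euc m))).analyticAt z
  have h2 : AnalyticAt ℝ (fun z : ℝ × Euc m => rotGen i j z.2) z :=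
    ((rotGen i j).comp (ContinuousLinearMap.snd ℝ ℝ (Euc m))).analyticAt z
  have h3 : AnalyticAt ℝ (fun z : ℝ × Euc m => Real.cos z.1) z :=
    (Real.analyticAt_cos).comp analyticAt_fst
  have h4 : AnalyticAt ℝ (fun z : ℝ × Euc m => Real.sin z.1) z :=
    (Real.analyticAt_sin).comp analyticAt_fst
  exact (analyticAt_snd.add ((h3.sub analyticAt_const).smul h1)).add (h4.smul h2)

/-- The iterated angular derivatives of an analytic function. -/
theorem exists_abs_angDeriv_iterate_le {g : Euc m → ℝ}
    (hg : AnalyticOnNhd ℝ g (Metric.sphere 0 1)) (i j : Fin m) :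
    ∃ K ≥ 0, ∃ C ≥ 0, ∀ x ∈ Metric.sphere (0 : Euc m) 1, ∀ k : ℕ,
      |(angDeriv i j)^[k] g x| ≤ K * C ^ k * k ! := by
  rcases eq_or_ne i j with rfl | hij
  · obtain ⟨K, hK⟩ := (isCompact_sphere (0 : Euc m) 1).exists_bound_of_continuousOn
      hg.continuousOn
    refine ⟨|K|, abs_nonneg _, 0, le_rfl, fun x hx k => ?_⟩
    cases k with
    | zero => simpa using (hK x hx).trans (le_abs_self K)
    | succ k => rw [Function.iterate_succ_apply', angDeriv_self]; simp
  have key : ∀ x ∈ Metric.sphere (0 : Euc m) 1, ∃ δ > 0, ∃ K ≥ 0, ∃ C ≥ 0,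
      ∀ y ∈ Metric.sphere (0 : Euc m) 1, ‖y - x‖ < δ → ∀ k : ℕ,
      |(angDeriv i j)^[k] g y| ≤ K * C ^ k * k ! := by
    intro x hx
    -- Joint analyticity in the angle and the point gives bounds uniform in the point; the direction
    -- `(1, 0)` picks out the derivatives in the angle.
    set G : ℝ × Euc m → ℝ := fun z => g (planeRot i j z.1 z.2) with hG
    have hGa : ∀ y ∈ Metric.sphere (0 : Euc m) 1, AnalyticAt ℝ G (0, y) := fun y hy => by
      refine AnalyticAt.comp (g := g) (f := fun z : ℝ × Euc m => planeRot i j z.1 z.2) ?_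
        (analyticAt_planeRot i j _)
      rw [planeRot_zero]
      exact hg y hy
    obtain ⟨δ, hδ, K, hK, C, hC, h⟩ := (hGa x hx).exists_norm_iteratedFDeriv_le
    refine ⟨δ, hδ, K, hK, C, hC, fun y hy hyx k => ?_⟩
    have h1 := h (0, y) (by simpa using hyx) k (1, 0)
    rw [← (hGa y hy).iteratedDeriv_comp_add_smul] at h1
    have h2 : (fun t : ℝ => G ((0, y) + t • ((1 : ℝ), (0 : Euc m)))) =
        fun t => g (planeRot i j t y) := by
      funext t
      simp [hG]
    rw [h2, iteratedDeriv_comp_planeRot hij hg hy] at h1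
    simp only [planeRot_zero] at h1
    simpa using h1
  choose! δ hδ K hK C hC h using key
  obtain ⟨t, hts, ht⟩ := (isCompact_sphere (0 : Euc m) 1).elim_nhds_subcover
    (fun x => Metric.ball x (δ x)) fun x hx => Metric.ball_mem_nhds x (hδ x hx)
  have hK' : ∀ x ∈ t, 0 ≤ K x := fun x hx => hK x (hts x hx)
  have hC' : ∀ x ∈ t, 0 ≤ C x := fun x hx => hC x (hts x hx)
  refine ⟨∑ x ∈ t, K x, sum_nonneg hK', ∑ x ∈ t, C x, sum_nonneg hC', fun y hy k => ?_⟩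
  obtain ⟨x, hxt, hyx⟩ := Set.mem_iUnion₂.1 (ht hy)
  refine (h x (hts x hxt) y hy (by simpa [dist_eq_norm] using hyx) k).trans ?_
  have h1 := single_le_sum hK' hxt
  have h2 := single_le_sum hC' hxt
  have h3 := hC' x hxt
  have h4 := sum_nonneg hK'
  gcongr

/-- A log-convex sequence has nondecreasing ratios, and the first ratio is at least `r`. -/
theorem pow_mul_le_of_sq_le {a : ℕ → ℝ} (h0 : ∀ k, 0 ≤ a k) (h : ∀ k, a (k + 1) ^ 2 ≤ a k * a (k + 2))
    {r : ℝ} (hr : 0 ≤ r) (h1 : r * a 0 ≤ a 1) (k : ℕ) : r ^ k * a 0 ≤ a k := by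
  have key : ∀ k, r * a k ≤ a (k + 1) := by
    intro k
    induction k with
    | zero => exact h1
    | succ k ih =>
      rcases (h0 (k + 1)).eq_or_lt with hz | hp
      · rw [← hz, mul_zero]; exact h0 _
      · have hk : 0 < a k := by
          refine (h0 k).lt_of_ne fun hz => ?_
          have := h k
          rw [← hz, zero_mul] at this
          nlinarith
        have h2 := h k
        refine le_of_mul_le_mul_left ?_ hk
        nlinarith
  induction k with
  | zero => simp
  | succ k ih =>
    calc r ^ (k + 1) * a 0 = r * (r ^ k * a 0) := by ring
      _ ≤ r * a k := mul_le_mul_of_nonneg_left ih hr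
      _ ≤ a (k + 1) := key k

theorem integral_angDeriv_iterate_mul {g : Euc m → ℝ} (hg : AnalyticOnNhd ℝ g (Metric.sphere 0 1))
    (i j : Fin m) (k : ℕ) (p : MvPolynomial (Fin m) ℝ) :
    ∫ x : Sph m, (angDeriv i j)^[k] g x * polyFun p x ∂sphMeasure m =
      (-1) ^ k * ∫ x : Sph m, g x * polyFun ((polyAng i j)^[k] p) x ∂sphMeasure m := by
  induction k generalizing p with
  | zero => simp
  | succ k ih =>
    rw [Function.iterate_succ_apply', integral_angDeriv_mul i j (fun x hx =>
      (analyticOnNhd_angDeriv_iterate hg i j k x hx).contDiffAt), ih, Function.iterate_succ_apply]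
    ring

theorem polyAng_iterate_mem (i j : Fin m) {n : ℕ} {p : MvPolynomial (Fin m) ℝ}
    (hp : p ∈ polyLT m (n + 1)) (h : polyRes p ∈ layer sphFilt n) (k : ℕ) :
    (polyAng i j)^[k] p ∈ polyLT m (n + 1) ∧ polyRes ((polyAng i j)^[k] p) ∈ layer sphFilt n := by
  induction k with
  | zero => exact ⟨hp, h⟩
  | succ k ih =>
    rw [Function.iterate_succ_apply']
    exact ⟨polyAng_mem_polyLT i j ih.1, polyRes_polyAng_mem_layer i j ih.1 ih.2⟩

theorem inner_polyRes_polyAng_iterate (i j : Fin m) (k : ℕ) (p q : MvPolynomial (Fin m) ℝ) :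
    inner ℝ (polyRes ((polyAng i j)^[k] p)) (polyRes q) =
      (-1) ^ k * inner ℝ (polyRes p) (polyRes ((polyAng i j)^[k] q)) := by
  induction k generalizing q with
  | zero => simp
  | succ k ih =>
    rw [Function.iterate_succ_apply', inner_polyRes_polyAng, ih, Function.iterate_succ_apply]
    ring

/-- The components of an analytic function decay exponentially. -/
theorem exists_exp_mul_norm_layerProj_le (hm : m ≠ 0) {g : Euc m → ℝ}
    (hg : AnalyticOnNhd ℝ g (Metric.sphere 0 1)) {u : SphFun m} (hu : ∀ x : Sph m, u x = g x) :
    ∃ ε > 0, ∃ K ≥ 0, ∀ l : ℕ, Real.exp (ε * l) * ‖layerProj sphFilt l u‖ ≤ K := by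
  choose K hK C hC hb using exists_abs_angDeriv_iterate_le hg
  set M := Real.sqrt ((sphMeasure m).real Set.univ)
  have hM : 0 ≤ M := Real.sqrt_nonneg _
  set K0 := ∑ i, ∑ j, K i j
  set C0 := 1 + ∑ i, ∑ j, C i j
  have hm' : (0 : ℝ) < m := by exact_mod_cast Nat.pos_of_ne_zero hm
  have hK0 : 0 ≤ K0 := sum_nonneg fun i _ => sum_nonneg fun j _ => hK i j
  have hC1 : 1 ≤ C0 := le_add_of_nonneg_right (sum_nonneg fun i _ => sum_nonneg fun j _ => hC i j)
  have hC0 : 0 < C0 := one_pos.trans_le hC1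
  -- With this rate `ε`, the estimate `(l / m) ^ k ‖p‖ ≤ K0 C0 ^ k k! M` becomes `(ε l) ^ k / k! ‖p‖
  -- ≤ K0 M 2⁻ᵏ`, and summation over `k` yields `e^{εl} ‖p‖ ≤ 2 K0 M`.
  have hε : 0 < 1 / (2 * m * C0) := by positivity
  refine ⟨1 / (2 * m * C0), hε, 2 * (K0 * M) + Real.exp 2 * ‖u‖, by positivity, fun l => ?_⟩
  -- For `l < 2` there is no lower bound by angular derivatives; there the exponential is at most
  -- `e²` and the component at most `‖u‖`.
  rcases lt_or_ge l 2 with hl | hl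
  · have h1 : Real.exp (1 / (2 * m * C0) * l) ≤ Real.exp 2 := by
      refine Real.exp_le_exp.2 ?_
      have h2 : (l : ℝ) ≤ 2 := by exact_mod_cast hl.le
      have h3 : (1 : ℝ) ≤ m := by exact_mod_cast Nat.one_le_iff_ne_zero.2 hm
      have h4 : 1 / (2 * m * C0) ≤ 1 := by
        rw [div_le_one (by positivity)]
        nlinarith [mul_le_mul h3 hC1 zero_le_one hm'.le]
      nlinarith
    have := mul_le_mul h1 (norm_layerProj_le (V := sphFilt) l u) (norm_nonneg _) (Real.exp_pos _).le
    have h2 : 0 ≤ 2 * (K0 * M) := by positivity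
    linarith
  obtain ⟨p, hp, hpu⟩ := exists_polyRes_eq (layerProj_mem (V := sphFilt) l u)
  have hpl : polyRes p ∈ layer sphFilt l := hpu ▸ layerProj_mem l u
  obtain ⟨i, j, hij⟩ := exists_le_norm_polyAng hl hm hp hpl
  set a : ℕ → ℝ := fun k => ‖polyRes ((polyAng i j)^[k] p)‖ with ha
  have hmem := polyAng_iterate_mem i j hp hpl
  -- Skew-symmetry and Cauchy–Schwarz make the norms of the iterates log-convex.
  have h1 : ∀ k, a (k + 1) ^ 2 ≤ a k * a (k + 2) := fun k => by
    rw [ha]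
    simp only
    rw [← real_inner_self_eq_norm_sq, Function.iterate_succ_apply', inner_polyRes_polyAng,
      ← Function.iterate_succ_apply' (polyAng i j), ← Function.iterate_succ_apply' (polyAng i j),
      ← inner_neg_left]
    refine (real_inner_le_norm _ _).trans ?_
    rw [norm_neg]
  have h2 := pow_mul_le_of_sq_le (a := a) (fun k => norm_nonneg _) h1 (r := l / m) (by positivity) hij
  have h3 : ∀ k, a k ≤ K0 * C0 ^ k * k ! * M := by
    intro k
    set w : SphFun m := (⟨fun x : Sph m => (angDeriv i j)^[k] g x, continuous_iff_continuousAt.2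
      fun x => (analyticOnNhd_angDeriv_iterate hg i j k x x.2).continuousAt.comp
        continuous_subtype_val.continuousAt⟩ : C(Sph m, ℝ)) with hw
    have hwn : ‖w‖ ≤ K0 * C0 ^ k * k ! * M := by
      refine SphFun.norm_le_of_forall_abs_le (by positivity) fun x => (hb i j x x.2 k).trans ?_
      have e1 : K i j ≤ K0 := (single_le_sum (fun j _ => hK i j) (mem_univ j)).trans
        (single_le_sum (f := fun i => ∑ j, K i j) (fun i _ => sum_nonneg fun j _ => hK i j)
          (mem_univ i))
      have e2 : C i j ≤ C0 := ((single_le_sum (fun j _ => hC i j) (mem_univ j)).trans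
        (single_le_sum (f := fun i => ∑ j, C i j) (fun i _ => sum_nonneg fun j _ => hC i j)
          (mem_univ i))).trans (le_add_of_nonneg_left zero_le_one)
      have e3 := hC i j
      gcongr
    -- Move `k` derivatives from `g` to the polynomial, replace `g` by its component `p`, and move
    -- `k` of the `2 k` derivatives back: the two signs `(-1) ^ k` cancel.
    have h4 : inner ℝ w (polyRes ((polyAng i j)^[k] p)) = a k ^ 2 := by
      rw [SphFun.inner_def]
      have h5 := integral_angDeriv_iterate_mul hg i j k ((polyAng i j)^[k] p)
      refine h5.trans ?_
      rw [ha]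
      simp only
      rw [← real_inner_self_eq_norm_sq, inner_polyRes_polyAng_iterate, hpu,
        inner_layerProj u (polyAng_iterate_mem i j (hmem k).1 (hmem k).2 k).2, SphFun.inner_def]
      simp only [hu, polyRes_apply]
    have h5 := h4.symm.trans_le (real_inner_le_norm _ _)
    rcases (norm_nonneg (polyRes ((polyAng i j)^[k] p))).eq_or_lt with hz | hpos
    · rw [ha]; simp only; rw [← hz]; positivity
    · refine le_trans (le_of_mul_le_mul_right ?_ hpos) hwn
      rw [← sq]
      exact h5
  have h4 : ∀ k : ℕ, (1 / (2 * m * C0) * l) ^ k / k ! * ‖polyRes p‖ ≤ K0 * M * (1 / 2) ^ k := by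
    intro k
    have h5 := (h2 k).trans (h3 k)
    have hk : (0 : ℝ) < k ! := by exact_mod_cast k.factorial_pos
    have e : (1 / (2 * m * C0) * l) ^ k / k ! * ‖polyRes p‖ =
        ((l / m) ^ k * ‖polyRes p‖) * ((1 / 2) ^ k / (C0 ^ k * k !)) := by
      simp only [div_pow, mul_pow, one_pow]
      field_simp
    rw [e]
    have h6 : 0 ≤ (1 / 2 : ℝ) ^ k / (C0 ^ k * k !) := by positivity
    refine (mul_le_mul_of_nonneg_right h5 h6).trans_eq ?_
    field_simp
  have h5 := (Real.summable_pow_div_factorial (1 / (2 * m * C0) * l)).hasSum.mul_right ‖polyRes p‖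
  have h6 := hasSum_geometric_two.mul_left (K0 * M)
  have h7 := hasSum_le h4 h5 h6
  have h9 : ∑' b : ℕ, (1 / (2 * m * C0) * (l : ℝ)) ^ b / (b ! : ℝ) =
      Real.exp (1 / (2 * m * C0) * l) := by
    rw [Real.exp_eq_exp_ℝ, NormedSpace.exp_eq_tsum_div]
  rw [h9] at h7
  rw [← hpu]
  have h8 : 0 ≤ Real.exp 2 * ‖u‖ := by positivity
  linarith

end Decay

end

noncomputable section

set_option linter.unusedSectionVars false

open MvPolynomial Finset MeasureTheory

/-! ### Division by a linear form. -/

section Division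

variable {m : ℕ}

/-- Otherwise `p (l + 2 N) ^ 2` would dominate a multiple of `1 / (N + 1)`, and the harmonic series
would converge. -/
theorem exists_mul_sq_lt {p : ℕ → ℝ} {B : ℝ} (hB : ∀ s : Finset ℕ, ∑ k ∈ s, p k ^ 2 ≤ B) (m l : ℕ)
    {δ : ℝ} (hδ : 0 < δ) : ∃ N : ℕ, (2 * ((l + 2 * N : ℕ) : ℝ) + m) * p (l + 2 * N) ^ 2 < δ := by
  by_contra! hc
  have h1 : Summable fun k => p k ^ 2 := summable_of_sum_le (fun k => sq_nonneg _) hB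
  have h2 : Summable fun N : ℕ => p (l + 2 * N) ^ 2 :=
    h1.comp_injective (i := fun N => l + 2 * N) fun a b h => by
      simp only at h
      omega
  have h3 : Summable fun N : ℕ => (2 * l + m + 4 : ℝ) / δ * p (l + 2 * N) ^ 2 := h2.mul_left _
  have h4 : Summable fun N : ℕ => 1 / ((N + 1 : ℕ) : ℝ) := by
    refine Summable.of_nonneg_of_le (fun N => by positivity) (fun N => ?_) h3
    have h5 := hc N
    have h6 : (0 : ℝ) < ((N + 1 : ℕ) : ℝ) := by positivity
    rw [div_le_iff₀ h6, div_mul_eq_mul_div, div_mul_eq_mul_div, le_div_iff₀ hδ, one_mul]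
    refine h5.trans ?_
    rw [mul_right_comm]
    refine mul_le_mul_of_nonneg_right ?_ (sq_nonneg _)
    push_cast
    have h7 : (0 : ℝ) ≤ l := l.cast_nonneg
    have h8 : (0 : ℝ) ≤ m := m.cast_nonneg
    have h9 : (0 : ℝ) ≤ N := N.cast_nonneg
    nlinarith [mul_nonneg h7 h9, mul_nonneg h8 h9]
  exact Real.not_summable_one_div_natCast ((summable_nat_add_iff 1).1 h4)

theorem summable_four_mul_add_one_mul_exp {ε : ℝ} (hε : 0 < ε) :
    Summable fun k : ℕ => (4 * k + 1 : ℝ) * Real.exp (-(ε * (2 * k))) := by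
  have h1 : ‖Real.exp (-(2 * ε))‖ < 1 := by
    rw [Real.norm_of_nonneg (Real.exp_pos _).le, Real.exp_lt_one_iff]
    linarith
  have h2 := summable_pow_mul_geometric_of_norm_lt_one 1 h1
  have h3 := summable_pow_mul_geometric_of_norm_lt_one 0 h1
  refine ((h2.mul_left 4).add h3).congr fun k => ?_
  rw [← Real.exp_nat_mul]
  rw [show (k : ℝ) * -(2 * ε) = -(ε * (2 * k)) by ring]
  ring

/-- Each bound drops one nonnegative term of `sq_norm_layerProj_linOp`; `l ≥ 2` makes the
coefficient `2 l + m - 4` nonnegative. -/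
theorem sq_norm_layerProj_le (α : Euc m) (hα : ‖α‖ = 1) {l : ℕ} (hl : 2 ≤ l) {h : SphFun m}
    (hh : h ∈ layer sphFilt l) :
    ‖h‖ ^ 2 ≤ (2 * l + m) * ‖layerProj sphFilt (l + 1) (linOp α h)‖ ^ 2 ∧
      (2 * l + m - 4) * ‖layerProj sphFilt (l - 1) (linOp α h)‖ ^ 2 ≤
        (2 * l + m) * ‖layerProj sphFilt (l + 1) (linOp α h)‖ ^ 2 := by
  obtain ⟨n, rfl⟩ : ∃ n, l = n + 1 := ⟨l - 1, by omega⟩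
  have h1 := sq_norm_layerProj_linOp hα hh
  have hn : (1 : ℝ) ≤ n := by
    have : 1 ≤ n := by omega
    exact_mod_cast this
  have hm : (0 : ℝ) ≤ m := m.cast_nonneg
  push_cast
  have h2 := sq_nonneg ‖h‖
  have h3 : 0 ≤ (2 * ((n : ℝ) + 1) + m - 4) * ‖layerProj sphFilt n (linOp α h)‖ ^ 2 :=
    mul_nonneg (by linarith) (sq_nonneg _)
  constructor <;> linarith

/-- The weighted upper components `b l` of `⟨α, x⟩ v_l` dominate `‖v_l‖`. The layer `l + 1` of `⟨α,
x⟩ v` receives only the upper component from `v_l` and the lower one from `v_{l+2}`, which bounds `b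
l` by data plus `b (l + 2)`. Summing upwards to infinity, the data form a convergent series, and the
remainder is small along a subsequence since `v` is square integrable. -/
theorem exp_mul_norm_layerProj_le_of_norm_one {α : Euc m} (hα : ‖α‖ = 1) {ε : ℝ} (hε : 0 < ε) {v : SphFun m}
    {K : ℝ} (hK : 0 ≤ K) {J : ℕ} (hJ : 2 ≤ J)
    (h : ∀ l : ℕ, J + 1 ≤ l → Real.exp (ε * l) * ‖layerProj sphFilt l (linOp α v)‖ ≤ K) {l : ℕ}
    (hl : J ≤ l) : Real.exp (ε * l) * ‖layerProj sphFilt l v‖ ≤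
      (∑' k : ℕ, (4 * k + 1 : ℝ) * Real.exp (-(ε * (2 * k)))) * Real.sqrt (2 * l + m) * K := by
  set S := ∑' k : ℕ, (4 * k + 1 : ℝ) * Real.exp (-(ε * (2 * k))) with hS
  set p : ℕ → ℝ := fun l => ‖layerProj sphFilt (l + 1) (linOp α (layerProj sphFilt l v))‖ with hp
  set b : ℕ → ℝ := fun l => Real.sqrt (2 * l + m) * p l with hb
  have hp0 : ∀ l, 0 ≤ p l := fun l => norm_nonneg _
  have hn0 : ∀ l : ℕ, (0 : ℝ) ≤ 2 * l + m := fun l => by positivity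
  have hpv : ∀ l, p l ≤ ‖layerProj sphFilt l v‖ := fun l => by
    refine (norm_layerProj_le _ _).trans ((norm_linOp_le _ _).trans ?_)
    rw [hα, one_mul]
  have hB : ∀ s : Finset ℕ, ∑ k ∈ s, p k ^ 2 ≤ ‖v‖ ^ 2 := fun s =>
    (sum_le_sum fun k _ => pow_le_pow_left₀ (hp0 k) (hpv k) 2).trans
      (sum_sq_norm_layerProj_le sphFilt_mono s v)
  have hvb : ∀ l, 2 ≤ l → ‖layerProj sphFilt l v‖ ≤ b l := fun l hl => by
    refine abs_le_of_sq_le_sq' ?_ (mul_nonneg (Real.sqrt_nonneg _) (hp0 l)) |>.2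
    rw [mul_pow, Real.sq_sqrt (hn0 l)]
    exact (sq_norm_layerProj_le α hα hl (layerProj_mem l v)).1
  -- The coefficient of the lower component for `v_{l+2}` is `2 (l + 2) + m - 4 = 2 l + m`, the
  -- square of the weight of `b l`. So `b (l + 2)` enters with constant one and the recursion does
  -- not amplify.
  have hrec : ∀ l, J ≤ l → b l ≤ Real.sqrt (2 * l + m) * (K * Real.exp (-(ε * l))) + b (l + 2) := by
    intro l hl
    have h1 : p l ≤ ‖layerProj sphFilt (l + 1) (linOp α v)‖ +
        ‖layerProj sphFilt (l + 1) (linOp α (layerProj sphFilt (l + 2) v))‖ := by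
      have := layerProj_linOp α l v
      rw [hp]
      simp only
      rw [← sub_eq_iff_eq_add.2 this]
      exact norm_sub_le _ _
    have h2 : ‖layerProj sphFilt (l + 1) (linOp α v)‖ ≤ K * Real.exp (-(ε * l)) := by
      have h3 := h (l + 1) (by omega)
      have h4 : Real.exp (ε * l) ≤ Real.exp (ε * (l + 1 : ℕ)) := by
        refine Real.exp_le_exp.2 ?_
        push_cast
        nlinarith
      rw [Real.exp_neg, ← div_eq_mul_inv, le_div_iff₀ (Real.exp_pos _), mul_comm]
      exact (mul_le_mul_of_nonneg_right h4 (norm_nonneg _)).trans h3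
    have h3 : Real.sqrt (2 * l + m) *
        ‖layerProj sphFilt (l + 1) (linOp α (layerProj sphFilt (l + 2) v))‖ ≤ b (l + 2) := by
      refine abs_le_of_sq_le_sq' ?_ (mul_nonneg (Real.sqrt_nonneg _) (hp0 _)) |>.2
      rw [mul_pow, mul_pow, Real.sq_sqrt (hn0 l), Real.sq_sqrt (hn0 _)]
      have h4 := (sq_norm_layerProj_le α hα (l := l + 2) (by omega) (layerProj_mem (l + 2) v)).2
      rw [show l + 2 - 1 = l + 1 by omega] at h4
      refine le_trans (le_of_eq ?_) h4
      push_cast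
      ring
    have h4 := mul_le_mul_of_nonneg_left (h1.trans (add_le_add_left h2 _)) (Real.sqrt_nonneg (2 * l + m))
    rw [mul_add] at h4
    exact h4.trans (add_le_add_right h3 _)
  have hsq : ∀ k : ℕ, Real.sqrt (2 * ((l + 2 * k : ℕ) : ℝ) + m) ≤
      Real.sqrt (2 * l + m) * (4 * k + 1) := fun k => by
    have h0 : (2 : ℝ) ≤ l := by exact_mod_cast hJ.trans hl
    have h1 : (0 : ℝ) ≤ k := k.cast_nonneg
    have h2 : (0 : ℝ) ≤ m := m.cast_nonneg
    rw [← Real.sqrt_sq (show (0 : ℝ) ≤ 4 * k + 1 by positivity), ← Real.sqrt_mul (hn0 l)]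
    refine Real.sqrt_le_sqrt ?_
    push_cast
    have h3 : (1 : ℝ) ≤ 2 * l + m := by linarith
    nlinarith [mul_le_mul h3 (show (4 * k : ℝ) ≤ (4 * k + 1) ^ 2 - 1 by nlinarith) (by positivity) (by linarith)]
  have hiter : ∀ N : ℕ, b l ≤ ∑ k ∈ range N, Real.sqrt (2 * l + m) * K * Real.exp (-(ε * l)) *
      ((4 * k + 1) * Real.exp (-(ε * (2 * k)))) + b (l + 2 * N) := by
    intro N
    induction N with
    | zero => simp
    | succ N ih =>
      refine ih.trans ?_
      rw [sum_range_succ, add_assoc]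
      refine add_le_add_right ((hrec (l + 2 * N) (by omega)).trans ?_) _
      rw [show l + 2 * (N + 1) = l + 2 * N + 2 by ring]
      refine add_le_add_left ?_ _
      have e : Real.exp (-(ε * ((l + 2 * N : ℕ) : ℝ))) =
          Real.exp (-(ε * l)) * Real.exp (-(ε * (2 * N))) := by
        rw [← Real.exp_add]
        congr 1
        push_cast
        ring
      rw [e]
      refine (mul_le_mul_of_nonneg_right (hsq N) (by positivity)).trans_eq ?_
      ring
  have hbl : b l ≤ Real.sqrt (2 * l + m) * K * Real.exp (-(ε * l)) * S := by
    refine le_of_forall_pos_le_add fun δ hδ => ?_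
    -- The remainders need not tend to zero; for each `δ` a single `N` with a small one is enough.
    obtain ⟨N, hN⟩ := exists_mul_sq_lt hB m l (pow_pos hδ 2)
    have hbN : b (l + 2 * N) ≤ δ := by
      refine abs_le_of_sq_le_sq' ?_ hδ.le |>.2
      rw [hb]
      simp only
      rw [mul_pow, Real.sq_sqrt (hn0 _)]
      exact hN.le
    refine (hiter N).trans (add_le_add ?_ hbN)
    rw [← mul_sum]
    refine mul_le_mul_of_nonneg_left ?_ (by positivity)
    exact (summable_four_mul_add_one_mul_exp hε).sum_le_tsum _ fun k _ => by positivity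
  have hv := (hvb l (hJ.trans hl)).trans hbl
  refine (mul_le_mul_of_nonneg_left hv (Real.exp_pos (ε * l)).le).trans_eq ?_
  have e : Real.exp (ε * l) * Real.exp (-(ε * l)) = 1 := by rw [← Real.exp_add]; simp
  linear_combination (Real.sqrt (2 * l + m) * K * S) * e

/-- Division by a linear form preserves the exponential decay of the components. -/
theorem exists_exp_mul_norm_layerProj_le_of_linOp {α : Euc m} (hα : α ≠ 0) {ε : ℝ} (hε : 0 < ε) :
    ∃ C ≥ 0, ∀ (v : SphFun m) (K : ℝ), 0 ≤ K → ∀ J, 2 ≤ J →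
      (∀ l : ℕ, J + 1 ≤ l → Real.exp (ε * l) * ‖layerProj sphFilt l (linOp α v)‖ ≤ K) → ∀ l : ℕ, J ≤ l →
      Real.exp (ε * l) * ‖layerProj sphFilt l v‖ ≤ C * Real.sqrt (2 * l + m) * K := by
  have hα' : 0 < ‖α‖ := norm_pos_iff.2 hα
  refine ⟨(∑' k : ℕ, (4 * k + 1 : ℝ) * Real.exp (-(ε * (2 * k)))) * ‖α‖⁻¹,
    mul_nonneg (tsum_nonneg fun k => by positivity) (by positivity), fun v K hK J hJ h l hl => ?_⟩
  have h1 : linOp (‖α‖⁻¹ • α) v = ‖α‖⁻¹ • linOp α v := SphFun.ext fun x => by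
    rw [SphFun.smul_apply, linOp_apply, linOp_apply, inner_smul_left]
    simp [mul_assoc]
  have h2 := exp_mul_norm_layerProj_le_of_norm_one (α := ‖α‖⁻¹ • α) (v := v) (K := ‖α‖⁻¹ * K)
    (by rw [norm_smul, norm_inv, norm_norm, inv_mul_cancel₀ hα'.ne']) hε (by positivity) hJ
    (fun l hl => by
      rw [h1, map_smul, norm_smul, norm_inv, norm_norm, mul_left_comm]
      exact mul_le_mul_of_nonneg_left (h l hl) (by positivity)) hl
  refine h2.trans_eq ?_
  ring

end Division

end

noncomputable section

set_option linter.unusedSectionVars false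

open MvPolynomial Finset MeasureTheory Filter
open scoped Topology

/-! ### Difference quotients and tangential derivatives on the sphere. -/

section SphRho

variable {m : ℕ}

/-- The difference quotient along a reflection, extended continuously to the mirror. -/
def sphRho (α : Euc m) (w : Euc m → ℝ) (x : Euc m) : ℝ :=
  if inner ℝ α x = 0 then 2 / ‖α‖ ^ 2 * fderiv ℝ w x α
  else (inner ℝ α x)⁻¹ * (w x - w (reflIso α x))

theorem reflIso_eq_self {α x : Euc m} (h : inner ℝ α x = 0) : reflIso α x = x := by
  rw [reflIso_apply, h]
  simp

theorem inner_mul_sphRho (α : Euc m) (w : Euc m → ℝ) (x : Euc m) :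
    inner ℝ α x * sphRho α w x = w x - w (reflIso α x) := by
  rw [sphRho]
  split_ifs with h
  · rw [reflIso_eq_self h, h, zero_mul, sub_self]
  · rw [mul_inv_cancel_left₀ h]

/-- At a mirror point both `y` and its reflection tend to `x`, and their difference is a multiple of
`α`. Strict differentiability at `x` therefore gives the limit of the difference quotient. -/
theorem continuousAt_sphRho {α : Euc m} (hα : α ≠ 0) {w : Euc m → ℝ} {x : Euc m}
    (h1 : ContDiffAt ℝ 1 w x) (h2 : ContinuousAt w (reflIso α x)) :
    ContinuousAt (sphRho α w) x := by
  have hinner : Continuous fun y : Euc m => inner ℝ α y := by fun_prop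
  have hrefl : Continuous (reflIso α) := (reflIso α).continuous
  by_cases h : inner ℝ α x = 0
  · have hα' : 0 < ‖α‖ := norm_pos_iff.2 hα
    have hx : sphRho α w x = 2 / ‖α‖ ^ 2 * fderiv ℝ w x α := if_pos h
    rw [ContinuousAt, hx, Metric.tendsto_nhds]
    intro ε hε
    have hc : ContinuousAt (fun y => 2 / ‖α‖ ^ 2 * fderiv ℝ w y α) x := by
      have : ContinuousAt (fderiv ℝ w) x := (h1.fderiv_right (m := 0) le_rfl).continuousAt
      exact continuousAt_const.mul (this.clm_apply continuousAt_const)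
    have hs := (h1.hasStrictFDerivAt one_ne_zero).isLittleO
    have hs' := hs.def (c := ε * ‖α‖ / 4) (by positivity)
    have ht : Tendsto (fun y => (y, reflIso α y)) (𝓝 x) (𝓝 (x, x)) := by
      have := (continuous_id.prodMk hrefl).tendsto x
      simpa only [id, reflIso_eq_self h] using this
    filter_upwards [ht.eventually hs', Metric.tendsto_nhds.1 hc ε hε] with y hy1 hy2
    rw [sphRho]
    split_ifs with hy
    · exact hy2
    · have e : y - reflIso α y = (2 * inner ℝ α y / ‖α‖ ^ 2) • α := by
        rw [reflIso_apply]; abel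
      simp only [e, map_smul, norm_smul, smul_eq_mul] at hy1
      have hi : 0 < |inner ℝ α y| := abs_pos.2 hy
      rw [Real.dist_eq]
      have e2 : (inner ℝ α y)⁻¹ * (w y - w (reflIso α y)) - 2 / ‖α‖ ^ 2 * fderiv ℝ w x α =
          (inner ℝ α y)⁻¹ * (w y - w (reflIso α y) - 2 * inner ℝ α y / ‖α‖ ^ 2 * fderiv ℝ w x α) := by
        field_simp
      rw [e2, abs_mul, abs_inv, inv_mul_lt_iff₀ hi]
      rw [Real.norm_eq_abs] at hy1
      refine hy1.trans_lt ?_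
      rw [Real.norm_eq_abs, abs_div, abs_mul, abs_two, abs_of_pos (pow_pos hα' 2)]
      have e3 : ε * ‖α‖ / 4 * (2 * |inner ℝ α y| / ‖α‖ ^ 2 * ‖α‖) = |inner ℝ α y| * (ε / 2) := by
        field_simp
        norm_num
      rw [e3]
      exact mul_lt_mul_of_pos_left (half_lt_self hε) hi
  · have h3 : ContinuousAt (fun y => (inner ℝ α y)⁻¹ * (w y - w (reflIso α y))) x := by
      refine (hinner.continuousAt.inv₀ h).mul (h1.continuousAt.sub ?_)
      exact ContinuousAt.comp (f := reflIso α) h2 hrefl.continuousAt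
    refine h3.congr ?_
    filter_upwards [hinner.continuousAt.eventually_ne h] with y hy
    rw [sphRho, if_neg hy]

/-- Rotations stay on the sphere, so the values there determine angular derivatives. -/
theorem angDeriv_eq_of_eqOn_sphere {W : Type*} [NormedAddCommGroup W] [NormedSpace ℝ W]
    {v w : Euc m → W}
    (hv : ∀ x ∈ Metric.sphere (0 : Euc m) 1, DifferentiableAt ℝ v x)
    (hw : ∀ x ∈ Metric.sphere (0 : Euc m) 1, DifferentiableAt ℝ w x)
    (h : ∀ x ∈ Metric.sphere (0 : Euc m) 1, v x = w x) (i j : Fin m) {x : Euc m}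
    (hx : x ∈ Metric.sphere (0 : Euc m) 1) : angDeriv i j v x = angDeriv i j w x := by
  rcases eq_or_ne i j with rfl | hij
  · rw [angDeriv_self, angDeriv_self]
  have hx' : planeRot i j 0 x ∈ Metric.sphere (0 : Euc m) 1 := planeRot_mem_sphere hij 0 hx
  have h1 := hasDerivAt_comp_planeRot hij (hv _ hx')
  have h2 := hasDerivAt_comp_planeRot hij (hw _ hx')
  have h3 : (fun t => v (planeRot i j t x)) = fun t => w (planeRot i j t x) :=
    funext fun t => h _ (planeRot_mem_sphere hij t hx)
  rw [h3] at h1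
  simpa only [planeRot_zero] using h1.unique h2

end SphRho

/-! ### Functions in the kernel of the Dunkl-spherical Dirac operator are polynomials -/

section Tame

variable {m : ℕ} {H : ℕ → ℝ → Prop} {ε : ℝ}

/-- The components of degree `l > J` of `w` are bounded by `C √l e^{-εl} K` whenever `H J K`
holds. -/
def Tame (H : ℕ → ℝ → Prop) (ε : ℝ) (w : SphFun m) : Prop :=
  ∃ C ≥ 0, ∀ (J : ℕ) (K : ℝ), 2 ≤ J → 0 ≤ K → H J K → ∀ l : ℕ, J + 1 ≤ l →
    Real.exp (ε * l) * ‖layerProj sphFilt l w‖ ≤ C * Real.sqrt (2 * l + m + 2) * K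

theorem Tame.add {v w : SphFun m} (hv : Tame H ε v) (hw : Tame H ε w) : Tame H ε (v + w) := by
  obtain ⟨C, hC, h⟩ := hv
  obtain ⟨C', hC', h'⟩ := hw
  refine ⟨C + C', add_nonneg hC hC', fun J K hJ hK hH l hl => ?_⟩
  rw [map_add]
  have h1 := mul_le_mul_of_nonneg_left (norm_add_le (layerProj sphFilt l v) (layerProj sphFilt l w))
    (Real.exp_pos (ε * l)).le
  linarith [h J K hJ hK hH l hl, h' J K hJ hK hH l hl]

theorem Tame.smul {w : SphFun m} (hw : Tame H ε w) (r : ℝ) : Tame H ε (r • w) := by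
  obtain ⟨C, hC, h⟩ := hw
  refine ⟨|r| * C, by positivity, fun J K hJ hK hH l hl => ?_⟩
  rw [map_smul, norm_smul, Real.norm_eq_abs, mul_left_comm, mul_assoc, mul_assoc, ← mul_assoc C]
  exact mul_le_mul_of_nonneg_left (h J K hJ hK hH l hl) (abs_nonneg r)

theorem Tame.sub {v w : SphFun m} (hv : Tame H ε v) (hw : Tame H ε w) : Tame H ε (v - w) := by
  rw [sub_eq_add_neg, ← neg_one_smul ℝ w]
  exact hv.add (hw.smul _)

theorem Tame.sum {κ : Type*} (s : Finset κ) {w : κ → SphFun m} (hw : ∀ i ∈ s, Tame H ε (w i)) :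
    Tame H ε (∑ i ∈ s, w i) :=
  sum_induction w (Tame H ε) (fun _ _ => Tame.add) ⟨0, le_rfl, fun J K _ _ _ l _ => by simp⟩ hw

theorem Tame.compOp_reflIso {w : SphFun m} (hw : Tame H ε w) (α : Euc m) :
    Tame H ε (compOp (reflIso α) w) := by
  obtain ⟨C, hC, h⟩ := hw
  refine ⟨C, hC, fun J K hJ hK hH l hl => le_trans ?_ (h J K hJ hK hH l hl)⟩
  exact mul_le_mul_of_nonneg_left (norm_layerProj_compOp_reflIso_le α l w) (Real.exp_pos _).le

theorem tame_of_le {w : SphFun m}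
    (h : ∀ J K, H J K → ∀ l : ℕ, J + 1 ≤ l → Real.exp (ε * l) * ‖layerProj sphFilt l w‖ ≤ K) :
    Tame H ε w := by
  refine ⟨1, zero_le_one, fun J K _ hK hH l hl => (h J K hH l hl).trans ?_⟩
  have : 1 ≤ Real.sqrt (2 * l + m + 2) := by
    rw [Real.one_le_sqrt]
    have h1 : (0 : ℝ) ≤ l := l.cast_nonneg
    have h2 : (0 : ℝ) ≤ m := m.cast_nonneg
    linarith
  rw [one_mul]
  exact le_mul_of_one_le_left hK this

/-- Reflections do not increase the layer norms, so `⟨α, x⟩ v` inherits the bound with `2 K`, and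
division costs a square root. The layer `l` of `⟨β, x⟩ v` uses the layers `l ± 1` of `v`: hence the
division estimate must hold from `J` on and not only from `J + 1`, the square root contains `+ 2`,
and a factor `e^ε` appears. -/
theorem tame_linOp_of_linOp_eq_sub (hε : 0 < ε) {α : Euc m} (hα : α ≠ 0) {u v : SphFun m}
    (hu : ∀ J K, H J K → ∀ l : ℕ, J + 1 ≤ l → Real.exp (ε * l) * ‖layerProj sphFilt l u‖ ≤ K)
    (hv : linOp α v = u - compOp (reflIso α) u) {β : Euc m} (hβ : ‖β‖ = 1) :
    Tame H ε (linOp β v) := by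
  obtain ⟨C, hC, h⟩ := exists_exp_mul_norm_layerProj_le_of_linOp hα hε
  refine ⟨4 * Real.exp ε * C, by positivity, fun J K hJ hK hH l hl => ?_⟩
  have h1 : ∀ l : ℕ, J + 1 ≤ l → Real.exp (ε * l) * ‖layerProj sphFilt l (linOp α v)‖ ≤ 2 * K := by
    intro l hl
    rw [hv, map_sub]
    have h2 := mul_le_mul_of_nonneg_left (norm_sub_le (layerProj sphFilt l u)
      (layerProj sphFilt l (compOp (reflIso α) u))) (Real.exp_pos (ε * l)).le
    have h3 := mul_le_mul_of_nonneg_left (norm_layerProj_compOp_reflIso_le α l u)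
      (Real.exp_pos (ε * l)).le
    linarith [hu J K hH l hl]
  have h2 := h v (2 * K) (by positivity) J hJ h1
  obtain ⟨n, rfl⟩ : ∃ n, l = n + 1 := ⟨l - 1, by omega⟩
  set s := Real.sqrt (2 * ((n + 1 : ℕ) : ℝ) + m + 2) with hs
  have hlin : ∀ w : SphFun m, ‖layerProj sphFilt (n + 1) (linOp β w)‖ ≤ ‖w‖ := fun w => by
    refine (norm_layerProj_le _ _).trans ((norm_linOp_le _ _).trans ?_)
    rw [hβ, one_mul]
  have h3 : ‖layerProj sphFilt (n + 1) (linOp β v)‖ ≤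
      ‖layerProj sphFilt n v‖ + ‖layerProj sphFilt (n + 2) v‖ := by
    rw [layerProj_linOp β n v]
    exact (norm_add_le _ _).trans (add_le_add (hlin _) (hlin _))
  have hexp1 : Real.exp (ε * ((n + 1 : ℕ) : ℝ)) = Real.exp ε * Real.exp (ε * n) := by
    rw [← Real.exp_add]; congr 1; push_cast; ring
  have hexp2 : Real.exp (ε * ((n + 1 : ℕ) : ℝ)) ≤ Real.exp ε * Real.exp (ε * ((n + 2 : ℕ) : ℝ)) := by
    rw [← Real.exp_add]
    refine Real.exp_le_exp.2 ?_
    push_cast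
    nlinarith
  have h4 : Real.exp (ε * ((n + 1 : ℕ) : ℝ)) * ‖layerProj sphFilt n v‖ ≤
      Real.exp ε * (C * s * (2 * K)) := by
    rw [hexp1, mul_assoc]
    refine mul_le_mul_of_nonneg_left ((h2 n (by omega)).trans ?_) (Real.exp_pos _).le
    refine mul_le_mul_of_nonneg_right (mul_le_mul_of_nonneg_left (Real.sqrt_le_sqrt ?_) hC)
      (by positivity)
    push_cast
    linarith
  have h5 : Real.exp (ε * ((n + 1 : ℕ) : ℝ)) * ‖layerProj sphFilt (n + 2) v‖ ≤
      Real.exp ε * (C * s * (2 * K)) := by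
    refine (mul_le_mul_of_nonneg_right hexp2 (norm_nonneg _)).trans ?_
    rw [mul_assoc]
    refine mul_le_mul_of_nonneg_left ((h2 (n + 2) (by omega)).trans ?_) (Real.exp_pos _).le
    refine mul_le_mul_of_nonneg_right (mul_le_mul_of_nonneg_left (Real.sqrt_le_sqrt ?_) hC)
      (by positivity)
    push_cast
    linarith
  have h6 := mul_le_mul_of_nonneg_left h3 (Real.exp_pos (ε * ((n + 1 : ℕ) : ℝ))).le
  linarith

end Tame

/-! ### Analytic kernel elements are polynomials, hence affine, on the unit sphere. -/

section Kernel

variable {m : ℕ} {ι J : Type*} [Fintype ι] [DecidableEq ι] [Fintype J]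

/-- The Dunkl-spherical Dirac operator for vectors of functions. -/
def sphDunkl (α : J → Euc m) (k : J → ℝ) (c : Fin m → Matrix ι ι ℝ) (G : ι → Euc m → ℝ) (A : ι)
    (x : Euc m) : ℝ :=
  (∑ a, k a) * G A x - 1 / 2 * (∑ i, ∑ j, ∑ B, (c i * c j) A B * (angDeriv i j (G B) x +
    ∑ a, k a * (x i * α a j - x j * α a i) * sphRho (α a) (G B) x)) -
    ∑ a, k a * G A (reflIso (α a) x)

/-- The angular form of `-E - X D`, obtained from `sum_angular`; it has the shape of `sphDunkl`,
with which it is compared on the sphere. -/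
theorem sphOp_apply {α : J → Fin m → ℝ} (hα : ∀ a, α a ≠ 0) (k : J → ℝ) {c : Fin m → Matrix ι ι ℝ}
    (hc : IsCliffordFamily c) (F : ι → MvPolynomial (Fin m) ℝ) (A : ι) :
    sphOp hα k c F A = (∑ a, k a) • F A - (1 / 2 : ℝ) • (∑ i, ∑ j, ∑ B, (c i * c j) A B •
      (polyAng i j (F B) + ∑ a, k a • ((α a j • X i - α a i • X j) * polyRho (hα a) (F B)))) -
      ∑ a, k a • polyReflect (α a) (F A) := by
  have h := (isCliffordFamily_matOp (m := m) hc).sum_angular (x := fun i => diagOp ι (coordOp i))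
    (fun i j => matOp_commute_diagOp _ _) fun i => diagOp ι (polyDunkl hα k i)
  have h1 := congr_fun (LinearMap.congr_fun h F) A
  have h2 := sum_X_mul_polyDunkl hα k (F A)
  have e : ∀ i j B, polyAng i j (F B) +
      ∑ a, k a • ((α a j • X i - α a i • X j) * polyRho (hα a) (F B)) =
      X i * polyDunkl hα k j (F B) - X j * polyDunkl hα k i (F B) := by
    intro i j B
    simp only [polyDunkl_apply, polyAng_apply, mul_add, mul_sum, add_sub_add_comm,
      ← sum_sub_distrib]
    congr 1
    refine sum_congr rfl fun a _ => ?_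
    simp only [smul_eq_C_mul, map_mul]
    ring
  have h3 : (∑ i, ∑ j, ∑ B, (c i * c j) A B • (X i * polyDunkl hα k j (F B) -
      X j * polyDunkl hα k i (F B))) = (2 : ℝ) • ((vecOp c * diracOp hα k c) F A +
      ∑ i, X i * polyDunkl hα k i (F A)) := by
    refine Eq.trans ?_ (h1.trans ?_)
    · simp only [LinearMap.sum_apply, Finset.sum_apply, ← map_mul, Module.End.mul_apply, matOp_apply]
      rfl
    · simp only [LinearMap.smul_apply, LinearMap.add_apply, Pi.smul_apply, Pi.add_apply,
        LinearMap.sum_apply, Finset.sum_apply]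
      rfl
  simp only [e, h3, h2]
  simp only [sphOp, LinearMap.sub_apply, LinearMap.neg_apply, Pi.sub_apply, Pi.neg_apply, eulerOp,
    diagOp_apply, Derivation.coeFn_coe, smul_sub, sum_sub_distrib, sum_smul]
  module

variable {α : J → Euc m} {k : J → ℝ} {c : Fin m → Matrix ι ι ℝ} {G : ι → Euc m → ℝ}

/-- A function on the sphere with finitely many components is a polynomial. -/
theorem exists_polyRes_eq_of_layerProj_eq_zero {u : SphFun m} {n : ℕ}
    (h : ∀ l, n ≤ l → layerProj sphFilt l u = 0) : ∃ p, polyRes p = u := by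
  have hmem : ∑ l ∈ range n, layerProj sphFilt l u ∈ (sphFilt n : Submodule ℝ (SphFun m)) :=
    sum_mem fun l hl => sphFilt_mono (mem_range.1 hl) (layerProj_mem l u).1
  obtain ⟨p, -, hp⟩ := hmem
  refine ⟨p, ?_⟩
  rw [eq_comm, ← sub_eq_zero]
  refine eq_zero_of_inner_polyRes _ fun q => ?_
  obtain ⟨N, hN⟩ := exists_mem_polyLT q
  refine inner_eq_zero_of_layerProj_eq_zero sphFilt_mono sphFilt_zero (fun l => ?_) (polyRes_mem hN)
  rw [hp, map_sub, map_sum]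
  have h1 : ∀ i, layerProj sphFilt l (layerProj sphFilt i u) =
      if l = i then layerProj sphFilt i u else 0 := by
    intro i
    split_ifs with hi
    · subst hi
      exact layerProj_eq_self (layerProj_mem _ _)
    · refine layerProj_eq_of_inner (zero_mem _) fun w hw => ?_
      rw [inner_zero_left, inner_eq_zero_of_layer_ne sphFilt_mono (Ne.symm hi) (layerProj_mem _ _) hw]
  simp only [h1, sum_ite_eq, mem_range]
  split_ifs with hl
  · exact sub_self _
  · rw [h l (not_lt.1 hl), sub_zero]

/-- The components of an angular derivative. -/
theorem layerProj_angDeriv (i j : Fin m) {g : Euc m → ℝ}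
    (hg : ∀ x ∈ Metric.sphere (0 : Euc m) 1, ContDiffAt ℝ 1 g x) {u d : SphFun m}
    (hu : ∀ x : Sph m, u x = g x) (hd : ∀ x : Sph m, d x = angDeriv i j g x) {l : ℕ}
    {p : MvPolynomial (Fin m) ℝ} (hp : p ∈ polyLT m (l + 1))
    (hpu : polyRes p = layerProj sphFilt l u) :
    layerProj sphFilt l d = polyRes (polyAng i j p) := by
  have hpl : polyRes p ∈ layer sphFilt l := hpu ▸ layerProj_mem l u
  refine layerProj_eq_of_inner (polyRes_polyAng_mem_layer i j hp hpl) fun h hh => ?_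
  obtain ⟨q, hq, rfl⟩ := exists_polyRes_eq hh
  rw [inner_polyRes_polyAng, hpu, inner_layerProj u (polyRes_polyAng_mem_layer i j hq hh),
    SphFun.inner_def, SphFun.inner_def]
  have := integral_angDeriv_mul i j hg q
  simp only [hu, hd, polyRes_apply]
  rw [this]

/-- The components of an analytic solution of the Dunkl-spherical Dirac equation are polynomials
on the sphere. -/
theorem exists_polyFun_eq_of_sphDunkl_eq_zero (hm : m ≠ 0) (hc : IsCliffordFamily c)
    (hα : ∀ a, α a ≠ 0) (hG : ∀ A, AnalyticOnNhd ℝ (G A) (Metric.sphere 0 1))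
    (h : ∀ x ∈ Metric.sphere (0 : Euc m) 1, ∀ A, sphDunkl α k c G A x = 0) :
    ∃ F : ι → MvPolynomial (Fin m) ℝ, ∀ x ∈ Metric.sphere (0 : Euc m) 1, ∀ A,
      polyFun (F A) x = G A x := by
  have hG1 : ∀ A, ∀ x ∈ Metric.sphere (0 : Euc m) 1, ContDiffAt ℝ 1 (G A) x := fun A x hx =>
    (hG A x hx).contDiffAt
  have hrefl : ∀ a, ∀ x : Sph m, reflIso (α a) x ∈ Metric.sphere (0 : Euc m) 1 := fun a x =>
    (sphMap (reflIso (α a)) x).2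
  set u : ι → SphFun m := fun A => (⟨fun x : Sph m => G A x, continuous_iff_continuousAt.2
    fun x => (hG A x x.2).continuousAt.comp continuous_subtype_val.continuousAt⟩ : C(Sph m, ℝ))
  set d : Fin m → Fin m → ι → SphFun m := fun i j A => (⟨fun x : Sph m => angDeriv i j (G A) x,
    continuous_iff_continuousAt.2 fun x => (analyticOnNhd_angDeriv (hG A) i j x x.2).continuousAt.comp
      continuous_subtype_val.continuousAt⟩ : C(Sph m, ℝ))
  set v : J → ι → SphFun m := fun a A => (⟨fun x : Sph m => sphRho (α a) (G A) x,
    continuous_iff_continuousAt.2 fun x => (continuousAt_sphRho (hα a) (hG1 A x x.2)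
      (hG A _ (hrefl a x)).continuousAt).comp continuous_subtype_val.continuousAt⟩ : C(Sph m, ℝ))
  have hu : ∀ A (x : Sph m), u A x = G A x := fun A x => rfl
  have hd : ∀ i j A (x : Sph m), d i j A x = angDeriv i j (G A) x := fun i j A x => rfl
  have hv : ∀ a A, linOp (α a) (v a A) = u A - compOp (reflIso (α a)) (u A) := fun a A =>
    SphFun.ext fun x => inner_mul_sphRho (α a) (G A) x
  choose ε hε K hK hb using fun A => exists_exp_mul_norm_layerProj_le hm (hG A) (hu A)
  obtain ⟨ε₀, hε₀, hle⟩ : ∃ ε₀ > 0, ∀ A, ε₀ ≤ ε A := by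
    rcases isEmpty_or_nonempty ι with hι | hι
    · exact ⟨1, one_pos, fun A => hι.elim A⟩
    · obtain ⟨A, hA⟩ := Finite.exists_min ε
      exact ⟨ε A, hε A, hA⟩
  -- The bound concerns all components at once, because the equation couples them.
  set H : ℕ → ℝ → Prop := fun J K => ∀ A, ∀ l : ℕ, J + 1 ≤ l →
    Real.exp (ε₀ * l) * ‖layerProj sphFilt l (u A)‖ ≤ K with hH
  have huT : ∀ A, Tame H ε₀ (u A) := fun A => tame_of_le fun J K hJK l hl => hJK A l hl
  have hvT : ∀ a A i, Tame H ε₀ (linOp (EuclideanSpace.single i 1) (v a A)) := fun a A i =>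
    tame_linOp_of_linOp_eq_sub hε₀ (hα a) (fun J K hJK l hl => hJK A l hl) (hv a A) (by simp)
  set w : ι → SphFun m := fun A => -(1 / 2 : ℝ) • ∑ i, ∑ j, ∑ B, (c i * c j) A B • d i j B with hw
  have hwT : ∀ A, Tame H ε₀ (w A) := by
    intro A
    -- The equation solved for `Γ`. Every difference quotient carries a coordinate as a factor,
    -- which is the form that `hvT` controls.
    have e : w A = (1 / 2 : ℝ) • (∑ i, ∑ j, ∑ B, (c i * c j) A B • ∑ a, k a •
        (α a j • linOp (EuclideanSpace.single i 1) (v a B) -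
          α a i • linOp (EuclideanSpace.single j 1) (v a B))) +
        ∑ a, k a • compOp (reflIso (α a)) (u A) - (∑ a, k a) • u A := by
      refine SphFun.ext fun x => ?_
      have hx := h x x.2 A
      have e1 : ∀ i a B, linOp (EuclideanSpace.single i 1) (v a B) x =
          (x : Euc m) i * sphRho (α a) (G B) x := fun i a B => by
        have e0 : v a B x = sphRho (α a) (G B) x := rfl
        rw [linOp_apply, e0]
        simp [EuclideanSpace.inner_single_left]
      have e2 : ∀ a, compOp (reflIso (α a)) (u A) x = G A (reflIso (α a) x) := fun a => rfl
      rw [sphDunkl] at hx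
      simp only [hw, SphFun.smul_apply, SphFun.sum_apply, SphFun.add_apply, SphFun.sub_apply, e1, e2,
        hu, hd]
      simp only [mul_add, sum_add_distrib] at hx
      have e3 : ∀ i j B, ∑ a, k a * (α a j * ((x : Euc m) i * sphRho (α a) (G B) x) -
          α a i * ((x : Euc m) j * sphRho (α a) (G B) x)) =
          ∑ a, k a * ((x : Euc m) i * α a j - (x : Euc m) j * α a i) * sphRho (α a) (G B) x :=
        fun i j B => sum_congr rfl fun a _ => by ring
      simp only [e3]
      linarith
    rw [e]
    refine ((Tame.smul (Tame.sum _ fun i _ => Tame.sum _ fun j _ => Tame.sum _ fun B _ =>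
      Tame.smul (Tame.sum _ fun a _ => Tame.smul (Tame.sub (Tame.smul (hvT a B i) _)
      (Tame.smul (hvT a B j) _)) _) _) _).add (Tame.sum _ fun a _ =>
      Tame.smul ((huT A).compOp_reflIso _) _)).sub (Tame.smul (huT A) _)
  choose C hC hCw using hwT
  obtain ⟨C₁, hC₁, hlow⟩ := exists_mul_norm_le_angDirac hm hc
  set C₂ := C₁ * ∑ A, C A with hC₂
  have hC₂0 : 0 ≤ C₂ := mul_nonneg hC₁ (sum_nonneg fun A _ => hC A)
  -- `Γ` gains a factor `l` and the right-hand side loses only a square root, so beyond some `J` the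
  -- gain wins by a factor of two. This `J` does not depend on `K`, which allows iteration.
  obtain ⟨J, hJ2, hJ⟩ : ∃ J : ℕ, 2 ≤ J ∧ ∀ l : ℕ, J + 1 ≤ l →
      C₂ * Real.sqrt (2 * l + m + 2) ≤ l / 2 := by
    obtain ⟨J, hJ⟩ := exists_nat_ge (4 * C₂ ^ 2 * (m + 4))
    refine ⟨J + 2, by omega, fun l hl => ?_⟩
    have hl1 : (1 : ℝ) ≤ l := by
      have : 1 ≤ l := by omega
      exact_mod_cast this
    have hlJ : (J : ℝ) ≤ l := by
      have : J ≤ l := by omega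
      exact_mod_cast this
    have hm0 : (0 : ℝ) ≤ m := m.cast_nonneg
    refine abs_le_of_sq_le_sq' ?_ (by positivity) |>.2
    rw [mul_pow, Real.sq_sqrt (by positivity)]
    have h1 : (2 * l + m + 2 : ℝ) ≤ (m + 4) * l := by nlinarith
    have h2 := mul_le_mul_of_nonneg_left h1 (sq_nonneg C₂)
    have h3 := mul_le_mul_of_nonneg_right (hJ.trans hlJ) (zero_le_one.trans hl1)
    linarith [h2, h3]
  have hstep : ∀ K, 0 ≤ K → H J K → H J (K / 2) := by
    intro K hK hHK A l hl
    choose p hp hpu using fun B => exists_polyRes_eq (layerProj_mem (V := sphFilt) l (u B))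
    have hpl : ∀ B, polyRes (p B) ∈ layer sphFilt l := fun B => hpu B ▸ layerProj_mem l (u B)
    have h1 := hlow l (by omega) p hp hpl A
    have h2 : ∀ B, polyRes (angDirac c p B) = layerProj sphFilt l (w B) := by
      intro B
      rw [polyRes_angDirac, hw]
      simp only [map_smul, map_sum]
      congr 1
      refine sum_congr rfl fun i _ => sum_congr rfl fun j _ => sum_congr rfl fun B' _ => ?_
      rw [layerProj_angDeriv i j (hG1 B') (hu B') (hd i j B') (hp B') (hpu B')]
    have hl0 : (0 : ℝ) < l := by
      have : 0 < l := by omega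
      exact_mod_cast this
    have h3 : Real.exp (ε₀ * l) * ∑ B, ‖polyRes (angDirac c p B)‖ ≤
        (∑ B, C B) * (Real.sqrt (2 * l + m + 2) * K) := by
      rw [mul_sum, sum_mul]
      refine sum_le_sum fun B _ => ?_
      rw [h2, ← mul_assoc]
      exact hCw B J K hJ2 hK hHK l hl
    have h4 : (l : ℝ) * (Real.exp (ε₀ * l) * ‖polyRes (p A)‖) ≤ l * (K / 2) := by
      calc (l : ℝ) * (Real.exp (ε₀ * l) * ‖polyRes (p A)‖)
          = Real.exp (ε₀ * l) * (l * ‖polyRes (p A)‖) := by ring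
        _ ≤ Real.exp (ε₀ * l) * (C₁ * ∑ B, ‖polyRes (angDirac c p B)‖) :=
            mul_le_mul_of_nonneg_left h1 (Real.exp_pos _).le
        _ = C₁ * (Real.exp (ε₀ * l) * ∑ B, ‖polyRes (angDirac c p B)‖) := by ring
        _ ≤ C₁ * ((∑ B, C B) * (Real.sqrt (2 * l + m + 2) * K)) :=
            mul_le_mul_of_nonneg_left h3 hC₁
        _ = C₂ * Real.sqrt (2 * l + m + 2) * K := by rw [hC₂]; ring
        _ ≤ l / 2 * K := mul_le_mul_of_nonneg_right (hJ l hl) hK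
        _ = l * (K / 2) := by ring
    rw [← hpu]
    exact le_of_mul_le_mul_left h4 hl0
  have hinit : H J (∑ A, K A) := by
    intro A l _
    refine le_trans ?_ ((hb A l).trans (single_le_sum (fun A _ => hK A) (mem_univ A)))
    refine mul_le_mul_of_nonneg_right (Real.exp_le_exp.2 ?_) (norm_nonneg _)
    exact mul_le_mul_of_nonneg_right (hle A) l.cast_nonneg
  have hKs : 0 ≤ ∑ A, K A := sum_nonneg fun A _ => hK A
  have hiter : ∀ n : ℕ, H J ((∑ A, K A) * (1 / 2) ^ n) := by
    intro n
    induction n with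
    | zero => simpa using hinit
    | succ n ih =>
      have := hstep _ (by positivity) ih
      rwa [pow_succ, ← mul_assoc, mul_one_div]
  have hzero : ∀ A, ∀ l, J + 1 ≤ l → layerProj sphFilt l (u A) = 0 := by
    intro A l hl
    have h1 : Tendsto (fun n : ℕ => (∑ A, K A) * (1 / 2 : ℝ) ^ n) atTop (𝓝 ((∑ A, K A) * 0)) :=
      (tendsto_pow_atTop_nhds_zero_of_lt_one (by norm_num) (by norm_num)).const_mul _
    have h2 := ge_of_tendsto' h1 fun n => hiter n A l hl
    rw [mul_zero] at h2
    have h3 := (mul_nonpos_iff_pos_imp_nonpos.1 h2).1 (Real.exp_pos _)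
    exact norm_le_zero_iff.1 h3
  choose F hF using fun A => exists_polyRes_eq_of_layerProj_eq_zero (hzero A)
  refine ⟨F, fun x hx A => ?_⟩
  have := congr_arg (fun u : SphFun m => u ⟨x, hx⟩) (hF A)
  exact this

/-- An analytic solution of the Dunkl-spherical Dirac equation is the sum of a constant and of the
product of the vector variable and a constant on the unit sphere. -/
theorem exists_eq_add_of_sphDunkl_eq_zero (hm : m ≠ 0) (hc : IsCliffordFamily c)
    (hα : ∀ a, α a ≠ 0) (hγ : ∑ a, k a = (1 - (m : ℝ)) / 2)
    (hG : ∀ A, AnalyticOnNhd ℝ (G A) (Metric.sphere 0 1))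
    (h : ∀ x ∈ Metric.sphere (0 : Euc m) 1, ∀ A, sphDunkl α k c G A x = 0) :
    ∃ v w : ι → ℝ, ∀ x ∈ Metric.sphere (0 : Euc m) 1, ∀ A,
      G A x = (v + (∑ i, x i • c i).mulVec w) A := by
  obtain ⟨F, hF⟩ := exists_polyFun_eq_of_sphDunkl_eq_zero hm hc hα hG h
  have hα' : ∀ a, (α a : Fin m → ℝ) ≠ 0 := fun a ha => hα a (PiLp.ext fun i => congr_fun ha i)
  have hsph : ∀ x : Fin m → ℝ, ∑ i, x i ^ 2 = 1 →
      (WithLp.toLp 2 x : Euc m) ∈ Metric.sphere (0 : Euc m) 1 := fun x hx => by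
    rw [mem_sphere_zero_iff_norm, ← sq_eq_sq₀ (norm_nonneg _) zero_le_one,
      EuclideanSpace.real_norm_sq_eq, one_pow, ← hx]
  obtain ⟨v, w, hvw⟩ := exists_evalVec_eq (α := fun a => (α a : Fin m → ℝ)) hα' k hm hc hγ F
    fun x hx hreg => by
      funext A
      set y : Euc m := WithLp.toLp 2 x with hy
      have hys := hsph x hx
      have hz := h y hys A
      rw [Pi.zero_apply, ← hz, evalVec_apply, sphOp_apply hα' k hc]
      have e1 : ∀ B, eval x (F B) = G B y := fun B => hF y hys B
      -- `F` and `G` agree on the sphere only. That suffices: angular derivatives are tangential,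
      -- and off the mirrors the divided differences depend on values alone.
      have e2 : ∀ i j B, eval x (polyAng i j (F B)) = angDeriv i j (G B) y := fun i j B => by
        refine (angDeriv_polyFun i j (F B) y).symm.trans ?_
        exact angDeriv_eq_of_eqOn_sphere (fun z _ => (polyFun_contDiff _).contDiffAt.differentiableAt
          (by simp)) (fun z hz => (hG B z hz).differentiableAt) (fun z hz => hF z hz B) i j hys
      have e3 : ∀ a B, eval x (polyReflect (α a) (F B)) = G B (reflIso (α a) y) := fun a B =>
        (polyFun_polyReflect (α a) (F B) y).trans (hF _ (sphMap (reflIso (α a)) ⟨y, hys⟩).2 B)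
      have e4 : ∀ a B, eval x (polyRho (hα' a) (F B)) = sphRho (α a) (G B) y := fun a B => by
        have h1 := congr_arg (eval x) (linForm_mul_polyRho (hα' a) (F B))
        rw [map_mul, map_sub, e1, e3, ← inner_mul_sphRho] at h1
        have h2 : eval x (linForm (α a)) = inner ℝ (α a) y := polyFun_linForm (α a) y
        rw [h2] at h1
        refine mul_left_cancel₀ ?_ h1
        rw [← h2]
        simpa [linForm] using hreg a
      simp only [map_sub, map_sum, map_add, smul_eval, map_mul, e1, e2, e3, e4, eval_X, sphDunkl]
      have e5 : ∀ i, y i = x i := fun i => rfl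
      simp only [e5, mul_assoc]
      simp only [mul_comm (x _)]
  refine ⟨v, w, fun x hx A => ?_⟩
  have hx' : ∑ i, x i ^ 2 = 1 := by
    rw [← EuclideanSpace.real_norm_sq_eq, mem_sphere_zero_iff_norm.1 hx, one_pow]
  rw [← hF x hx A, ← hvw x hx', evalVec_apply]
  rfl

end Kernel

end

noncomputable section

set_option linter.unusedSectionVars false

open Finset

/-! ### Passage from paravectors to the unit sphere. -/

section Slice

variable {m : ℕ}

/-- The vector part of a paravector. -/
def imPart (x : Paravec m) : Euc m := WithLp.toLp 2 fun j => x j.succ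

/-- The vectors, as paravectors. -/
def imEmb : Euc m →L[ℝ] Paravec m := LinearMap.toContinuousLinearMap
  { toFun := fun v => WithLp.toLp 2 (Fin.cons 0 fun j => v j)
    map_add' := fun u v => by
      ext i
      refine Fin.cases ?_ (fun j => ?_) i <;> simp
    map_smul' := fun r v => by
      ext i
      refine Fin.cases ?_ (fun j => ?_) i <;> simp }

@[simp] theorem imEmb_zero (v : Euc m) : imEmb v 0 = 0 := rfl

@[simp] theorem imEmb_succ (v : Euc m) (j : Fin m) : imEmb v j.succ = v j := rfl

@[simp] theorem imPart_apply (x : Paravec m) (j : Fin m) : imPart x j = x j.succ := rfl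

theorem imEmb_imPart {x : Paravec m} (hx : x 0 = 0) : imEmb (imPart x) = x := by
  ext i
  refine Fin.cases ?_ (fun j => ?_) i <;> simp [hx]

theorem imEmb_single (j : Fin m) :
    imEmb (EuclideanSpace.single j 1) = EuclideanSpace.single j.succ 1 := by
  ext i
  refine Fin.cases ?_ (fun j => ?_) i
  · simp [(Fin.succ_ne_zero j).symm]
  · simp

@[simp] theorem slicePoint_zero (a b : ℝ) (ω : Euc m) : slicePoint a b ω 0 = a := rfl

@[simp] theorem slicePoint_succ (a b : ℝ) (ω : Euc m) (j : Fin m) :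
    slicePoint a b ω j.succ = b * ω j := rfl

theorem slicePoint_eq (a b : ℝ) (ω : Euc m) :
    slicePoint a b ω = slicePoint a 0 0 + b • imEmb ω := by
  ext i
  refine Fin.cases ?_ (fun j => ?_) i <;> simp

theorem inner_imEmb_slicePoint (u : Euc m) (a b : ℝ) (ω : Euc m) :
    inner ℝ (imEmb u) (slicePoint a b ω) = b * inner ℝ u ω := by
  simp only [PiLp.inner_apply, Fin.sum_univ_succ, imEmb_zero, imEmb_succ, slicePoint_zero,
    slicePoint_succ, mul_sum]
  simp [mul_left_comm, mul_comm]

theorem norm_imEmb (u : Euc m) : ‖imEmb u‖ = ‖u‖ := by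
  rw [← sq_eq_sq₀ (norm_nonneg _) (norm_nonneg _), EuclideanSpace.real_norm_sq_eq,
    EuclideanSpace.real_norm_sq_eq, Fin.sum_univ_succ]
  simp

theorem reflect_imEmb_slicePoint (u : Euc m) (a b : ℝ) (ω : Euc m) :
    reflect (imEmb u) (slicePoint a b ω) = slicePoint a b (reflIso u ω) := by
  rw [reflect, inner_imEmb_slicePoint, norm_imEmb, reflIso_apply]
  ext i
  refine Fin.cases ?_ (fun j => ?_) i
  · simp
  · simp
    ring

theorem imNorm_slicePoint (a b : ℝ) {ω : Euc m} (hω : ‖ω‖ = 1) :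
    imNorm (slicePoint a b ω) = |b| := by
  have : ∑ j, ω j ^ 2 = 1 := by rw [← EuclideanSpace.real_norm_sq_eq, hω, one_pow]
  simp only [imNorm, slicePoint_succ, mul_pow, ← mul_sum, this, mul_one]
  exact Real.sqrt_sq_eq_abs b

theorem paraConj_slicePoint (a b : ℝ) (ω : Euc m) :
    paraConj (slicePoint a b ω) = slicePoint a b (-ω) := by
  ext i
  refine Fin.cases ?_ (fun j => ?_) i <;> simp [paraConj]

theorem slicePoint_neg_neg (a b : ℝ) (ω : Euc m) :
    slicePoint a (-b) (-ω) = slicePoint a b ω := by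
  ext i
  refine Fin.cases ?_ (fun j => ?_) i <;> simp

theorem slicePoint_neg (a b : ℝ) (ω : Euc m) :
    slicePoint a (-b) ω = slicePoint a b (-ω) := by
  rw [← slicePoint_neg_neg, neg_neg]

variable {W : Type*} [NormedAddCommGroup W] [NormedSpace ℝ W] {f : Paravec m → W}

theorem hasFDerivAt_comp_slicePoint {a b : ℝ} {ω : Euc m}
    (hf : DifferentiableAt ℝ f (slicePoint a b ω)) :
    HasFDerivAt (fun ω => f (slicePoint a b ω))
      ((fderiv ℝ f (slicePoint a b ω)).comp (b • imEmb)) ω := by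
  have h : HasFDerivAt (fun ω : Euc m => slicePoint a b ω) (b • imEmb) ω := by
    have h1 : (fun ω : Euc m => slicePoint a b ω) = fun ω =>
        slicePoint a 0 0 + (b • imEmb : Euc m →L[ℝ] Paravec m) ω :=
      funext fun ω => slicePoint_eq a b ω
    rw [h1]
    exact (b • imEmb : Euc m →L[ℝ] Paravec m).hasFDerivAt.const_add _
  exact hf.hasFDerivAt.comp ω h

theorem analyticAt_comp_slicePoint {a b : ℝ} {ω : Euc m}
    (hf : AnalyticAt ℝ f (slicePoint a b ω)) :
    AnalyticAt ℝ (fun ω => f (slicePoint a b ω)) ω := by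
  have h1 : (fun ω : Euc m => slicePoint a b ω) = fun ω =>
      slicePoint a 0 0 + (b • imEmb : Euc m →L[ℝ] Paravec m) ω :=
    funext fun ω => slicePoint_eq a b ω
  have h : AnalyticAt ℝ (fun ω : Euc m => slicePoint a b ω) ω := by
    rw [h1]
    exact analyticAt_const.add ((b • imEmb : Euc m →L[ℝ] Paravec m).analyticAt ω)
  exact hf.comp h

theorem angDeriv_comp_slicePoint {a b : ℝ} {ω : Euc m}
    (hf : DifferentiableAt ℝ f (slicePoint a b ω)) (i j : Fin m) :
    angDeriv i j (fun ω => f (slicePoint a b ω)) ω =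
      slicePoint a b ω i.succ • partialDeriv j.succ f (slicePoint a b ω) -
        slicePoint a b ω j.succ • partialDeriv i.succ f (slicePoint a b ω) := by
  rw [angDeriv, (hasFDerivAt_comp_slicePoint hf).fderiv, partialDeriv, partialDeriv,
    ← imEmb_single, ← imEmb_single, ← map_smul, ← map_smul, ← map_smul, ← map_smul, ← map_sub,
    ← map_sub]
  simp only [ContinuousLinearMap.comp_apply, _root_.smul_apply, slicePoint_succ, rotGen_apply,
    ← map_smul, smul_sub, smul_smul]

/-- Off the mirror the factor `b` comes from the pairing with `a + b ω`, on the mirror from the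
chain rule. -/
theorem smul_rho_imEmb (φ : W →L[ℝ] ℝ) {a b : ℝ} (hb : b ≠ 0) {ω : Euc m}
    (hf : DifferentiableAt ℝ f (slicePoint a b ω)) (u : Euc m) :
    b * φ (rho (imEmb u) f (slicePoint a b ω)) =
      sphRho u (fun ω => φ (f (slicePoint a b ω))) ω := by
  have hd : HasFDerivAt (fun ω => φ (f (slicePoint a b ω)))
      (φ.comp ((fderiv ℝ f (slicePoint a b ω)).comp (b • imEmb))) ω :=
    φ.hasFDerivAt.comp ω (hasFDerivAt_comp_slicePoint hf)
  rw [rho, sphRho, inner_imEmb_slicePoint, reflect_imEmb_slicePoint, norm_imEmb, hd.fderiv]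
  by_cases h : inner ℝ u ω = 0
  · rw [if_pos (by rw [h, mul_zero]), if_pos h]
    simp
    ring
  · rw [if_neg (mul_ne_zero hb h), if_neg h, map_smul, map_sub, smul_eq_mul]
    field_simp

end Slice

/-! ### Coordinates and contraction identities in the Clifford algebra. -/

section CliffordAlgebra

variable {m : ℕ}

theorem isCliffordFamily_clE : IsCliffordFamily (clE : Fin m → Cl m) := by
  intro i j
  split_ifs with h
  · rw [h, clE_mul_self]; norm_num
  · rw [clE_mul_comm h, neg_add_cancel]

/-- The matrices of the left multiplications by the generators. -/
def clMat (i : Fin m) : Matrix (Finset (Fin m)) (Finset (Fin m)) ℝ :=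
  Algebra.leftMulMatrix (clBasis m) (clE i)

theorem isCliffordFamily_clMat : IsCliffordFamily (clMat : Fin m → _) := by
  intro i j
  rw [clMat, clMat, ← map_mul, ← map_mul, ← map_add, isCliffordFamily_clE i j]
  split_ifs
  · rw [map_neg, map_ofNat]
  · exact map_zero _

instance : FiniteDimensional ℝ (Cl m) := Module.Finite.of_basis (clBasis m)

/-- The coordinates in the Clifford algebra. -/
def clCoord (A : Finset (Fin m)) : Cl m →L[ℝ] ℝ :=
  LinearMap.toContinuousLinearMap ((clBasis m).coord A)

theorem clCoord_apply (A : Finset (Fin m)) (u : Cl m) : clCoord A u = (clBasis m).repr u A := rfl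

theorem clCoord_ext {u v : Cl m} (h : ∀ A, clCoord A u = clCoord A v) : u = v :=
  (clBasis m).ext_elem h

theorem clCoord_mul (a : Cl m) (u : Cl m) (A : Finset (Fin m)) :
    clCoord A (a * u) = ∑ B, Algebra.leftMulMatrix (clBasis m) a A B * clCoord B u := by
  rw [clCoord_apply, ← Algebra.leftMulMatrix_mulVec_repr]
  rfl

theorem sum_clE_mul (x T : Fin m → Cl m) (hx : ∀ i j, Commute (clE i : Cl m) (x j)) :
    ∑ i, ∑ j, clE i * clE j * (x i * T j - x j * T i) =
      (2 : ℝ) • ((∑ i, clE i * x i) * (∑ j, clE j * T j) + ∑ i, x i * T i) :=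
  isCliffordFamily_clE.sum_angular hx T

theorem clVec_eq (v : Fin m → ℝ) : clVec v = ∑ i, clE i * algebraMap ℝ (Cl m) (v i) :=
  sum_congr rfl fun i _ => by rw [← Algebra.commutes, Algebra.smul_def]

theorem sum_clE_mul_sub (x y : Fin m → ℝ) :
    ∑ i, ∑ j, (x i * y j - x j * y i) • (clE i * clE j : Cl m) =
      (2 : ℝ) • (clVec x * clVec y + algebraMap ℝ (Cl m) (∑ i, x i * y i)) := by
  have h := sum_clE_mul (m := m) (fun i => algebraMap ℝ _ (x i)) (fun i => algebraMap ℝ _ (y i))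
    fun i j => (Algebra.commutes _ _).symm
  rw [← clVec_eq, ← clVec_eq] at h
  simp only [← map_mul, ← map_sub, ← map_sum] at h
  rw [← h]
  refine sum_congr rfl fun i _ => sum_congr rfl fun j _ => ?_
  rw [← Algebra.commutes, Algebra.smul_def]

/-- The angular identity with the generators in place of a differential operator, and `∑ j, clE j *
clE j = -m`. It computes `Γ` on linear functions. -/
theorem sum_clE_mul_clE (x : Fin m → ℝ) :
    ∑ i, ∑ j, clE i * clE j * (x i • clE j - x j • clE i : Cl m) =
      (2 * (1 - (m : ℝ))) • clVec x := by
  have h := sum_clE_mul (m := m) (fun i => algebraMap ℝ _ (x i)) clE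
    fun i j => (Algebra.commutes _ _).symm
  rw [← clVec_eq] at h
  simp only [clE_mul_self, sum_const, card_univ, Fintype.card_fin, ← Algebra.smul_def] at h
  rw [h, mul_smul, sub_smul, one_smul]
  congr 1
  rw [clVec, ← Nat.cast_smul_eq_nsmul ℝ, mul_smul_comm, mul_neg, mul_one, smul_neg]
  abel

theorem clVec_mul_self (x : Fin m → ℝ) :
    clVec x * clVec x = -algebraMap ℝ (Cl m) (∑ i, x i ^ 2) := by
  have h := sum_clE_mul_sub x x
  have h0 : ∀ i j, x i * x j - x j * x i = 0 := fun i j => by ring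
  simp only [h0, zero_smul, sum_const_zero, ← sq] at h
  have := (smul_eq_zero.1 h.symm).resolve_left two_ne_zero
  rw [sq] at this
  exact eq_neg_of_add_eq_zero_left this

theorem sum_Ioi_eq {V : Type*} [AddCommGroup V] [Module ℝ V] {h : Fin m → Fin m → V}
    (h1 : ∀ i j, h j i = h i j) (h2 : ∀ i, h i i = 0) :
    ∑ i, ∑ j ∈ Ioi i, h i j = (1 / 2 : ℝ) • ∑ i, ∑ j, h i j := by
  have h3 := sum_sum_Ioi_add_eq_sum_sum_off_diag (fun i j => h i j)
  simp only [h1, ← two_smul ℝ (h _ _), ← smul_sum] at h3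
  have h4 : ∀ i, ∑ j ∈ ({i}ᶜ : Finset (Fin m)), h i j = ∑ j, h i j := fun i => by
    rw [← sum_compl_add_sum {i}, sum_singleton, h2, add_zero]
  have h5 : ∑ i, ∑ j ∈ Ioi i, h i j = (1 / 2 : ℝ) • (2 : ℝ) • ∑ i, ∑ j ∈ Ioi i, h i j := by
    rw [smul_smul]; norm_num
  rw [h5, h3]
  simp only [h4]

/-- Off the diagonal both factors change sign under the exchange of `i` and `j`, so the product is
symmetric. -/
theorem sum_Ioi_clE_mul {T : Fin m → Fin m → Cl m} (hT : ∀ i j, T j i = -T i j) :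
    ∑ i, ∑ j ∈ Ioi i, clE i * clE j * T i j = (1 / 2 : ℝ) • ∑ i, ∑ j, clE i * clE j * T i j := by
  have h0 : ∀ i, T i i = 0 := fun i => by
    have := eq_neg_iff_add_eq_zero.1 (hT i i)
    rw [← two_smul ℝ] at this
    exact (smul_eq_zero.1 this).resolve_left two_ne_zero
  refine sum_Ioi_eq (fun i j => ?_) fun i => by rw [h0, mul_zero]
  rcases eq_or_ne i j with rfl | hij
  · rfl
  · rw [hT i j, clE_mul_comm hij.symm, neg_mul_neg]

theorem sphericalDirac_eq (f : Paravec m → Cl m) (x : Paravec m) :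
    sphericalDirac f x = -(1 / 2 : ℝ) • ∑ i : Fin m, ∑ j : Fin m, clE i * clE j *
      (x i.succ • partialDeriv j.succ f x - x j.succ • partialDeriv i.succ f x) := by
  rw [sphericalDirac, sum_Ioi_clE_mul fun i j => (neg_sub _ _).symm, neg_smul]

theorem dunklPsi_eq (Rp : Finset (Paravec m)) (κ : Paravec m → ℝ) (f : Paravec m → Cl m)
    (x : Paravec m) : dunklPsi Rp κ f x = -(1 / 2 : ℝ) • ∑ i : Fin m, ∑ j : Fin m, clE i * clE j *
      (∑ α ∈ Rp, (κ α * (x i.succ * α j.succ - x j.succ * α i.succ)) • rho α f x) -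
      ∑ α ∈ Rp, κ α • f (reflect α x) := by
  rw [dunklPsi, sum_Ioi_clE_mul fun i j => ?_, neg_smul]
  rw [← sum_neg_distrib]
  refine sum_congr rfl fun α _ => ?_
  rw [← neg_smul]
  congr 1
  ring

/-- Angular fields do not see the radius, and in `Ψ` the factor `b` of the coordinates compensates
the scaling of `rho`. Roots without `0`-th coordinate reflect each sphere into itself. -/
theorem clCoord_dunklSphericalDirac {Rp : Finset (Paravec m)} (h0 : ∀ α ∈ Rp, α 0 = 0)
    (κ : Paravec m → ℝ) {f : Paravec m → Cl m} {a b : ℝ} (hb : b ≠ 0) {ω : Euc m}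
    (hf : DifferentiableAt ℝ f (slicePoint a b ω)) (A : Finset (Fin m)) :
    clCoord A (dunklSphericalDirac Rp κ f (slicePoint a b ω)) =
      sphDunkl (fun α : Rp => imPart α.1) (fun α => κ α.1) clMat
        (fun B ω => clCoord B (f (slicePoint a b ω))) A ω := by
  have e1 : ∀ i j B, angDeriv i j (fun ω => clCoord B (f (slicePoint a b ω))) ω =
      clCoord B (slicePoint a b ω i.succ • partialDeriv j.succ f (slicePoint a b ω) -
        slicePoint a b ω j.succ • partialDeriv i.succ f (slicePoint a b ω)) := fun i j B => by
    rw [← angDeriv_comp_slicePoint hf, angDeriv, angDeriv]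
    have hd := (clCoord B).hasFDerivAt.comp ω (hasFDerivAt_comp_slicePoint hf)
    have hd' : HasFDerivAt (fun ω => clCoord B (f (slicePoint a b ω))) _ ω := hd
    rw [hd'.fderiv, (hasFDerivAt_comp_slicePoint hf).fderiv]
    rfl
  have e2 : ∀ (α : Rp) B, sphRho (imPart α.1) (fun ω => clCoord B (f (slicePoint a b ω))) ω =
      b * clCoord B (rho α.1 f (slicePoint a b ω)) := fun α B => by
    rw [← smul_rho_imEmb _ hb hf, imEmb_imPart (h0 _ α.2)]
  have e3 : ∀ α : Rp, slicePoint a b (reflIso (imPart α.1) ω) = reflect α.1 (slicePoint a b ω) :=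
    fun α => by rw [← reflect_imEmb_slicePoint, imEmb_imPart (h0 _ α.2)]
  have e4 : ∀ (i j : Fin m) (u : Cl m), clCoord A (clE i * clE j * u) =
      ∑ B, (clMat i * clMat j) A B * clCoord B u := fun i j u => by
    rw [clCoord_mul, map_mul]
    rfl
  simp only [sphDunkl, e1, e2, e3]
  rw [dunklSphericalDirac, dunklPsi_eq, sphericalDirac_eq, dunklIndex, ← sum_coe_sort Rp κ]
  simp only [map_add, map_sub, map_smul, map_sum, e4, smul_eq_mul]
  rw [← sum_coe_sort Rp]
  simp only [← sum_coe_sort Rp (fun α => _ * clCoord _ (rho α f _)), imPart_apply, slicePoint_succ]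
  simp only [mul_add, sum_add_distrib]
  have e5 : ∀ (i j : Fin m) B, ∑ α : Rp, κ α.1 * (b * ω i * α.1 j.succ - b * ω j * α.1 i.succ) *
      clCoord B (rho α.1 f (slicePoint a b ω)) = ∑ α : Rp, κ α.1 * (ω i * α.1 j.succ - ω j *
      α.1 i.succ) * (b * clCoord B (rho α.1 f (slicePoint a b ω))) := fun i j B =>
    sum_congr rfl fun α _ => by ring
  simp only [e5]
  ring

end CliffordAlgebra

end

noncomputable section

set_option linter.unusedSectionVars false

open Finset

/-! ### Functions of the form `P + ω Q` on one sphere. -/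

section SphereAffine

variable {m : ℕ}

/-- The rotation generators span the tangent space: the sum equals `|ω|² u - ⟨u, ω⟩ ω`. -/
theorem eq_sum_smul_rotGen {ω u : Euc m} (hω : ‖ω‖ = 1) (hu : inner ℝ u ω = 0) :
    u = ∑ i, ∑ j, (ω i * u j) • rotGen i j ω := by
  have h1 : ∑ i, ω i ^ 2 = 1 := by rw [← EuclideanSpace.real_norm_sq_eq, hω, one_pow]
  have h2 : ∑ i, ω i * u i = 0 := by simpa [PiLp.inner_apply] using hu
  refine PiLp.ext fun l => ?_
  have h3 : ∀ i j, (ω i * u j) • rotGen i j ω = (ω i ^ 2) • (u j • EuclideanSpace.single j (1 : ℝ)) -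
      (ω j * u j) • (ω i • EuclideanSpace.single i (1 : ℝ)) := fun i j => by
    rw [rotGen_apply]
    module
  simp only [h3, sum_sub_distrib, ← smul_sum, ← sum_smul, h1, h2]
  simp [WithLp.ofLp_sum, Pi.single_apply]

theorem fderiv_eq_of_eqOn_sphere {W : Type*} [NormedAddCommGroup W] [NormedSpace ℝ W]
    {v w : Euc m → W} (hv : ∀ x ∈ Metric.sphere (0 : Euc m) 1, DifferentiableAt ℝ v x)
    (hw : ∀ x ∈ Metric.sphere (0 : Euc m) 1, DifferentiableAt ℝ w x)
    (h : ∀ x ∈ Metric.sphere (0 : Euc m) 1, v x = w x) {ω u : Euc m}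
    (hω : ω ∈ Metric.sphere (0 : Euc m) 1) (hu : inner ℝ u ω = 0) :
    fderiv ℝ v ω u = fderiv ℝ w ω u := by
  rw [eq_sum_smul_rotGen (mem_sphere_zero_iff_norm.1 hω) hu]
  simp only [map_sum, map_smul]
  exact sum_congr rfl fun i _ => sum_congr rfl fun j _ => congr_arg _
    (angDeriv_eq_of_eqOn_sphere hv hw h i j hω)

/-- The map `v ↦ v Q` for vectors `v`. -/
def vecMulRight (Q : Cl m) : Euc m →L[ℝ] Cl m := LinearMap.toContinuousLinearMap
  { toFun := fun v => clVec v * Q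
    map_add' := fun u v => by simp [clVec, add_smul, sum_add_distrib, add_mul]
    map_smul' := fun r v => by simp [clVec, mul_smul, ← smul_sum] }

theorem vecMulRight_apply (Q : Cl m) (v : Euc m) : vecMulRight Q v = clVec v * Q := rfl

theorem clVec_single (j : Fin m) : clVec (EuclideanSpace.single j (1 : ℝ) : Euc m) = clE j := by
  simp [clVec]

theorem clIm_slicePoint (a b : ℝ) (ω : Euc m) : clIm (slicePoint a b ω) = b • clVec ω := by
  simp [clIm, clVec, smul_sum, smul_smul]

theorem clVec_mul_clVec_mul (u : Euc m) (Q : Cl m) : clVec u * (clVec u * Q) = -(‖u‖ ^ 2) • Q := by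
  rw [← mul_assoc, clVec_mul_self, ← EuclideanSpace.real_norm_sq_eq, neg_mul, ← Algebra.smul_def,
    neg_smul]

theorem inner_smul_rho {W : Type*} [NormedAddCommGroup W] [NormedSpace ℝ W] (α : Paravec m)
    (f : Paravec m → W) (x : Paravec m) :
    (inner ℝ α x) • rho α f x = f x - f (reflect α x) := by
  rw [rho]
  split_ifs with h
  · simp [h, reflect]
  · rw [smul_smul, mul_inv_cancel₀ h, one_smul]

theorem inner_eq_sum_of_zero {α : Paravec m} (hα : α 0 = 0) (x : Paravec m) :
    inner ℝ α x = ∑ i : Fin m, x i.succ * α i.succ := by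
  simp [PiLp.inner_apply, Fin.sum_univ_succ, hα]

/-- The reflection part of the Dunkl-spherical Dirac operator. -/
theorem dunklPsi_eq_sum {Rp : Finset (Paravec m)} (h0 : ∀ α ∈ Rp, α 0 = 0) (κ : Paravec m → ℝ)
    (f : Paravec m → Cl m) (x : Paravec m) : dunklPsi Rp κ f x =
      -∑ α ∈ Rp, κ α • (clIm x * (clIm α * rho α f x) + f x) := by
  have h1 : ∀ α ∈ Rp, ∑ i : Fin m, ∑ j : Fin m, clE i * clE j *
      ((κ α * (x i.succ * α j.succ - x j.succ * α i.succ)) • rho α f x) =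
      (2 : ℝ) • κ α • (clIm x * (clIm α * rho α f x) + (f x - f (reflect α x))) := by
    intro α hα
    have h2 := sum_clE_mul_sub (m := m) (fun i => x i.succ) (fun i => α i.succ)
    have h4 : clIm x * (clIm α * rho α f x) + (f x - f (reflect α x)) =
        (clIm x * clIm α + algebraMap ℝ (Cl m) (∑ i : Fin m, x i.succ * α i.succ)) *
          rho α f x := by
      rw [← inner_smul_rho, inner_eq_sum_of_zero (h0 α hα),
        Algebra.smul_def (∑ i : Fin m, x i.succ * α i.succ), add_mul, mul_assoc]
    rw [h4, smul_comm, ← smul_mul_assoc, clIm, clIm, ← h2, sum_mul, smul_sum]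
    refine sum_congr rfl fun i _ => ?_
    rw [sum_mul, smul_sum]
    refine sum_congr rfl fun j _ => ?_
    rw [mul_smul_comm, smul_mul_assoc, smul_smul]
  rw [dunklPsi_eq]
  have h3 : ∑ i : Fin m, ∑ j : Fin m, clE i * clE j *
      (∑ α ∈ Rp, (κ α * (x i.succ * α j.succ - x j.succ * α i.succ)) • rho α f x) =
      ∑ α ∈ Rp, (2 : ℝ) • κ α • (clIm x * (clIm α * rho α f x) + (f x - f (reflect α x))) := by
    rw [← sum_congr rfl h1]
    simp only [mul_sum]
    exact Eq.symm (sum_comm.trans (sum_congr rfl fun i _ => sum_comm))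
  rw [h3, ← smul_sum, smul_smul, ← sum_neg_distrib, smul_sum, ← sum_sub_distrib]
  refine sum_congr rfl fun α _ => ?_
  module

variable {f : Paravec m → Cl m} {a b : ℝ} {P Q : Cl m}

/-- Only the values on the sphere matter, so `f` may be replaced by the affine map, whose angular
derivatives `sum_clE_mul_clE` contracts. -/
theorem sphericalDirac_of_eq_add
    (hf : ∀ ω : Euc m, ‖ω‖ = 1 → DifferentiableAt ℝ f (slicePoint a b ω))
    (h : ∀ ω : Euc m, ‖ω‖ = 1 → f (slicePoint a b ω) = P + clVec ω * Q)
    {ω : Euc m} (hω : ‖ω‖ = 1) :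
    sphericalDirac f (slicePoint a b ω) = ((m : ℝ) - 1) • (clVec ω * Q) := by
  have e : ∀ i j : Fin m, slicePoint a b ω i.succ • partialDeriv j.succ f (slicePoint a b ω) -
      slicePoint a b ω j.succ • partialDeriv i.succ f (slicePoint a b ω) =
      (ω i • clE j - ω j • clE i) * Q := fun i j => by
    have hL : ∀ x : Euc m, HasFDerivAt (fun ω => P + vecMulRight Q ω) (vecMulRight Q) x := fun x =>
      (vecMulRight Q).hasFDerivAt.const_add P
    rw [← angDeriv_comp_slicePoint (hf ω hω), angDeriv_eq_of_eqOn_sphere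
      (w := fun ω => P + vecMulRight Q ω) (fun x hx => (hasFDerivAt_comp_slicePoint
        (hf x (mem_sphere_zero_iff_norm.1 hx))).differentiableAt)
      (fun x _ => (hL x).differentiableAt) (fun x hx => h x (mem_sphere_zero_iff_norm.1 hx)) i j
      (mem_sphere_zero_iff_norm.2 hω), angDeriv, (hL ω).fderiv, rotGen_apply, map_sub, map_smul,
      map_smul, vecMulRight_apply, vecMulRight_apply, clVec_single, clVec_single, sub_mul,
      smul_mul_assoc, smul_mul_assoc]
  rw [sphericalDirac_eq]
  simp only [e, ← mul_assoc, ← sum_mul]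
  rw [sum_clE_mul_clE, smul_mul_assoc, smul_smul]
  congr 1
  ring

/-- The constant cancels in `f - f ∘ σ` and the pairing with `u` cancels against the denominator. On
the mirror, `u` is tangent to the sphere, so the derivative along it can be read off from the affine
map. -/
theorem rho_of_eq_add
    (hf : ∀ ω : Euc m, ‖ω‖ = 1 → DifferentiableAt ℝ f (slicePoint a b ω))
    (h : ∀ ω : Euc m, ‖ω‖ = 1 → f (slicePoint a b ω) = P + clVec ω * Q)
    (hb : b ≠ 0) {ω : Euc m} (hω : ‖ω‖ = 1) {u : Euc m} (hu : u ≠ 0) :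
    rho (imEmb u) f (slicePoint a b ω) = (2 / (b * ‖u‖ ^ 2)) • (clVec u * Q) := by
  have hu' : ‖u‖ ≠ 0 := norm_ne_zero_iff.2 hu
  rw [rho, inner_imEmb_slicePoint, norm_imEmb, reflect_imEmb_slicePoint]
  by_cases hi : inner ℝ u ω = 0
  · rw [if_pos (by rw [hi, mul_zero])]
    have hL : ∀ x : Euc m, HasFDerivAt (fun ω => P + vecMulRight Q ω) (vecMulRight Q) x := fun x =>
      (vecMulRight Q).hasFDerivAt.const_add P
    have h1 := fderiv_eq_of_eqOn_sphere (w := fun ω => P + vecMulRight Q ω)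
      (fun x hx => (hasFDerivAt_comp_slicePoint
        (hf x (mem_sphere_zero_iff_norm.1 hx))).differentiableAt)
      (fun x _ => (hL x).differentiableAt) (fun x hx => h x (mem_sphere_zero_iff_norm.1 hx))
      (mem_sphere_zero_iff_norm.2 hω) hi
    rw [(hasFDerivAt_comp_slicePoint (hf ω hω)).fderiv, (hL ω).fderiv, vecMulRight_apply] at h1
    rw [← h1]
    simp only [ContinuousLinearMap.comp_apply, _root_.smul_apply, map_smul, smul_smul]
    congr 1
    field_simp
  · have h2 : ‖reflIso u ω‖ = 1 := by rw [LinearIsometryEquiv.norm_map, hω]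
    have h3 : f (slicePoint a b ω) - f (slicePoint a b (reflIso u ω)) =
        (2 * inner ℝ u ω / ‖u‖ ^ 2) • (clVec u * Q) := by
      rw [h ω hω, h _ h2, ← vecMulRight_apply, ← vecMulRight_apply, reflIso_apply, map_sub, map_smul,
        vecMulRight_apply, vecMulRight_apply]
      abel
    rw [if_neg (mul_ne_zero hb hi), h3, smul_smul]
    congr 1
    field_simp

/-- The square of the root is `-|α|²` and removes the last trace of `α`; hence the independence of
the root. -/
theorem clVec_mul_rho_of_eq_add
    (hf : ∀ ω : Euc m, ‖ω‖ = 1 → DifferentiableAt ℝ f (slicePoint a b ω))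
    (h : ∀ ω : Euc m, ‖ω‖ = 1 → f (slicePoint a b ω) = P + clVec ω * Q)
    (hb : b ≠ 0) {ω : Euc m} (hω : ‖ω‖ = 1) {α : Paravec m}
    (h0 : α 0 = 0) (hα : α ≠ 0) : clIm α * rho α f (slicePoint a b ω) = -(2 / b) • Q := by
  have hu : imPart α ≠ 0 := fun hz => hα (by rw [← imEmb_imPart h0, hz, map_zero])
  have hu' : ‖imPart α‖ ≠ 0 := norm_ne_zero_iff.2 hu
  have h1 : clIm α = clVec (imPart α) := rfl
  have h2 := rho_of_eq_add hf h hb hω hu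
  rw [imEmb_imPart h0] at h2
  rw [h1, h2, mul_smul_comm, clVec_mul_clVec_mul, smul_smul]
  congr 1
  field_simp

theorem clIm_mul_clIm_mul_rho_of_eq_add
    (hf : ∀ ω : Euc m, ‖ω‖ = 1 → DifferentiableAt ℝ f (slicePoint a b ω))
    (h : ∀ ω : Euc m, ‖ω‖ = 1 → f (slicePoint a b ω) = P + clVec ω * Q)
    (hb : b ≠ 0) {ω : Euc m} (hω : ‖ω‖ = 1) {α : Paravec m}
    (h0 : α 0 = 0) (hα : α ≠ 0) : clIm (slicePoint a b ω) * (clIm α * rho α f (slicePoint a b ω)) =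
      -(2 : ℝ) • (clVec ω * Q) := by
  rw [clVec_mul_rho_of_eq_add hf h hb hω h0 hα, clIm_slicePoint, smul_mul_assoc, mul_smul_comm,
    smul_smul]
  congr 1
  field_simp

/-- The terms `γ f` cancel, and what remains is `(m - 1 + 2 γ) ω Q`. -/
theorem dunklSphericalDirac_of_eq_add
    (hf : ∀ ω : Euc m, ‖ω‖ = 1 → DifferentiableAt ℝ f (slicePoint a b ω))
    (h : ∀ ω : Euc m, ‖ω‖ = 1 → f (slicePoint a b ω) = P + clVec ω * Q)
    (hb : b ≠ 0) {ω : Euc m} (hω : ‖ω‖ = 1)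
    {Rp : Finset (Paravec m)} (h0 : ∀ α ∈ Rp, α 0 = 0) (hne : ∀ α ∈ Rp, α ≠ 0) {κ : Paravec m → ℝ}
    (hγ : dunklIndex Rp κ = (1 - (m : ℝ)) / 2) :
    dunklSphericalDirac Rp κ f (slicePoint a b ω) = 0 := by
  rw [dunklSphericalDirac, dunklPsi_eq_sum h0, sphericalDirac_of_eq_add hf h hω]
  have h1 : ∑ α ∈ Rp, κ α • (clIm (slicePoint a b ω) * (clIm α * rho α f (slicePoint a b ω)) +
      f (slicePoint a b ω)) = dunklIndex Rp κ • (-(2 : ℝ) • (clVec ω * Q) + f (slicePoint a b ω)) := by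
    rw [dunklIndex, sum_smul]
    exact sum_congr rfl fun α hα => by
      rw [clIm_mul_clIm_mul_rho_of_eq_add hf h hb hω (h0 α hα) (hne α hα)]
  rw [h1, hγ]
  module
theorem clIm_mul_sphericalDeriv (h : ∀ ω : Euc m, ‖ω‖ = 1 → f (slicePoint a b ω) = P + clVec ω * Q)
    (hb : b ≠ 0) {ω : Euc m} (hω : ‖ω‖ = 1) :
    clIm (slicePoint a b ω) * sphericalDeriv f (slicePoint a b ω) = clVec ω * Q := by
  have hsq : clIm (slicePoint a b ω) * clIm (slicePoint a b ω) = -(b ^ 2) • 1 := by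
    have h1 := clVec_mul_clVec_mul ω (1 : Cl m)
    rw [mul_one, hω] at h1
    rw [clIm_slicePoint, smul_mul_smul_comm, h1, smul_smul]
    congr 1
    ring
  have hunit : IsUnit (clIm (slicePoint a b ω)) := by
    refine ⟨⟨clIm (slicePoint a b ω), -(b ^ 2)⁻¹ • clIm (slicePoint a b ω), ?_, ?_⟩, rfl⟩
    · rw [mul_smul_comm, hsq, smul_smul, neg_mul_neg, inv_mul_cancel₀ (pow_ne_zero 2 hb), one_smul]
    · rw [smul_mul_assoc, hsq, smul_smul, neg_mul_neg, inv_mul_cancel₀ (pow_ne_zero 2 hb), one_smul]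
  have hn : clVec (-ω : Euc m) * Q = -(clVec ω * Q) := by
    rw [← vecMulRight_apply, map_neg, vecMulRight_apply]
  rw [sphericalDeriv, Ring.mul_inverse_cancel_left _ _ hunit, paraConj_slicePoint, h ω hω,
    h (-ω) (by rw [norm_neg, hω]), hn]
  module

/-- An analytic solution of the Dunkl-spherical Dirac equation is the sum of a constant and of a
multiple of the vector variable on each sphere. -/
theorem exists_eq_add_of_dunklSphericalDirac_eq_zero (hm : m ≠ 0) {Rp : Finset (Paravec m)}
    (h0 : ∀ α ∈ Rp, α 0 = 0) (hne : ∀ α ∈ Rp, α ≠ 0) {κ : Paravec m → ℝ}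
    (hγ : dunklIndex Rp κ = (1 - (m : ℝ)) / 2) (hb : b ≠ 0)
    (hf : ∀ ω : Euc m, ‖ω‖ = 1 → AnalyticAt ℝ f (slicePoint a b ω))
    (h : ∀ ω : Euc m, ‖ω‖ = 1 → dunklSphericalDirac Rp κ f (slicePoint a b ω) = 0) :
    ∃ P Q : Cl m, ∀ ω : Euc m, ‖ω‖ = 1 → f (slicePoint a b ω) = P + clVec ω * Q := by
  obtain ⟨v, w, hvw⟩ := exists_eq_add_of_sphDunkl_eq_zero (α := fun α : Rp => imPart α.1)
    (k := fun α : Rp => κ α.1) (c := clMat) (G := fun B ω => clCoord B (f (slicePoint a b ω))) hm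
    isCliffordFamily_clMat
    (fun α hz => hne α.1 α.2 (by rw [← imEmb_imPart (h0 α.1 α.2)]; rw [hz, map_zero]))
    (by rw [← hγ, dunklIndex, ← sum_coe_sort Rp κ])
    (fun A x hx => (clCoord A).analyticAt _ |>.comp
      (analyticAt_comp_slicePoint (hf x (mem_sphere_zero_iff_norm.1 hx))))
    (fun x hx A => by
      have hx' := mem_sphere_zero_iff_norm.1 hx
      rw [← clCoord_dunklSphericalDirac h0 κ hb (hf x hx').differentiableAt, h x hx', map_zero])
  refine ⟨(clBasis m).equivFun.symm v, (clBasis m).equivFun.symm w, fun ω hω => clCoord_ext fun A => ?_⟩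
  rw [hvw ω (mem_sphere_zero_iff_norm.2 hω) A, map_add, clCoord_mul]
  have hc : ∀ (v : Finset (Fin m) → ℝ) A, clCoord A ((clBasis m).equivFun.symm v) = v A :=
    fun v A => congr_fun ((clBasis m).equivFun.apply_symm_apply v) A
  have hmat : Algebra.leftMulMatrix (clBasis m) (clVec ω) = ∑ i, ω i • clMat i := by
    simp only [clVec, map_sum, map_smul, clMat]
  simp only [hc, hmat]
  rfl

end SphereAffine

/-! ### Slice functions as families of affine functions on spheres, and the theorem. -/

section Main

variable {m : ℕ} {D : Set ℂ} {f : Paravec m → Cl m}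

theorem slicePoint_mem {a b : ℝ} {ω : Euc m} (hω : ‖ω‖ = 1) (h : (⟨a, b⟩ : ℂ) ∈ D) :
    slicePoint a b ω ∈ circularization m D := ⟨a, b, ω, hω, h, rfl⟩

theorem slicePoint_not_mem_realAxis (a : ℝ) {b : ℝ} (hb : b ≠ 0) {ω : Euc m} (hω : ‖ω‖ = 1) :
    slicePoint a b ω ∉ realAxis m := by
  intro h
  have h1 : ω = 0 := PiLp.ext fun j => by
    have := h j
    rw [slicePoint_succ] at this
    exact (mul_eq_zero.1 this).resolve_left hb
  rw [h1, norm_zero] at hω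
  exact zero_ne_one hω

theorem exists_eq_slicePoint (hDsymm : ∀ z ∈ D, starRingEnd ℂ z ∈ D) {x : Paravec m}
    (hx : x ∈ circularization m D) : ∃ ω : Euc m, ‖ω‖ = 1 ∧
      x = slicePoint (x 0) (imNorm x) ω ∧ (⟨x 0, imNorm x⟩ : ℂ) ∈ D := by
  obtain ⟨a, b, ω, hω, hab, rfl⟩ := hx
  rw [imNorm_slicePoint a b hω, slicePoint_zero]
  rcases le_total 0 b with hb | hb
  · exact ⟨ω, hω, by rw [abs_of_nonneg hb], by rwa [abs_of_nonneg hb]⟩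
  · refine ⟨-ω, by rwa [norm_neg], by rw [abs_of_nonpos hb, slicePoint_neg_neg], ?_⟩
    rw [abs_of_nonpos hb]
    exact hDsymm _ hab

theorem exists_eq_slicePoint_pos (hDsymm : ∀ z ∈ D, starRingEnd ℂ z ∈ D) {x : Paravec m}
    (hx : x ∈ circularization m D \ realAxis m) : ∃ (a b : ℝ) (ω : Euc m), 0 < b ∧ ‖ω‖ = 1 ∧
      (⟨a, b⟩ : ℂ) ∈ D ∧ x = slicePoint a b ω := by
  obtain ⟨ω, hω, hxω, hD⟩ := exists_eq_slicePoint hDsymm hx.1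
  refine ⟨_, _, ω, (Real.sqrt_nonneg _).lt_of_ne fun h0 => hx.2 fun j => ?_, hω, hD, hxω⟩
  have h0' : imNorm x = 0 := h0.symm
  rw [hxω, h0', slicePoint_succ, zero_mul]

theorem IsSliceOn.exists_eq_add (hf : IsSliceOn D f) {a b : ℝ} (hb : 0 < b)
    (hab : (⟨a, b⟩ : ℂ) ∈ D) :
    ∃ P Q : Cl m, ∀ ω : Euc m, ‖ω‖ = 1 → f (slicePoint a b ω) = P + clVec ω * Q := by
  obtain ⟨A, B, -, h⟩ := hf
  refine ⟨A ⟨a, b⟩, B ⟨a, b⟩, fun ω hω => ?_⟩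
  have h1 := h _ (slicePoint_mem hω hab) ω hω
  rw [imNorm_slicePoint a b hω, slicePoint_zero, abs_of_pos hb] at h1
  exact h1 rfl

/-- The stem components are the even part and, up to the factor `-ω₀`, the odd part of `f` at the
antipodal points `a ± ω₀ b`. Since `b ↦ -b` exchanges these points, the symmetry of the stem
function is automatic. -/
theorem isSliceOn_of_forall_exists (hm : m ≠ 0)
    (h : ∀ a b : ℝ, b ≠ 0 → (⟨a, b⟩ : ℂ) ∈ D → ∃ P Q : Cl m, ∀ ω : Euc m, ‖ω‖ = 1 →
      f (slicePoint a b ω) = P + clVec ω * Q) (hDsymm : ∀ z ∈ D, starRingEnd ℂ z ∈ D) :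
    IsSliceOn D f := by
  obtain ⟨ω₀, hω₀⟩ : ∃ ω₀ : Euc m, ‖ω₀‖ = 1 :=
    ⟨EuclideanSpace.single ⟨0, Nat.pos_of_ne_zero hm⟩ 1, by simp⟩
  refine ⟨fun z => (1 / 2 : ℝ) • (f (slicePoint z.re z.im ω₀) + f (slicePoint z.re z.im (-ω₀))),
    fun z => -(1 / 2 : ℝ) • (clVec ω₀ * (f (slicePoint z.re z.im ω₀) -
      f (slicePoint z.re z.im (-ω₀)))), fun z _ => ⟨?_, ?_⟩, fun x hx ω hω hxω => ?_⟩
  · simp only [Complex.conj_re, Complex.conj_im, slicePoint_neg, neg_neg]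
    rw [add_comm]
  · simp only [Complex.conj_re, Complex.conj_im, slicePoint_neg, neg_neg]
    rw [← neg_sub, mul_neg, smul_neg]
  · obtain ⟨ω', hω', hxω', hD⟩ := exists_eq_slicePoint hDsymm hx
    -- On the real axis `a + ω b` does not depend on `ω`: the odd part is zero and the even part is
    -- the value of `f`.
    by_cases hb : imNorm x = 0
    · have h1 : ∀ ω : Euc m, slicePoint (x 0) (imNorm x) ω = x := fun ω => by
        conv_rhs => rw [hxω']
        rw [hb, slicePoint_eq _ 0 ω, slicePoint_eq _ 0 ω', zero_smul, zero_smul]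
      simp only [h1, sub_self, mul_zero, smul_zero, add_zero]
      module
    · obtain ⟨P, Q, hPQ⟩ := h _ _ hb hD
      have hn : clVec (-ω₀ : Euc m) * Q = -(clVec ω₀ * Q) := by
        rw [← vecMulRight_apply, map_neg, vecMulRight_apply]
      have h1 := hPQ ω hω
      rw [← hxω] at h1
      rw [h1]
      simp only [hPQ ω₀ hω₀, hPQ (-ω₀) (by rw [norm_neg, hω₀]), hn]
      have h2 : clVec ω₀ * (P + clVec ω₀ * Q - (P + -(clVec ω₀ * Q))) = -(2 : ℝ) • Q := by
        have e : P + clVec ω₀ * Q - (P + -(clVec ω₀ * Q)) = (2 : ℝ) • (clVec ω₀ * Q) := by module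
        rw [e, mul_smul_comm, clVec_mul_clVec_mul, hω₀]
        module
      rw [h2, smul_smul]
      norm_num
      module

end Main

end

theorem mainTheorem2 (m : ℕ) (R Rp : Finset (Paravec m)) (hR : IsRootSystem R)
    (hR0 : ∀ α ∈ R, α 0 = 0) (hRp : IsPositiveSubsystem R Rp)
    (κ : Paravec m → ℝ) (hκ : IsMultiplicity R κ)
    (hγ : dunklIndex Rp κ = (1 - (m : ℝ)) / 2) (hsing : κ ∉ singularSet Rp)
    (D : Set ℂ) (hD : IsOpen D) (hDsymm : ∀ z ∈ D, starRingEnd ℂ z ∈ D)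
    (f : Paravec m → Cl m) (hf : AnalyticOnNhd ℝ f (circularization m D)) :
    (IsSliceOn D f ↔
      ∀ x ∈ circularization m D \ realAxis m, dunklSphericalDirac Rp κ f x = 0) ∧
    (IsSliceOn D f → ∀ x ∈ circularization m D \ realAxis m,
      (∀ α ∈ R,
        sphericalDirac f x = dunklIndex Rp κ • (clIm x * (clIm α * rho α f x)) ∧
        dunklIndex Rp κ • (clIm x * (clIm α * rho α f x)) =
          -(2 * dunklIndex Rp κ) • (clIm x * sphericalDeriv f x)) ∧
      ∀ α ∈ R, ∀ β ∈ R, clIm α * rho α f x = clIm β * rho β f x) := by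
    classical
  have hsub : ∀ α ∈ Rp, α ∈ R := fun α hα => by
    obtain ⟨v, -, hv⟩ := hRp
    exact ((hv α).1 hα).1
  have h0 : ∀ α ∈ Rp, α 0 = 0 := fun α hα => hR0 α (hsub α hα)
  have hne : ∀ α ∈ Rp, α ≠ 0 := fun α hα => hR.ne_zero α (hsub α hα)
  -- For `m = 0` there are no roots, so the index would be `0` and not `1 / 2`.
  have hm : m ≠ 0 := by
    rintro rfl
    have hRp0 : Rp = ∅ := Finset.eq_empty_of_forall_notMem fun α hα =>
      hne α hα (PiLp.ext fun i => by rw [Fin.fin_one_eq_zero i]; exact h0 α hα)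
    rw [hRp0, dunklIndex, Finset.sum_empty] at hγ
    norm_num at hγ
  have hdiff : ∀ a b : ℝ, (⟨a, b⟩ : ℂ) ∈ D → ∀ ω : EuclideanSpace ℝ (Fin m), ‖ω‖ = 1 →
      AnalyticAt ℝ f (slicePoint a b ω) := fun a b hab ω hω => hf _ (slicePoint_mem hω hab)
  refine ⟨⟨fun hs x hx => ?_, fun h => ?_⟩, fun hs x hx => ?_⟩
  · obtain ⟨a, b, ω, hb, hω, hab, rfl⟩ := exists_eq_slicePoint_pos hDsymm hx
    obtain ⟨P, Q, hPQ⟩ := hs.exists_eq_add hb hab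
    exact dunklSphericalDirac_of_eq_add (fun ω hω => (hdiff a b hab ω hω).differentiableAt) hPQ
      hb.ne' hω h0 hne hγ
  · exact isSliceOn_of_forall_exists hm (fun a b hb hab =>
      exists_eq_add_of_dunklSphericalDirac_eq_zero hm h0 hne hγ hb (hdiff a b hab) fun ω hω =>
        h _ ⟨slicePoint_mem hω hab, slicePoint_not_mem_realAxis a hb hω⟩) hDsymm
  · obtain ⟨a, b, ω, hb, hω, hab, rfl⟩ := exists_eq_slicePoint_pos hDsymm hx
    obtain ⟨P, Q, hPQ⟩ := hs.exists_eq_add hb hab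
    have hd := fun ω hω => (hdiff a b hab ω hω).differentiableAt
    refine ⟨fun α hα => ?_, fun α hα β hβ => ?_⟩
    · rw [clIm_mul_clIm_mul_rho_of_eq_add hd hPQ hb.ne' hω (hR0 α hα) (hR.ne_zero α hα),
        sphericalDirac_of_eq_add hd hPQ hω, clIm_mul_sphericalDeriv hPQ hb.ne' hω, hγ]
      constructor <;> module
    · rw [clVec_mul_rho_of_eq_add hd hPQ hb.ne' hω (hR0 α hα) (hR.ne_zero α hα),
        clVec_mul_rho_of_eq_add hd hPQ hb.ne' hω (hR0 β hβ) (hR.ne_zero β hβ)]
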